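/- Let $n\ge 2$, and let $G=SO_0(n,1)$ act on the closed unit ball $\overline{\mathbb B}{}^n\subset\mathbb R^n$ by the projective action $\mathrm{proj}$, i.e. by the projective transformations induced by matrices on the affine hyperplane $t=1$ of $\mathbb R^{n+1}$ with the form $x_1^2+\dots+x_n^2-t^2$; on the open ball this is the isometric action on $\mathbb H^n$ in the Klein model. An \emph{analytic compactification} of the isometric action is a homeomorphism $\varphi$ of $\overline{\mathbb B}{}^n$ that restricts to a real analytic diffeomorphism of the open ball and is such that for every $g\in G$ the map $\varphi^{-1}\circ\mathrm{proj}_g\circ\varphi$ on the open ball has a real analytic extension to $\overline{\mathbb B}{}^n$; these extensions form an action of $G$ on $\overline{\mathbb B}{}^n$. Two compactifications are \emph{analytically conjugate} if a real analytic diffeomorphism of $\overline{\mathbb B}{}^n$ intertwines their actions. A \emph{half-space chart} is an analytic diffeomorphism from $\overline{\mathbb B}{}^n$ minus one boundary point onto the closed half-space $\{(x_1,\dots,x_{n-1},y)\in\mathbb R^n : y\ge 0\}$; let $\mathcal{KC}$ be the half-space chart $$(x,y)\longmapsto\left(\frac{x}{1-y},\frac{1-|x|^2-y^2}{(1-y)^2}\right),\qquad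 x\in\mathbb R^{n-1},$$ of $\overline{\mathbb B}{}^n$ minus $(0,\dots,0,1)$. For a positive integer $p$, a compactification $\varphi$ is said to be \emph{given by $\varphi_p$} if, for some half-space chart at the source and the chart $\mathcal{KC}$ at the goal, it is the map $\varphi_p:(x_1,\dots,x_{n-1},y)\mapsto(x_1,\dots,x_{n-1},y^p)$ and sends the point missed by the first chart to the point missed by the second. Then: 1. for every positive integer $p$ there is an analytic compactification given by $\varphi_p$ whose action $G\times\overline{\mathbb B}{}^n\to\overline{\mathbb B}{}^n$ is real analytic; 2. for positive integers $p,q$, an analytic compactification given by $\varphi_p$ and one given by $\varphi_q$ are analytically conjugate if and only if $p=q$; 3. if $n\ge 3$, then for every analytic compactification there is exactly one positive integer $p$ such that it is analytically conjugate to an analytic compactification given by $\varphi_p$. -/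

import Mathlib

open scoped ContDiff Matrix

namespace HypBall

noncomputable section

/-- Euclidean space `ℝⁿ`. -/
abbrev E (n : ℕ) : Type := EuclideanSpace ℝ (Fin n)

/-- The closed unit ball of `ℝⁿ`. -/
abbrev CBall (n : ℕ) : Type := {x : E n // x ∈ Metric.closedBall (0 : E n) 1}

/-- Indices of `ℝⁿ⁺¹ = ℝⁿ × ℝ`; the last coordinate, `Sum.inr ()`, is the timelike one. -/
abbrev Idx (n : ℕ) : Type := Fin n ⊕ Unit

/-- The Gram matrix `diag(1, …, 1, -1)` of the Lorentzian quadratic form. -/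
abbrev J (n : ℕ) : Matrix (Idx n) (Idx n) ℝ :=
  LieAlgebra.Orthogonal.indefiniteDiagonal (Fin n) Unit ℝ

/-! ### Elementary facts on Lorentz matrices -/

theorem cone_pos {n : ℕ} (a b : Fin n → ℝ) (s t : ℝ) (hs : 0 < s) (ht : 0 < t)
    (ha : ∑ j, a j ^ 2 < s ^ 2) (hb : ∑ j, b j ^ 2 ≤ t ^ 2) :
    0 < ∑ j, a j * b j + s * t := by
  have cs := Finset.sum_mul_sq_le_sq_mul_sq Finset.univ a b
  have h0 : 0 ≤ ∑ j, a j ^ 2 := Finset.sum_nonneg fun _ _ => sq_nonneg _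
  have h1 : (∑ j, a j * b j) ^ 2 < (s * t) ^ 2 := by
    calc (∑ j, a j * b j) ^ 2 ≤ (∑ j, a j ^ 2) * ∑ j, b j ^ 2 := cs
      _ ≤ (∑ j, a j ^ 2) * t ^ 2 := by gcongr
      _ < s ^ 2 * t ^ 2 := by gcongr
      _ = (s * t) ^ 2 := by ring
  have h2 := abs_lt_of_sq_lt_sq' h1 (by positivity)
  linarith [h2.1]

theorem J_mul_J (n : ℕ) : J n * J n = 1 := by
  rw [J, LieAlgebra.Orthogonal.indefiniteDiagonal, Matrix.diagonal_mul_diagonal,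
    ← Matrix.diagonal_one]
  congr 1
  ext i
  rcases i with i | i <;> simp

theorem lorentz_transpose {n : ℕ} {A : Matrix (Idx n) (Idx n) ℝ} (h : Aᵀ * J n * A = J n) :
    A * J n * Aᵀ = J n := by
  have h1 : (J n * Aᵀ * J n) * A = 1 := by
    calc J n * Aᵀ * J n * A = J n * (Aᵀ * J n * A) := by simp only [Matrix.mul_assoc]
      _ = 1 := by rw [h, J_mul_J]
  have h2 := mul_eq_one_comm.mp h1
  calc A * J n * Aᵀ = A * (J n * Aᵀ * J n) * J n := by
        simp only [Matrix.mul_assoc, J_mul_J, Matrix.mul_one]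
    _ = J n := by rw [h2, Matrix.one_mul]

theorem lorentz_row {n : ℕ} {A : Matrix (Idx n) (Idx n) ℝ} (h : Aᵀ * J n * A = J n) :
    ∑ j, A (.inr ()) (.inl j) ^ 2 = A (.inr ()) (.inr ()) ^ 2 - 1 := by
  have := congrFun (congrFun (lorentz_transpose h) (.inr ())) (.inr ())
  rw [J, LieAlgebra.Orthogonal.indefiniteDiagonal, Matrix.mul_apply] at this
  simp [Matrix.mul_diagonal, Fintype.sum_sum_type] at this
  simp only [sq]
  linarith

theorem lorentz_col {n : ℕ} {A : Matrix (Idx n) (Idx n) ℝ} (h : Aᵀ * J n * A = J n) :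
    ∑ j, A (.inl j) (.inr ()) ^ 2 = A (.inr ()) (.inr ()) ^ 2 - 1 := by
  have := congrFun (congrFun h (.inr ())) (.inr ())
  rw [J, LieAlgebra.Orthogonal.indefiniteDiagonal, Matrix.mul_apply] at this
  simp [Matrix.mul_diagonal, Fintype.sum_sum_type] at this
  simp only [sq]
  linarith

/-- The group `SO₀(n,1)`: real matrices of determinant `1` that preserve the form
`x₁² + ⋯ + xₙ² - t²` and the direction of time. -/
def SO₀ (n : ℕ) : Subgroup (Matrix.SpecialLinearGroup (Idx n) ℝ) where
  carrier := {A | A.1ᵀ * J n * A.1 = J n ∧ 0 < A.1 (.inr ()) (.inr ())}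
  one_mem' := by simp
  mul_mem' := by
    rintro A B ⟨hA, hA'⟩ ⟨hB, hB'⟩
    refine ⟨?_, ?_⟩
    · calc (A * B).1ᵀ * J n * (A * B).1 = B.1ᵀ * (A.1ᵀ * J n * A.1) * B.1 := by
            simp [Matrix.transpose_mul, Matrix.mul_assoc]
        _ = J n := by rw [hA, hB]
    · have := cone_pos (fun j => A.1 (.inr ()) (.inl j)) (fun j => B.1 (.inl j) (.inr ())) _ _
        hA' hB' (by rw [lorentz_row hA]; linarith) (by rw [lorentz_col hB]; linarith)
      simpa [Matrix.mul_apply, Fintype.sum_sum_type] using this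
  inv_mem' := by
    rintro A ⟨hA, hA'⟩
    have h1 : (J n * A.1ᵀ * J n) * A.1 = 1 := by
      calc J n * A.1ᵀ * J n * A.1 = J n * (A.1ᵀ * J n * A.1) := by simp only [Matrix.mul_assoc]
        _ = 1 := by rw [hA, J_mul_J]
    have h2 : (A⁻¹).1 = J n * A.1ᵀ * J n := by
      have h3 : A.1 * (A⁻¹).1 = 1 := by
        rw [← Matrix.SpecialLinearGroup.coe_mul, mul_inv_cancel, Matrix.SpecialLinearGroup.coe_one]
      calc (A⁻¹).1 = (J n * A.1ᵀ * J n) * A.1 * (A⁻¹).1 := by rw [h1, Matrix.one_mul]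
        _ = J n * A.1ᵀ * J n := by rw [Matrix.mul_assoc, h3, Matrix.mul_one]
    refine ⟨?_, ?_⟩
    · rw [h2]
      have h4 := lorentz_transpose hA
      have h5 : (J n)ᵀ = J n := by
        rw [J, LieAlgebra.Orthogonal.indefiniteDiagonal, Matrix.diagonal_transpose]
      simp only [Matrix.transpose_mul, Matrix.transpose_transpose, h5]
      calc J n * (A.1 * J n) * J n * (J n * A.1ᵀ * J n)
          = J n * (A.1 * J n * (J n * J n) * A.1ᵀ) * J n := by simp only [Matrix.mul_assoc]
        _ = J n := by rw [J_mul_J, Matrix.mul_one, h4, J_mul_J, Matrix.one_mul]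
    · rw [h2, J, LieAlgebra.Orthogonal.indefiniteDiagonal]
      simpa [Matrix.mul_diagonal, Matrix.diagonal_mul] using hA'

/-! ### The projective action on the closed ball -/

/-- The point `(x, 1)` of `ℝⁿ⁺¹`. -/
def lift {n : ℕ} (x : E n) : Idx n → ℝ := Sum.elim x (fun _ => 1)

/-- The projective transformation of `ℝⁿ`, seen as the affine hyperplane `t = 1` of `ℝⁿ⁺¹`,
that is induced by the matrix `A` (through central projection from the origin). -/
def projFun {n : ℕ} (A : Matrix (Idx n) (Idx n) ℝ) (x : E n) : E n :=
  WithLp.toLp 2 fun i => (A *ᵥ lift x) (.inl i) / (A *ᵥ lift x) (.inr ())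

theorem den_pos {n : ℕ} (g : SO₀ n) (x : CBall n) : 0 < (g.1.1 *ᵥ lift x.1) (.inr ()) := by
  have hx : ∑ j, x.1 j ^ 2 ≤ (1 : ℝ) ^ 2 := by
    have h := x.2
    rw [mem_closedBall_zero_iff] at h
    rw [← EuclideanSpace.real_norm_sq_eq]
    gcongr
  have := cone_pos (fun j => g.1.1 (.inr ()) (.inl j)) (fun j => x.1 j) _ 1 g.2.2 one_pos
    (by rw [lorentz_row g.2.1]; linarith) hx
  simpa [Matrix.mulVec, dotProduct, Fintype.sum_sum_type, lift] using this

theorem quad_mulVec {n : ℕ} (g : SO₀ n) (v : Idx n → ℝ) :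
    ∑ j, (g.1.1 *ᵥ v) (.inl j) ^ 2 - (g.1.1 *ᵥ v) (.inr ()) ^ 2
      = ∑ j, v (.inl j) ^ 2 - v (.inr ()) ^ 2 := by
  have key : ∀ w : Idx n → ℝ, ∑ j, w (.inl j) ^ 2 - w (.inr ()) ^ 2 = w ⬝ᵥ (J n *ᵥ w) := by
    intro w
    rw [J, LieAlgebra.Orthogonal.indefiniteDiagonal]
    simp [dotProduct, Matrix.mulVec_diagonal, Fintype.sum_sum_type, sq]
    ring
  rw [key, key]
  conv_rhs => rw [← g.2.1]
  rw [← Matrix.mulVec_mulVec, ← Matrix.mulVec_mulVec, Matrix.mulVec_transpose,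
    dotProduct_comm v, ← Matrix.dotProduct_mulVec, dotProduct_comm]

theorem projFun_mem {n : ℕ} (g : SO₀ n) (x : CBall n) :
    projFun g.1.1 x.1 ∈ Metric.closedBall (0 : E n) 1 := by
  have hd := den_pos g x
  have hx : ∑ j, x.1 j ^ 2 ≤ 1 := by
    have h := x.2
    rw [mem_closedBall_zero_iff] at h
    rw [← EuclideanSpace.real_norm_sq_eq]
    nlinarith [norm_nonneg x.1]
  have hq := quad_mulVec g (lift x.1)
  have e1 : ∀ j, lift x.1 (.inl j) = x.1 j := fun _ => rfl
  have e2 : lift x.1 (.inr ()) = 1 := rfl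
  simp only [e1, e2] at hq
  rw [mem_closedBall_zero_iff, ← sq_le_one_iff₀ (norm_nonneg _), EuclideanSpace.real_norm_sq_eq]
  simp only [projFun, div_pow]
  rw [← Finset.sum_div, div_le_one (by positivity)]
  linarith

theorem lift_projFun {n : ℕ} (g : SO₀ n) (x : CBall n) :
    lift (projFun g.1.1 x.1)
      = ((g.1.1 *ᵥ lift x.1) (.inr ()))⁻¹ • (g.1.1 *ᵥ lift x.1) := by
  have hd := (den_pos g x).ne'
  ext i
  rcases i with i | i
  · simp [lift, projFun, div_eq_inv_mul]
  · simp only [lift, Sum.elim_inr, Pi.smul_apply, smul_eq_mul]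
    exact (inv_mul_cancel₀ hd).symm

theorem projFun_mul {n : ℕ} (g h : SO₀ n) (x : CBall n) :
    projFun (g * h).1.1 x.1 = projFun g.1.1 (projFun h.1.1 x.1) := by
  have hd := (den_pos h x).ne'
  ext i
  have e : (g * h).1.1 = g.1.1 * h.1.1 := rfl
  conv_lhs => rw [projFun]
  conv_rhs => rw [projFun]
  simp only [lift_projFun, Matrix.mulVec_smul, Pi.smul_apply, smul_eq_mul, e,
    Matrix.mulVec_mulVec]
  rw [mul_div_mul_left _ _ (inv_ne_zero hd)]

theorem projFun_one {n : ℕ} (x : E n) : projFun (1 : Matrix (Idx n) (Idx n) ℝ) x = x := by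
  ext i
  simp [projFun, lift]

theorem continuous_projFun {n : ℕ} (g : SO₀ n) :
    Continuous fun x : CBall n => (⟨projFun g.1.1 x.1, projFun_mem g x⟩ : CBall n) := by
  refine Continuous.subtype_mk ?_ _
  refine (PiLp.continuous_toLp 2 _).comp (continuous_pi fun i => ?_)
  have hl : Continuous fun x : CBall n => lift x.1 := by
    refine continuous_pi fun j => ?_
    rcases j with j | j
    · simp only [lift, Sum.elim_inl]
      fun_prop
    · simp only [lift, Sum.elim_inr]
      fun_prop
  have hm : Continuous fun x : CBall n => g.1.1 *ᵥ lift x.1 := continuous_const.matrix_mulVec hl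
  exact ((continuous_apply _).comp hm).div ((continuous_apply _).comp hm)
    fun x => (den_pos g x).ne'

/-- The projective action of `SO₀(n,1)` on the closed ball; on the open ball it is the isometric
action on hyperbolic space in the Klein model. -/
def proj (n : ℕ) : SO₀ n →* (CBall n ≃ₜ CBall n) where
  toFun g :=
    { toFun := fun x => ⟨projFun g.1.1 x.1, projFun_mem g x⟩
      invFun := fun x => ⟨projFun (g⁻¹).1.1 x.1, projFun_mem g⁻¹ x⟩
      left_inv := fun x => Subtype.ext <| by
        have h := projFun_mul g⁻¹ g x
        rw [inv_mul_cancel] at h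
        exact h.symm.trans (projFun_one x.1)
      right_inv := fun x => Subtype.ext <| by
        have h := projFun_mul g g⁻¹ x
        rw [mul_inv_cancel] at h
        exact h.symm.trans (projFun_one x.1)
      continuous_toFun := continuous_projFun g
      continuous_invFun := continuous_projFun g⁻¹ }
  map_one' := Homeomorph.ext fun x => Subtype.ext (projFun_one x.1)
  map_mul' g h := Homeomorph.ext fun x => Subtype.ext (projFun_mul g h x)

/-! ### Compactifications -/

/-- The action `g ↦ φ⁻¹ ∘ proj_g ∘ φ` of `SO₀(n,1)` on the closed ball. -/
def conjAction {n : ℕ} (φ : CBall n ≃ₜ CBall n) : SO₀ n →* (CBall n ≃ₜ CBall n) where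
  toFun g := φ.trans ((proj n g).trans φ.symm)
  map_one' := Homeomorph.ext fun x => by simp
  map_mul' g h := Homeomorph.ext fun x => by simp

/-- On the part `s` of the closed ball, the self-map `f` of the closed ball is real analytic.
(`AnalyticOn` on a set that is not open: near each point of the set, the map is given by a
convergent power series of the ambient space, so that it extends analytically beyond the
boundary.) -/
def AnalyticBallMapOn {n : ℕ} (f : CBall n → CBall n) (s : Set (E n)) : Prop :=
  ∃ F : E n → E n, AnalyticOn ℝ F s ∧ ∀ x : CBall n, x.1 ∈ s → F x.1 = f x

/-- `h` is an analytic diffeomorphism of the closed ball. -/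
def IsAnalyticDiffeo {n : ℕ} (h : CBall n ≃ₜ CBall n) : Prop :=
  AnalyticBallMapOn h (Metric.closedBall 0 1) ∧ AnalyticBallMapOn h.symm (Metric.closedBall 0 1)

/-- An analytic compactification of the isometric action: a homeomorphism `φ` of the closed ball
that restricts to an analytic diffeomorphism of the open ball onto itself and is such that each
`φ⁻¹ ∘ proj_g ∘ φ`, on the open ball, has an analytic extension to the closed ball (this extension
is then the map `conjAction φ g`, by continuity). -/
structure IsCompactification {n : ℕ} (φ : CBall n ≃ₜ CBall n) : Prop where
  interior : ∀ x : CBall n, ‖(φ x).1‖ < 1 ↔ ‖x.1‖ < 1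
  analytic : AnalyticBallMapOn φ (Metric.ball 0 1)
  analytic_symm : AnalyticBallMapOn φ.symm (Metric.ball 0 1)
  extension : ∀ g : SO₀ n, ∃ F : E n → E n, AnalyticOn ℝ F (Metric.closedBall 0 1) ∧
    ∀ x : CBall n, ‖x.1‖ < 1 → F x.1 = (φ.symm (proj n g (φ x))).1

/-- The action `conjAction φ` is analytic jointly in the group element (through its matrix
entries) and in the point of the closed ball. -/
def IsAnalyticAction {n : ℕ} (φ : CBall n ≃ₜ CBall n) : Prop :=
  ∃ F : (Idx n → Idx n → ℝ) × E n → E n,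
    AnalyticOn ℝ F
      (Set.range (fun (g : SO₀ n) (i j : Idx n) => g.1.1 i j) ×ˢ Metric.closedBall (0 : E n) 1) ∧
    ∀ (g : SO₀ n) (x : CBall n), F (fun i j => g.1.1 i j, x.1) = (conjAction φ g x).1

/-- The actions of `SO₀(n,1)` given by `φ` and `ψ` are conjugate by an analytic diffeomorphism of
the closed ball. -/
def AnalyticallyConjugate {n : ℕ} (φ ψ : CBall n ≃ₜ CBall n) : Prop :=
  ∃ h : CBall n ≃ₜ CBall n, IsAnalyticDiffeo h ∧
    ∀ (g : SO₀ n) (x : CBall n), h (conjAction φ g x) = conjAction ψ g (h x)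

/-! ### Half-space charts

In the closed half-space, the coordinate `y` is the coordinate of index `0`. -/

/-- A half-space chart of the closed ball: an analytic diffeomorphism from the closed ball minus
one boundary point onto the closed half-space. -/
structure HalfSpaceChart (n : ℕ) [NeZero n] where
  pole : E n
  norm_pole : ‖pole‖ = 1
  equiv : PartialEquiv (E n) (E n)
  source_eq : equiv.source = Metric.closedBall 0 1 \ {pole}
  target_eq : equiv.target = {z | 0 ≤ z 0}
  analytic : AnalyticOn ℝ equiv equiv.source
  analytic_symm : AnalyticOn ℝ equiv.symm equiv.target

/-- `(x, y) ↦ (x / (1 - y), (1 - |x|² - y²) / (1 - y)²)`. -/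
def kleinFun {n : ℕ} [NeZero n] (v : E n) : E n :=
  WithLp.toLp 2 fun i => if i = 0 then (1 - ‖v‖ ^ 2) / (1 - v 0) ^ 2 else v i / (1 - v 0)

/-- The inverse of `kleinFun`. -/
def kleinInv {n : ℕ} [NeZero n] (z : E n) : E n :=
  WithLp.toLp 2 fun i =>
    if i = 0 then 1 - 2 / (1 + (‖z‖ ^ 2 - z 0 ^ 2) + z 0)
    else 2 / (1 + (‖z‖ ^ 2 - z 0 ^ 2) + z 0) * z i

theorem norm_sq_split {n : ℕ} [NeZero n] (v : E n) :
    ‖v‖ ^ 2 = v 0 ^ 2 + ∑ i ∈ Finset.univ.erase (0 : Fin n), v i ^ 2 := by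
  rw [EuclideanSpace.real_norm_sq_eq,
    Finset.add_sum_erase _ (fun i => v i ^ 2) (Finset.mem_univ (0 : Fin n))]

theorem coord_lt_one {n : ℕ} [NeZero n] {v : E n} (hv : ‖v‖ ≤ 1)
    (hne : v ≠ EuclideanSpace.single (0 : Fin n) (1 : ℝ)) : v 0 < 1 := by
  by_contra! hc
  apply hne
  have h1 := norm_sq_split v
  have h0 : 0 ≤ ∑ i ∈ Finset.univ.erase (0 : Fin n), v i ^ 2 :=
    Finset.sum_nonneg fun _ _ => sq_nonneg _
  have h2 : ‖v‖ ^ 2 ≤ 1 := by nlinarith [norm_nonneg v]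
  have h3 : v 0 = 1 := by nlinarith
  have h4 : ∑ i ∈ Finset.univ.erase (0 : Fin n), v i ^ 2 = 0 := by nlinarith
  rw [Finset.sum_eq_zero_iff_of_nonneg fun _ _ => sq_nonneg _] at h4
  ext i
  by_cases hi : i = 0
  · subst hi
    simp [h3]
  · have := h4 i (by simp [hi])
    simpa [hi] using this

theorem den_klein_pos {n : ℕ} [NeZero n] {z : E n} (hz : 0 ≤ z 0) :
    0 < 1 + (‖z‖ ^ 2 - z 0 ^ 2) + z 0 := by
  have h1 := norm_sq_split z
  have h0 : 0 ≤ ∑ i ∈ Finset.univ.erase (0 : Fin n), z i ^ 2 :=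
    Finset.sum_nonneg fun _ _ => sq_nonneg _
  linarith

theorem norm_sq_kleinFun {n : ℕ} [NeZero n] {v : E n} :
    ‖kleinFun v‖ ^ 2 - kleinFun v 0 ^ 2 = (‖v‖ ^ 2 - v 0 ^ 2) / (1 - v 0) ^ 2 := by
  rw [norm_sq_split, norm_sq_split v, add_sub_cancel_left, add_sub_cancel_left, Finset.sum_div]
  refine Finset.sum_congr rfl fun i hi => ?_
  simp [kleinFun, (Finset.mem_erase.mp hi).1, div_pow]

theorem norm_sq_kleinInv {n : ℕ} [NeZero n] {z : E n} :
    ‖kleinInv z‖ ^ 2 - kleinInv z 0 ^ 2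
      = (2 / (1 + (‖z‖ ^ 2 - z 0 ^ 2) + z 0)) ^ 2 * (‖z‖ ^ 2 - z 0 ^ 2) := by
  conv_lhs => rw [norm_sq_split, add_sub_cancel_left]
  have h : ‖z‖ ^ 2 - z 0 ^ 2 = ∑ i ∈ Finset.univ.erase (0 : Fin n), z i ^ 2 := by
    rw [norm_sq_split z, add_sub_cancel_left]
  conv_rhs => rw [h]
  rw [Finset.mul_sum]
  refine Finset.sum_congr rfl fun i hi => ?_
  simp [kleinInv, (Finset.mem_erase.mp hi).1, mul_pow, ← h]

theorem one_sub_norm_sq_kleinInv {n : ℕ} [NeZero n] {z : E n} (hz : 0 ≤ z 0) :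
    1 - ‖kleinInv z‖ ^ 2 = 4 * z 0 / (1 + (‖z‖ ^ 2 - z 0 ^ 2) + z 0) ^ 2 := by
  have h := norm_sq_kleinInv (z := z)
  have hd := (den_klein_pos hz).ne'
  have h0 : kleinInv z 0 = 1 - 2 / (1 + (‖z‖ ^ 2 - z 0 ^ 2) + z 0) := by simp [kleinInv]
  rw [h0] at h
  have h' : ‖kleinInv z‖ ^ 2 = (2 / (1 + (‖z‖ ^ 2 - z 0 ^ 2) + z 0)) ^ 2 * (‖z‖ ^ 2 - z 0 ^ 2)
      + (1 - 2 / (1 + (‖z‖ ^ 2 - z 0 ^ 2) + z 0)) ^ 2 := by linarith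
  rw [h']
  generalize ‖z‖ ^ 2 - z 0 ^ 2 = m at hd ⊢
  field_simp
  ring

theorem kleinInv_kleinFun {n : ℕ} [NeZero n] {v : E n} (hv : v 0 < 1) :
    kleinInv (kleinFun v) = v := by
  have hu : (1 - v 0) ≠ 0 := by linarith
  have h0 : kleinFun v 0 = (1 - ‖v‖ ^ 2) / (1 - v 0) ^ 2 := by simp [kleinFun]
  have hs : 2 / (1 + (‖kleinFun v‖ ^ 2 - kleinFun v 0 ^ 2) + kleinFun v 0) = 1 - v 0 := by
    have : 1 + (‖kleinFun v‖ ^ 2 - kleinFun v 0 ^ 2) + kleinFun v 0 = 2 / (1 - v 0) := by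
      rw [norm_sq_kleinFun, h0]
      field_simp
      ring
    rw [this]
    field_simp
  ext i
  simp only [kleinInv, hs]
  by_cases hi : i = 0
  · subst hi
    simp
  · simp only [hi, if_false, kleinFun]
    field_simp

theorem kleinFun_kleinInv {n : ℕ} [NeZero n] {z : E n} (hz : 0 ≤ z 0) :
    kleinFun (kleinInv z) = z := by
  have hd := (den_klein_pos hz).ne'
  have h0 : 1 - kleinInv z 0 = 2 / (1 + (‖z‖ ^ 2 - z 0 ^ 2) + z 0) := by simp [kleinInv]
  ext i
  simp only [kleinFun, h0]
  by_cases hi : i = 0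
  · subst hi
    simp only [if_true, one_sub_norm_sq_kleinInv hz]
    field_simp
    ring
  · simp only [hi, if_false, kleinInv]
    field_simp

/-- The chart of the closed ball, minus the point `(0, …, 0, 1)`, in which the projective action is
read. -/
def kleinChart (n : ℕ) [NeZero n] : HalfSpaceChart n where
  pole := EuclideanSpace.single (0 : Fin n) (1 : ℝ)
  norm_pole := by simp
  equiv :=
    { toFun := kleinFun
      invFun := kleinInv
      source := Metric.closedBall 0 1 \ {EuclideanSpace.single (0 : Fin n) (1 : ℝ)}
      target := {z | 0 ≤ z 0}
      map_source' := by
        rintro v ⟨hv, -⟩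
        rw [mem_closedBall_zero_iff] at hv
        have : ‖v‖ ^ 2 ≤ 1 := by nlinarith [norm_nonneg v]
        change 0 ≤ kleinFun v 0
        simp only [kleinFun, if_true]
        exact div_nonneg (by linarith) (sq_nonneg _)
      map_target' := by
        intro z hz
        have hz : 0 ≤ z 0 := hz
        have hd := den_klein_pos hz
        refine ⟨?_, ?_⟩
        · have h1 := one_sub_norm_sq_kleinInv hz
          have h2 : 0 ≤ 4 * z 0 / (1 + (‖z‖ ^ 2 - z 0 ^ 2) + z 0) ^ 2 := by positivity
          rw [mem_closedBall_zero_iff, ← sq_le_one_iff₀ (norm_nonneg _)]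
          linarith
        · intro h
          have h1 : kleinInv z 0 = 1 := by
            rw [Set.mem_singleton_iff.mp h]
            simp
          have h2 : kleinInv z 0 = 1 - 2 / (1 + (‖z‖ ^ 2 - z 0 ^ 2) + z 0) := by simp [kleinInv]
          have h3 : 0 < 2 / (1 + (‖z‖ ^ 2 - z 0 ^ 2) + z 0) := by positivity
          linarith
      left_inv' := by
        rintro v ⟨hv, hne⟩
        rw [mem_closedBall_zero_iff] at hv
        exact kleinInv_kleinFun (coord_lt_one hv hne)
      right_inv' := fun z hz => kleinFun_kleinInv hz }
  source_eq := rfl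
  target_eq := rfl
  analytic := by
    rintro v ⟨hv, hne⟩
    rw [mem_closedBall_zero_iff] at hv
    have hu : 1 - v 0 ≠ 0 := by linarith [coord_lt_one hv hne]
    refine (ContDiffAt.analyticAt (contDiffAt_euclidean.mpr fun i => ?_)).analyticWithinAt
    have h1 : ContDiffAt ℝ ω (fun x : E n => x i) v := by fun_prop
    have h2 : ContDiffAt ℝ ω (fun x : E n => 1 - x 0) v := by fun_prop
    have h3 : ContDiffAt ℝ ω (fun x : E n => 1 - ‖x‖ ^ 2) v :=
      contDiffAt_const.sub (contDiff_norm_sq ℝ).contDiffAt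
    by_cases hi : i = 0
    · simp only [kleinFun, hi, if_true]
      exact h3.div (h2.pow 2) (pow_ne_zero 2 hu)
    · simp only [kleinFun, hi, if_false]
      exact h1.div h2 hu
  analytic_symm := by
    intro z hz
    have hd := (den_klein_pos hz).ne'
    refine (ContDiffAt.analyticAt (contDiffAt_euclidean.mpr fun i => ?_)).analyticWithinAt
    have h0 : ContDiffAt ℝ ω (fun x : E n => x 0) z := by fun_prop
    have h1 : ContDiffAt ℝ ω (fun x : E n => x i) z := by fun_prop
    have h2 : ContDiffAt ℝ ω (fun x : E n => 2 / (1 + (‖x‖ ^ 2 - x 0 ^ 2) + x 0)) z :=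
      contDiffAt_const.div ((contDiffAt_const.add
        ((contDiff_norm_sq ℝ).contDiffAt.sub (h0.pow 2))).add h0) hd
    change ContDiffAt ℝ ω (fun x : E n => kleinInv x i) z
    by_cases hi : i = 0
    · simp only [kleinInv, hi, if_true]
      exact contDiffAt_const.sub h2
    · simp only [kleinInv, hi, if_false]
      exact h2.mul h1

/-- The map `φ_p : (x, y) ↦ (x, y ^ p)`. -/
def powerMap {n : ℕ} [NeZero n] (p : ℕ) (z : E n) : E n :=
  WithLp.toLp 2 (Function.update (WithLp.ofLp z) 0 (z 0 ^ p))

/-- The homeomorphism `φ` of the closed ball is the map `φ_p` when it is read in the half-space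
charts `c` (at the source) and `c'` (at the goal); it sends the point missed by `c` to the one
missed by `c'`. -/
def IsPowerMapIn {n : ℕ} [NeZero n] (c c' : HalfSpaceChart n) (p : ℕ)
    (φ : CBall n ≃ₜ CBall n) : Prop :=
  ∀ x : CBall n, (x.1 = c.pole → (φ x).1 = c'.pole) ∧
    (x.1 ≠ c.pole → (φ x).1 ≠ c'.pole ∧ c'.equiv (φ x).1 = powerMap p (c.equiv x.1))

/-- `φ` is an analytic compactification given by `φ_p`, for some half-space chart at the source
and for the chart `kleinChart` at the goal. -/
def IsPowerCompactification {n : ℕ} [NeZero n] (p : ℕ) (φ : CBall n ≃ₜ CBall n) : Prop :=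
  IsCompactification φ ∧ ∃ c : HalfSpaceChart n, IsPowerMapIn c (kleinChart n) p φ

end

end HypBall

open HypBall

/-!
A compactification `ψ` is studied in the half-space coordinates of the chart `kleinFun` at the goal.
There the group contains the horizontal translations (`transSO`) and inversions (`signSO`), and the
action is transitive on the open ball. Three facts carry the theorem.

*Existence.* The radial homeomorphism `radialMap p` of the ball, for which `1 - ‖φ v‖ ^ 2` equals
`(1 - ‖v‖ ^ 2) ^ p`, is given by `φ_p`. An element of `SO₀ n` multiplies `1 - ‖x‖ ^ 2` by a positive
analytic function, so the conjugated action involves fractional powers of positive functions only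
(`radialAction`) and is analytic up to the boundary.

*Uniqueness of the exponent.* A homeomorphism that intertwines the actions of `φ` and `ψ` is
`ψ⁻¹ ∘ φ`, because a map that commutes with the projective action fixes the only common fixed point
of the sign changes, hence is the identity by transitivity (`eq_of_intertwines`). Between
compactifications given by `φ_p` and by `φ_q`, this map reads `y ↦ y ^ (p / q)` on the heights, and
both it and its inverse can be analytic only if `p = q` (`analyticallyConjugate_iff`).

*Classification, for `n ≥ 3`.* The vertical axis of the half-space is the set of fixed points of a
finite group of sign changes. Linearizing this group at the boundary shows that the axis is an
analytic curve `γ` of the compactification, transverse to the boundary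
(`exists_curve_of_finite_group`, `exists_axis_curve`). Translating `γ` by horizontal vectors `b` gives
a map `(b, s) ↦ R_b (γ s)` that is jointly analytic for `s > 0`, and analytic in `s ≥ 0` for each
`b`. A Hartogs type theorem, proved through Baire's theorem and a two-constants estimate, makes it
jointly analytic at some boundary point (`exists_analyticAt_of_separately`), hence at all of them by
homogeneity. It is a local diffeomorphism (`injective_fderiv_parametrization`), so that the
compactification has local coordinates which are the half-space ones up to a change of variable `f`
of the height. An inversion expresses `f` through horizontal coordinates, so `f` is analytic up to
the boundary (`analyticWithinAt_height`) and there of the form `κ ^ p` with an analytic change of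
variable `κ`. Replacing the height by its `p`-th root yields the half-space chart, first near one
boundary point and then, by translations, everywhere
(`isPowerCompactification_of_analyticWithinAt`).
-/

/-! ### Two-constants estimates on the disc -/

open Metric Set Filter Topology in
/-- The case of the upper half disc of `norm_le_of_norm_le_on_reals`. The harmonic function
`x ^ 2 - y ^ 2 + 2 * y`, which is the real part of `z ^ 2 - 2 * I * z`, is nonnegative on the
diameter, at least `1` on the half circle, and at most `3 * ‖z‖`: it bounds the harmonic measure of
the half circle, and the maximum principle applies to `f z * exp (-log (A / B) * (z ^ 2 - 2 * I * z))`.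
-/
theorem norm_le_of_norm_le_on_reals_of_im_nonneg {f : ℂ → ℂ}
    (hf : DiffContOnCl ℂ f (ball 0 1)) {A B : ℝ} (hB : 0 < B) (hAB : B ≤ A)
    (hA : ∀ z, ‖z‖ ≤ 1 → ‖f z‖ ≤ A) (hr : ∀ x : ℝ, |x| ≤ 1 → ‖f x‖ ≤ B)
    {z : ℂ} (hz : ‖z‖ ≤ 1) (hz' : 0 ≤ z.im) : ‖f z‖ ≤ B * (A / B) ^ (3 * ‖z‖) := by
  have hA0 : 0 < A := hB.trans_le hAB
  set L : ℝ := Real.log (A / B) with hL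
  have hL0 : 0 ≤ L := Real.log_nonneg ((one_le_div hB).mpr hAB)
  have hexp : Real.exp (-L) * A = B := by
    rw [hL, Real.exp_neg, Real.exp_log (by positivity)]
    field_simp
  set u : ℂ → ℝ := fun w => w.re ^ 2 - w.im ^ 2 + 2 * w.im with hu
  set F : ℂ → ℂ := fun w => f w * Complex.exp (-(L : ℂ) * (w ^ 2 - 2 * Complex.I * w)) with hF
  have hnF : ∀ w, ‖F w‖ = ‖f w‖ * Real.exp (-L * u w) := by
    intro w
    rw [hF]
    simp only [norm_mul, Complex.norm_exp]
    congr 2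
    simp [hu, sq, Complex.mul_re, Complex.mul_im]
  -- the bound on the boundary of the upper half disc
  have hbd : ∀ w : ℂ, ‖w‖ ≤ 1 → (w.im = 0 ∨ (0 ≤ w.im ∧ ‖w‖ = 1)) → ‖F w‖ ≤ B := by
    intro w hw h
    rw [hnF]
    have hn : ‖w‖ ^ 2 = w.re ^ 2 + w.im ^ 2 := by
      rw [← Complex.normSq_eq_norm_sq, Complex.normSq_apply]; ring
    rcases h with h | ⟨h, h1⟩
    · have hwr : w = (w.re : ℂ) := Complex.ext (by simp) (by simp [h])
      have h2 : |w.re| ≤ 1 := (Complex.abs_re_le_norm w).trans hw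
      have h3 : ‖f w‖ ≤ B := by rw [hwr]; exact hr _ h2
      have h4 : Real.exp (-L * u w) ≤ 1 := by
        rw [Real.exp_le_one_iff]
        have : 0 ≤ u w := by simp only [hu, h]; nlinarith [sq_nonneg w.re]
        nlinarith
      calc _ ≤ B * 1 := by gcongr
        _ = B := mul_one B
    · have h2 : w.im ≤ 1 := (Complex.im_le_norm w).trans hw
      have h3 : 1 ≤ u w := by
        simp only [hu]
        rw [h1] at hn
        nlinarith
      have h4 : Real.exp (-L * u w) ≤ Real.exp (-L) := by
        rw [Real.exp_le_exp]
        nlinarith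
      calc _ ≤ A * Real.exp (-L) := by
            gcongr
            exact hA w hw
        _ = B := by rw [mul_comm, hexp]
  have hmain : ‖F z‖ ≤ B := by
    by_cases hb : z.im = 0 ∨ (0 ≤ z.im ∧ ‖z‖ = 1)
    · exact hbd z hz hb
    push Not at hb
    have hzim : 0 < z.im := lt_of_le_of_ne hz' (Ne.symm hb.1)
    have hz1 : ‖z‖ < 1 := lt_of_le_of_ne hz (hb.2 hz')
    set U : Set ℂ := ball 0 1 ∩ {w | 0 < w.im} with hU
    have hUo : IsOpen U := isOpen_ball.inter (isOpen_lt continuous_const Complex.continuous_im)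
    have hUb : Bornology.IsBounded U := isBounded_ball.subset inter_subset_left
    have hcl : closure U ⊆ {w | ‖w‖ ≤ 1 ∧ 0 ≤ w.im} := by
      refine closure_minimal ?_ ((isClosed_le continuous_norm continuous_const).inter
        (isClosed_le continuous_const Complex.continuous_im))
      rintro w ⟨hw, hw'⟩
      exact ⟨(mem_ball_zero_iff.mp hw).le, le_of_lt hw'⟩
    refine Complex.norm_le_of_forall_mem_frontier_norm_le hUb ?_ ?_
      (subset_closure ⟨mem_ball_zero_iff.mpr hz1, hzim⟩)
    · refine DiffContOnCl.smul (hf.mono inter_subset_left)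
        (Differentiable.diffContOnCl ?_)
      fun_prop
    · intro w hw
      have h1 := hcl (frontier_subset_closure hw)
      refine hbd w h1.1 ?_
      by_contra! hcon
      apply hw.2
      rw [hUo.interior_eq]
      exact ⟨mem_ball_zero_iff.mpr (lt_of_le_of_ne h1.1 (hcon.2 h1.2)),
        lt_of_le_of_ne h1.2 (Ne.symm hcon.1)⟩
  rw [hnF] at hmain
  have hub : u z ≤ 3 * ‖z‖ := by
    have h1 : z.im ≤ ‖z‖ := Complex.im_le_norm z
    have hn : ‖z‖ ^ 2 = z.re ^ 2 + z.im ^ 2 := by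
      rw [← Complex.normSq_eq_norm_sq, Complex.normSq_apply]; ring
    simp only [hu]
    nlinarith [norm_nonneg z]
  calc ‖f z‖ = ‖f z‖ * Real.exp (-L * u z) * Real.exp (L * u z) := by
        rw [mul_assoc, ← Real.exp_add]
        simp
    _ ≤ B * Real.exp (L * (3 * ‖z‖)) := by gcongr
    _ = B * (A / B) ^ (3 * ‖z‖) := by rw [Real.rpow_def_of_pos (by positivity)]

open Metric Set in
/-- A two-constants theorem: a holomorphic function on the disc that is bounded by `A`, and by the
smaller `B` on the real diameter, is almost bounded by `B` near the centre. -/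
theorem norm_le_of_norm_le_on_reals {f : ℂ → ℂ}
    (hf : DiffContOnCl ℂ f (ball 0 1)) {A B : ℝ} (hB : 0 < B) (hAB : B ≤ A)
    (hA : ∀ z, ‖z‖ ≤ 1 → ‖f z‖ ≤ A) (hr : ∀ x : ℝ, |x| ≤ 1 → ‖f x‖ ≤ B)
    {z : ℂ} (hz : ‖z‖ ≤ 1) : ‖f z‖ ≤ B * (A / B) ^ (3 * ‖z‖) := by
  rcases le_total 0 z.im with h | h
  · exact norm_le_of_norm_le_on_reals_of_im_nonneg hf hB hAB hA hr hz h
  · have hd : DiffContOnCl ℂ (fun w => f (-w)) (ball 0 1) := by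
      refine hf.comp (g := fun w : ℂ => -w) differentiable_neg.diffContOnCl ?_
      intro w hw
      simpa using hw
    have := norm_le_of_norm_le_on_reals_of_im_nonneg (z := -z) hd hB hAB
      (fun w hw => hA _ (by simpa using hw))
      (fun x hx => by simpa using hr (-x) (by simpa using hx)) (by simpa using hz)
      (by simpa using h)
    simpa using this

open Metric Set in
/-- Cauchy's estimates, combined with the two-constants theorem: the coefficients of a power series
are controlled by its size `B` on the real segment `[-1, 1]`, with only a small power of the bound
`A` on the complex disc. -/
theorem abs_coeff_le_of_abs_tsum_le {c : ℕ → ℝ} {A B ρ : ℝ} (hB : 0 < B) (hAB : B ≤ A)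
    (hs : Summable fun j => |c j|) (hA : ∑' j, |c j| ≤ A)
    (hr : ∀ x : ℝ, |x| ≤ 1 → |∑' j, c j * x ^ j| ≤ B) (hρ : 0 < ρ) (hρ1 : ρ ≤ 1) (j : ℕ) :
    |c j| ≤ B * (A / B) ^ (3 * ρ) / ρ ^ j := by
  set f : ℂ → ℂ := fun z => ∑' j, (c j : ℂ) * z ^ j with hfdef
  have hle : ∀ (j : ℕ) (z : ℂ), ‖z‖ ≤ 1 → ‖(c j : ℂ) * z ^ j‖ ≤ |c j| := by
    intro j z hz
    rw [norm_mul, norm_pow, Complex.norm_real, Real.norm_eq_abs]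
    exact mul_le_of_le_one_right (abs_nonneg _) (pow_le_one₀ (norm_nonneg _) hz)
  have hf : DiffContOnCl ℂ f (ball 0 1) := by
    refine ⟨Complex.differentiableOn_tsum_of_summable_norm hs (fun i => by fun_prop) isOpen_ball
      fun i w hw => hle i w (mem_ball_zero_iff.mp hw).le, ?_⟩
    rw [closure_ball _ one_ne_zero]
    exact continuousOn_tsum (fun i => by fun_prop) hs
      fun i w hw => hle i w (mem_closedBall_zero_iff.mp hw)
  have hfA : ∀ z, ‖z‖ ≤ 1 → ‖f z‖ ≤ A := fun z hz =>
    (tsum_of_norm_bounded hs.hasSum fun i => hle i z hz).trans hA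
  have hfr : ∀ x : ℝ, |x| ≤ 1 → ‖f x‖ ≤ B := by
    intro x hx
    have : f x = ((∑' j, c j * x ^ j : ℝ) : ℂ) := by
      rw [hfdef, Complex.ofReal_tsum]
      simp
    rw [this, Complex.norm_real]
    exact hr x hx
  have hA0 : 0 < A := hB.trans_le hAB
  have hcau := Complex.norm_iteratedDeriv_le_of_forall_mem_sphere_norm_le (c := 0) (f := f) (R := ρ)
    (C := B * (A / B) ^ (3 * ρ)) j hρ (hf.mono (ball_subset_ball hρ1)) (by
      intro z hz
      have h1 : ‖z‖ = ρ := mem_sphere_zero_iff_norm.mp hz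
      have := norm_le_of_norm_le_on_reals hf hB hAB hfA hfr (z := z) (h1.trans_le hρ1)
      rwa [h1] at this)
  have hps : HasFPowerSeriesOnBall f
      (FormalMultilinearSeries.ofScalars ℂ (fun j => (c j : ℂ))) 0 1 := by
    refine ⟨?_, one_pos, ?_⟩
    · have := FormalMultilinearSeries.le_radius_of_summable_norm
        (FormalMultilinearSeries.ofScalars ℂ (fun j => (c j : ℂ))) (r := 1) (by
          simpa [FormalMultilinearSeries.ofScalars_norm] using hs)
      simpa using this
    · intro y hy
      have hy1 : ‖y‖ ≤ 1 := by
        have : y ∈ Metric.ball (0 : ℂ) 1 := by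
          rwa [← Metric.eball_ofReal, ENNReal.ofReal_one]
        exact (mem_ball_zero_iff.mp this).le
      rw [zero_add]
      have := (Summable.of_norm_bounded hs fun i => hle i y hy1).hasSum
      simpa [FormalMultilinearSeries.ofScalars_apply_eq, mul_comm] using this
  have h2 := hps.factorial_smul 1 j
  have h3 : iteratedDeriv j f 0 = (j.factorial : ℂ) * c j := by
    rw [iteratedDeriv_eq_iteratedFDeriv, ← h2]
    simp
  rw [h3, norm_mul, Complex.norm_real, Complex.norm_natCast, mul_div_assoc] at hcau
  exact le_of_mul_le_mul_left hcau (by positivity)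

/-- The vector-valued form of `abs_coeff_le_of_abs_tsum_le`, through norming functionals. -/
theorem norm_coeff_le_of_norm_tsum_le {F : Type*} [NormedAddCommGroup F] [NormedSpace ℝ F]
    [CompleteSpace F] {c : ℕ → F} {A B ρ : ℝ} (hB : 0 < B) (hAB : B ≤ A)
    (hs : Summable fun j => ‖c j‖) (hA : ∑' j, ‖c j‖ ≤ A)
    (hr : ∀ x : ℝ, |x| ≤ 1 → ‖∑' j, x ^ j • c j‖ ≤ B) (hρ : 0 < ρ) (hρ1 : ρ ≤ 1) (j : ℕ) :
    ‖c j‖ ≤ B * (A / B) ^ (3 * ρ) / ρ ^ j := by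
  obtain ⟨g, hg, hgj⟩ := exists_dual_vector'' ℝ (c j)
  have hle : ∀ y : F, |g y| ≤ ‖y‖ := fun y =>
    (g.le_opNorm y).trans (mul_le_of_le_one_left (norm_nonneg _) hg)
  have hs' : Summable fun j => |g (c j)| :=
    Summable.of_nonneg_of_le (fun _ => abs_nonneg _) (fun i => hle _) hs
  have := abs_coeff_le_of_abs_tsum_le (c := fun j => g (c j)) hB hAB hs'
    ((hs'.tsum_le_tsum (fun i => hle _) hs).trans hA) (by
      intro x hx
      have h1 : Summable fun j => x ^ j • c j := by
        refine Summable.of_norm_bounded hs fun i => ?_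
        rw [norm_smul, norm_pow]
        exact mul_le_of_le_one_left (norm_nonneg _) (pow_le_one₀ (abs_nonneg _) hx)
      have h2 : ∑' j, g (c j) * x ^ j = g (∑' j, x ^ j • c j) := by
        rw [g.map_tsum h1]
        simp [mul_comm]
      rw [h2]
      exact (hle _).trans (hr x hx)) hρ hρ1 j
  rw [hgj] at this
  simpa using this

/-! ### Polarization and real analytic convergence -/

section

/-- Orthogonality of signs: only bijections contribute to the polarization formula. -/
theorem sum_sign_mul_prod_comp {m : ℕ} (r : Fin m → Fin m) :
    ∑ ε : Fin m → ℤˣ, (∏ i, ((ε i : ℤ) : ℝ)) * ∏ i, ((ε (r i) : ℤ) : ℝ)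
      = if Function.Bijective r then 2 ^ m else 0 := by
  classical
  have h1 : ∀ ε : Fin m → ℤˣ, (∏ i, ((ε i : ℤ) : ℝ)) * ∏ i, ((ε (r i) : ℤ) : ℝ)
      = ∏ i, ((ε i : ℤ) : ℝ) ^ (1 + (Finset.univ.filter fun k => r k = i).card) := by
    intro ε
    have : ∏ i, ((ε (r i) : ℤ) : ℝ)
        = ∏ i, ((ε i : ℤ) : ℝ) ^ (Finset.univ.filter fun k => r k = i).card := by
      rw [← Finset.prod_fiberwise' Finset.univ r (fun i => ((ε i : ℤ) : ℝ))]
      simp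
    rw [this, ← Finset.prod_mul_distrib]
    simp [pow_add]
  simp_rw [h1]
  rw [← Fintype.prod_sum
    (fun i (e : ℤˣ) => ((e : ℤ) : ℝ) ^ (1 + (Finset.univ.filter fun k => r k = i).card))]
  have h2 : ∀ k : ℕ, ∑ e : ℤˣ, ((e : ℤ) : ℝ) ^ k = 1 + (-1) ^ k := by
    intro k
    rw [UnitsInt.univ]
    simp
  simp_rw [h2]
  split_ifs with hb
  · have : ∀ i, (Finset.univ.filter fun k => r k = i).card = 1 := by
      intro i
      rw [Finset.card_eq_one]
      obtain ⟨k, hk⟩ := hb.2 i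
      refine ⟨k, ?_⟩
      ext l
      simp only [Finset.mem_filter, Finset.mem_univ, true_and, Finset.mem_singleton]
      exact ⟨fun h => hb.1 (h.trans hk.symm), fun h => h ▸ hk⟩
    simp_rw [this]
    norm_num
  · have : ¬ Function.Surjective r := fun h => hb ⟨Finite.injective_iff_surjective.mpr h, h⟩
    simp only [Function.Surjective, not_forall] at this
    obtain ⟨i, hi⟩ := this
    refine Finset.prod_eq_zero (Finset.mem_univ i) ?_
    have : (Finset.univ.filter fun k => r k = i) = ∅ := by
      ext k
      simpa using fun h => hi ⟨k, h⟩
    rw [this]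
    norm_num

variable {V F : Type*} [NormedAddCommGroup V] [NormedSpace ℝ V] [NormedAddCommGroup F]
  [NormedSpace ℝ F]

/-- The polarization formula: the symmetrization of a multilinear map from its values on the
diagonal. -/
theorem sum_sign_smul_map_diag {m : ℕ} (T : V [×m]→L[ℝ] F) (v : Fin m → V) :
    ∑ ε : Fin m → ℤˣ, (∏ i, ((ε i : ℤ) : ℝ)) • T (fun _ => ∑ i, ((ε i : ℤ) : ℝ) • v i)
      = (2 : ℝ) ^ m • ∑ σ : Equiv.Perm (Fin m), T fun i => v (σ i) := by
  classical
  have h1 : ∀ ε : Fin m → ℤˣ, T (fun _ => ∑ i, ((ε i : ℤ) : ℝ) • v i)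
      = ∑ r : Fin m → Fin m, (∏ i, ((ε (r i) : ℤ) : ℝ)) • T fun i => v (r i) := by
    intro ε
    rw [T.map_sum]
    refine Finset.sum_congr rfl fun r _ => ?_
    rw [T.map_smul_univ (fun i => ((ε (r i) : ℤ) : ℝ))]
  simp_rw [h1, Finset.smul_sum]
  rw [Finset.sum_comm]
  have h2 : ∀ r : Fin m → Fin m,
      ∑ ε : Fin m → ℤˣ, (∏ i, ((ε i : ℤ) : ℝ)) • (∏ i, ((ε (r i) : ℤ) : ℝ)) • T (fun i => v (r i))
      = if Function.Bijective r then (2 : ℝ) ^ m • T (fun i => v (r i)) else 0 := by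
    intro r
    simp_rw [smul_smul]
    rw [← Finset.sum_smul, sum_sign_mul_prod_comp]
    split_ifs <;> simp
  simp_rw [h2]
  rw [← Finset.sum_filter]
  symm
  refine Finset.sum_bij (fun σ _ => (σ : Fin m → Fin m)) ?_ ?_ ?_ ?_
  · intro σ _
    exact Finset.mem_filter.mpr ⟨Finset.mem_univ _, σ.bijective⟩
  · intro σ _ τ _ h
    exact Equiv.ext (congrFun h)
  · intro r hr
    exact ⟨Equiv.ofBijective r (Finset.mem_filter.mp hr).2, Finset.mem_univ _, rfl⟩
  · intro σ _
    rfl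

/-- A bound on the diagonal bounds the symmetrization. -/
theorem norm_sum_perm_le_of_diag {m : ℕ} (T : V [×m]→L[ℝ] F) {D : ℝ} (hD : 0 ≤ D)
    (hT : ∀ v : V, ‖v‖ ≤ 1 → ‖T fun _ => v‖ ≤ D) (v : Fin m → V) :
    ‖∑ σ : Equiv.Perm (Fin m), T fun i => v (σ i)‖ ≤ (m : ℝ) ^ m * D * ∏ i, ‖v i‖ := by
  have hdiag : ∀ v : V, ‖T fun _ => v‖ ≤ D * ‖v‖ ^ m := by
    intro v
    rcases eq_or_ne v 0 with rfl | hv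
    · rcases Nat.eq_zero_or_pos m with rfl | hm
      · simpa using hT 0 (by simp)
      · have : T (fun _ => (0 : V)) = 0 := T.map_coord_zero ⟨0, hm⟩ rfl
        rw [this, norm_zero]
        positivity
    · have h1 := hT (‖v‖⁻¹ • v) (by rw [norm_smul, norm_inv, norm_norm, inv_mul_cancel₀ (by simpa)])
      have h2 : T (fun _ => ‖v‖⁻¹ • v) = (‖v‖⁻¹) ^ m • T fun _ => v := by
        rw [T.map_smul_univ (fun _ => ‖v‖⁻¹)]
        simp
      rw [h2, norm_smul, norm_pow, norm_inv, norm_norm, inv_pow, inv_mul_le_iff₀ (by positivity)]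
        at h1
      linarith
  -- normalized vectors
  have hunit : ∀ v : Fin m → V, (∀ i, ‖v i‖ ≤ 1) →
      ‖∑ σ : Equiv.Perm (Fin m), T fun i => v (σ i)‖ ≤ (m : ℝ) ^ m * D := by
    intro v hv
    have h1 : ‖(2 : ℝ) ^ m • ∑ σ : Equiv.Perm (Fin m), T fun i => v (σ i)‖
        ≤ ∑ _ε : Fin m → ℤˣ, (m : ℝ) ^ m * D := by
      rw [← sum_sign_smul_map_diag]
      refine norm_sum_le_of_le _ fun ε _ => ?_
      have hs : ∀ e : ℤˣ, ‖((e : ℤ) : ℝ)‖ = 1 := by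
        intro e
        rcases Int.units_eq_one_or e with rfl | rfl <;> simp
      rw [norm_smul, norm_prod]
      simp only [hs, Finset.prod_const_one, one_mul]
      have h2 : ‖∑ i, ((ε i : ℤ) : ℝ) • v i‖ ≤ m := by
        calc _ ≤ ∑ i : Fin m, (1 : ℝ) := norm_sum_le_of_le _ fun i _ => by
              rw [norm_smul, hs, one_mul]; exact hv i
          _ = m := by simp
      calc _ ≤ D * ‖∑ i, ((ε i : ℤ) : ℝ) • v i‖ ^ m := hdiag _
        _ ≤ D * (m : ℝ) ^ m := by gcongr
        _ = _ := mul_comm _ _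
    rw [norm_smul, norm_pow, Real.norm_ofNat, Finset.sum_const, nsmul_eq_mul] at h1
    have h3 : ((Finset.univ : Finset (Fin m → ℤˣ)).card : ℝ) = 2 ^ m := by
      rw [Finset.card_univ, Fintype.card_fun]
      simp
    rw [h3] at h1
    exact le_of_mul_le_mul_left h1 (by positivity)
  by_cases hz : ∃ i, v i = 0
  · obtain ⟨i, hi⟩ := hz
    have : ∑ σ : Equiv.Perm (Fin m), T (fun i => v (σ i)) = 0 := by
      refine Finset.sum_eq_zero fun σ _ => T.map_coord_zero (σ⁻¹ i) ?_
      simpa using hi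
    rw [this, norm_zero]
    positivity
  · push Not at hz
    have h1 := hunit (fun i => ‖v i‖⁻¹ • v i) (fun i => by
      rw [norm_smul, norm_inv, norm_norm, inv_mul_cancel₀ (by simpa using hz i)])
    have h2 : ∑ σ : Equiv.Perm (Fin m), T (fun i => ‖v (σ i)‖⁻¹ • v (σ i))
        = (∏ i, ‖v i‖)⁻¹ • ∑ σ : Equiv.Perm (Fin m), T fun i => v (σ i) := by
      rw [Finset.smul_sum]
      refine Finset.sum_congr rfl fun σ _ => ?_
      rw [T.map_smul_univ (fun i => ‖v (σ i)‖⁻¹), Equiv.prod_comp σ (fun i => ‖v i‖⁻¹),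
        Finset.prod_inv_distrib]
    have h3 : 0 < ∏ i, ‖v i‖ := Finset.prod_pos fun i _ => norm_pos_iff.mpr (hz i)
    rw [h2, norm_smul, norm_inv, Real.norm_of_nonneg h3.le, inv_mul_le_iff₀ h3] at h1
    linarith

open Filter Topology Metric in
/-- If the homogeneous terms of a power series decay like `4⁻ᵐ` on the unit ball, then the function
extends analytically to the unit ball. The symmetrized power series is used, whose terms are
controlled by the diagonal up to a factor `mᵐ / m! ≤ eᵐ`; this is where `4 > e` is needed. -/
theorem exists_analyticOnNhd_ball_of_diag_bound [CompleteSpace F] {f : V → F}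
    {p : FormalMultilinearSeries ℝ V F} (hp : HasFPowerSeriesAt f p 0) {C : ℝ} (hC : 0 ≤ C)
    (hb : ∀ (m : ℕ) (v : V), ‖v‖ ≤ 1 → ‖p m fun _ => v‖ ≤ C * (1 / 4) ^ m) :
    ∃ g : V → F, AnalyticOnNhd ℝ g (ball 0 1) ∧ f =ᶠ[𝓝 0] g := by
  obtain ⟨r, hr⟩ := hp
  set q : FormalMultilinearSeries ℝ V F :=
    fun m => ((m.factorial : ℝ))⁻¹ • iteratedFDeriv ℝ m f 0 with hq
  have hqn : ∀ m, ‖q m‖ ≤ C := by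
    intro m
    refine ContinuousMultilinearMap.opNorm_le_bound hC fun v => ?_
    have h1 : q m v
        = ((m.factorial : ℝ))⁻¹ • ∑ σ : Equiv.Perm (Fin m), p m fun i => v (σ i) := by
      simp only [hq, smul_apply]
      rw [hr.iteratedFDeriv_eq_sum_of_completeSpace]
    have h2 := norm_sum_perm_le_of_diag (p m) (D := C * (1 / 4) ^ m) (by positivity) (hb m) v
    have h3 : (m : ℝ) ^ m / m.factorial ≤ 4 ^ m := by
      refine (Real.pow_div_factorial_le_exp _ (Nat.cast_nonneg m) m).trans ?_
      rw [← Real.exp_one_pow]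
      gcongr
      linarith [Real.exp_one_lt_d9]
    rw [h1, norm_smul, norm_inv, Real.norm_natCast]
    calc _ ≤ ((m.factorial : ℝ))⁻¹ * ((m : ℝ) ^ m * (C * (1 / 4) ^ m) * ∏ i, ‖v i‖) := by gcongr
      _ = (m : ℝ) ^ m / m.factorial * (C * (1 / 4) ^ m * ∏ i, ‖v i‖) := by ring
      _ ≤ 4 ^ m * (C * (1 / 4) ^ m * ∏ i, ‖v i‖) := by gcongr
      _ = C * ∏ i, ‖v i‖ := by
          have : (4 : ℝ) ^ m * (1 / 4) ^ m = 1 := by rw [← mul_pow]; norm_num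
          linear_combination (C * ∏ i, ‖v i‖) * this
  have hrad : (1 : ENNReal) ≤ q.radius := by
    have := q.le_radius_of_bound C (r := 1) fun m => by simpa using hqn m
    simpa using this
  refine ⟨q.sum, ?_, ?_⟩
  · have h1 := (q.hasFPowerSeriesOnBall (one_pos.trans_le hrad)).analyticOnNhd
    refine h1.mono ?_
    rw [← eball_ofReal, ENNReal.ofReal_one]
    exact eball_subset_eball hrad
  · filter_upwards [eball_mem_nhds (0 : V) hr.r_pos] with y hy
    have h1 := hr.hasSum_iteratedFDeriv hy
    rw [zero_add] at h1
    exact h1.tsum_eq.symm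

end

/-! ### A Hartogs type theorem: power series with uniform bounds -/

section

variable {W F : Type*} [NormedAddCommGroup W] [NormedSpace ℝ W] [NormedAddCommGroup F]
  [NormedSpace ℝ F]

/-- The part of degree `j` in `x` and `m - j` in the real variable of the homogeneous polynomial
`p m` on `W × ℝ`, at `(x, 1)`. -/
noncomputable def bidegreeCoeff (p : FormalMultilinearSeries ℝ (W × ℝ) F) (m j : ℕ) (x : W) : F :=
  ∑ s ∈ Finset.powersetCard j (Finset.univ : Finset (Fin m)),
    p m (s.piecewise (fun _ => (x, 0)) fun _ => (0, 1))

theorem map_diag_eq_sum_bidegreeCoeff (p : FormalMultilinearSeries ℝ (W × ℝ) F) (m : ℕ) (x : W)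
    (η σ : ℝ) :
    p m (fun _ => (η • x, σ))
      = ∑ j ∈ Finset.range (m + 1), (η ^ j * σ ^ (m - j)) • bidegreeCoeff p m j x := by
  classical
  have h1 : (fun _ : Fin m => ((η • x, σ) : W × ℝ))
      = (fun _ => η • ((x, 0) : W × ℝ)) + fun _ => σ • ((0, 1) : W × ℝ) := by
    ext <;> simp
  rw [h1, (p m).map_add_univ, ← Finset.powerset_univ, Finset.sum_powerset, Finset.card_univ,
    Fintype.card_fin]
  refine Finset.sum_congr rfl fun j _ => ?_
  rw [bidegreeCoeff, Finset.smul_sum]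
  refine Finset.sum_congr rfl fun s hs => ?_
  have hs' : s.card = j := (Finset.mem_powersetCard.mp hs).2
  have h2 : s.piecewise (fun _ => η • ((x, 0) : W × ℝ)) (fun _ => σ • ((0, 1) : W × ℝ))
      = fun i => (s.piecewise (fun _ => η) (fun _ => σ) i)
        • (s.piecewise (fun _ => ((x, 0) : W × ℝ)) (fun _ => ((0, 1) : W × ℝ)) i) := by
    ext i <;> by_cases hi : i ∈ s <;> simp [hi]
  rw [h2, (p m).map_smul_univ, Finset.prod_piecewise]
  simp [← hs', Finset.card_sdiff]

/-- The parts of fixed degree `k` in the real variable are the terms of the power series in `x` of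
the `k`-th coefficient of `p` recentred at `(x, 0)`. -/
theorem bidegreeCoeff_eq_changeOriginSeries (p : FormalMultilinearSeries ℝ (W × ℝ) F) (k j : ℕ)
    (x : W) :
    bidegreeCoeff p (k + j) j x
      = p.changeOriginSeries k j (fun _ => (x, 0)) (fun _ => ((0, 1) : W × ℝ)) := by
  rw [FormalMultilinearSeries.changeOriginSeries, sum_apply, sum_apply, bidegreeCoeff]
  rw [Finset.sum_subtype (p := fun s : Finset (Fin (k + j)) => s.card = j) _
    (fun s => by simp [Finset.mem_powersetCard])]
  refine Finset.sum_congr rfl fun s _ => ?_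
  rw [FormalMultilinearSeries.changeOriginSeriesTerm_apply]

theorem norm_bidegreeCoeff_le (p : FormalMultilinearSeries ℝ (W × ℝ) F) (m j : ℕ) {x : W}
    (hx : ‖x‖ ≤ 1) : ‖bidegreeCoeff p m j x‖ ≤ 2 ^ m * ‖p m‖ := by
  have h1 : ∀ s ∈ Finset.powersetCard j (Finset.univ : Finset (Fin m)),
      ‖p m (s.piecewise (fun _ => (x, 0)) fun _ => ((0, 1) : W × ℝ))‖ ≤ ‖p m‖ := by
    intro s _
    refine ((p m).le_opNorm _).trans (mul_le_of_le_one_right (norm_nonneg _) ?_)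
    refine Finset.prod_le_one (fun _ _ => norm_nonneg _) fun i _ => ?_
    by_cases hi : i ∈ s <;> simp [hi, Prod.norm_def, hx]
  refine (norm_sum_le_of_le _ h1).trans ?_
  rw [Finset.sum_const, Finset.card_powersetCard, Finset.card_univ, Fintype.card_fin, nsmul_eq_mul]
  gcongr
  exact_mod_cast Nat.choose_le_two_pow m j

open Filter Topology Metric in
/-- If near `b₀` the `k`-th derivatives in the real variable grow like `k! * M ^ k`, uniformly on
real points, then so do the coefficients of the power series, up to doubling `M`. A direct bound
through complex points would only see the domain of convergence of `p`, with a factor `D ^ k`;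
the two-constants theorem on a disc of small radius `ρ` turns it into `D ^ (3 * ρ * k) ≤ 2 ^ k`. -/
theorem exists_bound_bidegreeCoeff [CompleteSpace F] {G : W × ℝ → F} {b₀ : W} {s₀ : ℝ}
    {p : FormalMultilinearSeries ℝ (W × ℝ) F} (hp : HasFPowerSeriesAt G p (b₀, s₀))
    {M N : ℝ} (hM : 0 < M) (hN : 0 < N)
    (hb : ∀ᶠ b in 𝓝 b₀, ∀ k : ℕ,
      ‖iteratedFDeriv ℝ k G (b, s₀) fun _ => (0, 1)‖ ≤ k.factorial * (N * M ^ k)) :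
    ∃ C ρ : ℝ, 0 < C ∧ 0 < ρ ∧ ∀ (k j : ℕ) (x : W), ‖x‖ ≤ 1 →
      ‖bidegreeCoeff p (k + j) j x‖ ≤ C * (2 * M) ^ k / ρ ^ j := by
  obtain ⟨R, hR⟩ := hp
  have hrad : 0 < p.radius := hR.r_pos.trans_le hR.r_le
  obtain ⟨C, K, hC, hK, hCK⟩ := p.le_mul_pow_of_radius_pos hrad
  obtain ⟨δ, hδ, hδb⟩ := Metric.eventually_nhds_iff_ball.mp hb
  obtain ⟨R', hR', hR'R⟩ : ∃ R' : ℝ, 0 < R' ∧ ENNReal.ofReal R' < R := by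
    obtain ⟨a, ha, haR⟩ := ENNReal.lt_iff_exists_nnreal_btwn.mp hR.r_pos
    exact ⟨a, by exact_mod_cast ha, by simpa using haR⟩
  obtain ⟨t, ht0, ht⟩ : ∃ t : ℝ, 0 < t ∧ t ≤ R' ∧ t < δ ∧ 2 * K * t ≤ 1 / 2 := by
    refine ⟨min R' (min (δ / 2) (1 / (4 * K))), by positivity, min_le_left _ _, ?_, ?_⟩
    · calc _ ≤ δ / 2 := (min_le_right _ _).trans (min_le_left _ _)
        _ < δ := half_lt_self hδ
    · calc 2 * K * min R' (min (δ / 2) (1 / (4 * K))) ≤ 2 * K * (1 / (4 * K)) := by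
            gcongr
            exact (min_le_right _ _).trans (min_le_right _ _)
        _ = 1 / 2 := by field_simp; norm_num
  obtain ⟨htR, htδ, htK⟩ := ht
  -- `C₂ * D ^ k` bounds the ratio of the two constants; `ρ` is chosen with `D ^ (3 * ρ) ≤ 2`
  set D : ℝ := max 1 (2 * K / M) with hD
  set C₂ : ℝ := max 1 (2 * C / N) with hC₂
  have hD1 : 1 ≤ D := le_max_left _ _
  have hC1 : 1 ≤ C₂ := le_max_left _ _
  set ρ : ℝ := Real.log 2 / (3 * (Real.log D + 1)) with hρ
  have hlogD : 0 ≤ Real.log D := Real.log_nonneg hD1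
  have hlog2 : 0 < Real.log 2 := Real.log_pos one_lt_two
  have hρ0 : 0 < ρ := by positivity
  have h3ρ : 3 * ρ = Real.log 2 / (Real.log D + 1) := by rw [hρ]; field_simp
  have h3ρ1 : 3 * ρ ≤ 1 := by
    rw [h3ρ, div_le_one (by positivity)]
    linarith [Real.log_two_lt_d9]
  have hDρ : D ^ (3 * ρ) ≤ 2 := by
    rw [Real.rpow_def_of_pos (by positivity), ← Real.le_log_iff_exp_le two_pos, h3ρ,
      mul_div_assoc', div_le_iff₀ (by positivity)]
    nlinarith
  refine ⟨N * C₂, ρ * t, by positivity, by positivity, fun k j x hx => ?_⟩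
  set c : ℕ → F := fun j => t ^ j • bidegreeCoeff p (k + j) j x with hc
  have hcle : ∀ j, ‖c j‖ ≤ C * (2 * K) ^ k * (1 / 2) ^ j := by
    intro j
    rw [hc]
    simp only [norm_smul, norm_pow, Real.norm_of_nonneg ht0.le]
    calc t ^ j * ‖bidegreeCoeff p (k + j) j x‖ ≤ t ^ j * (2 ^ (k + j) * (C * K ^ (k + j))) := by
          gcongr
          exact (norm_bidegreeCoeff_le p _ _ hx).trans (by gcongr; exact hCK _)
      _ = C * (2 * K) ^ k * (2 * K * t) ^ j := by ring
      _ ≤ _ := by gcongr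
  have hgeom : Summable fun j : ℕ => C * (2 * K) ^ k * (1 / 2 : ℝ) ^ j :=
    (summable_geometric_of_lt_one (by norm_num) (by norm_num)).mul_left _
  have hsum : Summable fun j => ‖c j‖ :=
    Summable.of_nonneg_of_le (fun _ => norm_nonneg _) hcle hgeom
  have hA : ∑' j, ‖c j‖ ≤ C₂ * D ^ k * (N * M ^ k) := by
    calc ∑' j, ‖c j‖ ≤ ∑' j : ℕ, C * (2 * K) ^ k * (1 / 2 : ℝ) ^ j := hsum.tsum_le_tsum hcle hgeom
      _ = (2 * C / N) * (2 * K / M) ^ k * (N * M ^ k) := by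
          rw [tsum_mul_left, tsum_geometric_two]
          rw [div_pow]
          field_simp
      _ ≤ _ := by
          gcongr
          · exact le_max_right _ _
          · exact le_max_right _ _
  have hr : ∀ y : ℝ, |y| ≤ 1 → ‖∑' j, y ^ j • c j‖ ≤ N * M ^ k := by
    intro y hy
    have hyt : |y * t| ≤ t := by
      rw [abs_mul, abs_of_pos ht0]
      exact mul_le_of_le_one_left ht0.le hy
    have hxt : ‖(y * t) • x‖ ≤ t := by
      rw [norm_smul, Real.norm_eq_abs]
      calc _ ≤ t * 1 := by gcongr
        _ = t := mul_one t
    have hpt : (‖(((y * t) • x, 0) : W × ℝ)‖₊ : ENNReal) < R := by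
      refine lt_of_le_of_lt ?_ hR'R
      rw [← ENNReal.ofReal_coe_nnreal, coe_nnnorm]
      refine ENNReal.ofReal_le_ofReal ?_
      simpa [Prod.norm_def] using hxt.trans htR
    have h1 : HasSum (fun j => y ^ j • c j)
        (p.changeOrigin ((y * t) • x, 0) k fun _ => (0, 1)) := by
      have h2 := (p.hasFPowerSeriesOnBall_changeOrigin k hrad).hasSum
        (y := ((y * t) • x, 0)) (by
          rw [mem_eball_zero_iff]
          exact (hpt.trans_le hR.r_le))
      rw [zero_add] at h2
      have h3 := (ContinuousMultilinearMap.apply ℝ (fun _ : Fin k => W × ℝ) F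
        (fun _ => (0, 1))).hasSum h2
      convert h3 using 2 with j
      · rw [ContinuousMultilinearMap.apply_apply]
        simp only [hc]
        rw [bidegreeCoeff_eq_changeOriginSeries]
        have h4 : (fun _ : Fin j => (((y * t) • x, 0) : W × ℝ))
            = fun _ => (y * t) • ((x, 0) : W × ℝ) := by
          ext <;> simp
        rw [h4, (p.changeOriginSeries k j).map_smul_univ (fun _ => y * t)]
        simp [smul_smul, mul_pow]
      · rfl
    rw [h1.tsum_eq]
    have h5 := (hR.changeOrigin hpt).factorial_smul ((0, 1) : W × ℝ) k
    have h6 := hδb (b₀ + (y * t) • x) (by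
      rw [mem_ball_iff_norm, add_sub_cancel_left]
      exact hxt.trans_lt htδ) k
    have h7 : (b₀, s₀) + ((y * t) • x, (0 : ℝ)) = (b₀ + (y * t) • x, s₀) := by simp
    rw [h7] at h5
    rw [← h5, ← Nat.cast_smul_eq_nsmul ℝ, norm_smul, Real.norm_natCast] at h6
    exact le_of_mul_le_mul_left h6 (by positivity)
  have hDk : 1 ≤ D ^ k := one_le_pow₀ hD1
  have hBA : N * M ^ k ≤ C₂ * D ^ k * (N * M ^ k) := by
    refine le_mul_of_one_le_left (by positivity) ?_
    nlinarith
  have hmain := norm_coeff_le_of_norm_tsum_le (c := c) (B := N * M ^ k) (ρ := ρ) (by positivity) hBA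
    hsum hA hr hρ0 (by linarith) j
  rw [mul_div_cancel_right₀ _ (by positivity : N * M ^ k ≠ 0)] at hmain
  have hpow : (C₂ * D ^ k) ^ (3 * ρ) ≤ C₂ * 2 ^ k := by
    rw [Real.mul_rpow (by positivity) (by positivity)]
    have h1 : C₂ ^ (3 * ρ) ≤ C₂ := by
      conv_rhs => rw [← Real.rpow_one C₂]
      exact Real.rpow_le_rpow_of_exponent_le hC1 h3ρ1
    have h2 : (D ^ k) ^ (3 * ρ) ≤ 2 ^ k := by
      rw [← Real.rpow_natCast, ← Real.rpow_mul (by positivity), mul_comm, Real.rpow_mul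
        (by positivity), Real.rpow_natCast]
      gcongr
    gcongr
  rw [hc] at hmain
  simp only [norm_smul, norm_pow, Real.norm_of_nonneg ht0.le] at hmain
  rw [mul_pow ρ t, le_div_iff₀ (by positivity)]
  rw [le_div_iff₀ (by positivity)] at hmain
  calc ‖bidegreeCoeff p (k + j) j x‖ * (ρ ^ j * t ^ j)
      = t ^ j * ‖bidegreeCoeff p (k + j) j x‖ * ρ ^ j := by ring
    _ ≤ N * M ^ k * (C₂ * D ^ k) ^ (3 * ρ) := hmain
    _ ≤ N * M ^ k * (C₂ * 2 ^ k) := by gcongr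
    _ = N * C₂ * (2 * M) ^ k := by ring

theorem succ_le_two_pow_real (m : ℕ) : ((m : ℝ) + 1) ≤ 2 ^ m := by
  exact_mod_cast Nat.lt_two_pow_self (n := m)

open Filter Topology Metric in
/-- A Hartogs type lemma: an analytic function at `(b₀, s₀)`, whose Taylor series in the real
variable have a common radius of convergence `1 / M` for `b` near `b₀`, extends analytically to a
product of balls whose second factor has a radius proportional to `1 / M`, however small the domain
of convergence of the function at `(b₀, s₀)` is. -/
theorem exists_analyticOnNhd_of_uniform_bound [CompleteSpace F] {G : W × ℝ → F} {b₀ : W} {s₀ : ℝ}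
    (hG : AnalyticAt ℝ G (b₀, s₀)) {M N : ℝ} (hM : 0 < M) (hN : 0 < N)
    (hb : ∀ᶠ b in 𝓝 b₀, ∀ k : ℕ,
      ‖iteratedFDeriv ℝ k G (b, s₀) fun _ => (0, 1)‖ ≤ k.factorial * (N * M ^ k)) :
    ∃ (H : W × ℝ → F) (δ : ℝ), 0 < δ ∧
      AnalyticOnNhd ℝ H (ball b₀ δ ×ˢ ball s₀ (1 / (16 * M))) ∧ G =ᶠ[𝓝 (b₀, s₀)] H := by
  obtain ⟨p, hp⟩ := hG
  obtain ⟨C, ρ, hC, hρ, hCρ⟩ := exists_bound_bidegreeCoeff hp hM hN hb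
  obtain ⟨κ, hκ⟩ : ∃ κ : ℝ, κ = 1 / (16 * M) := ⟨_, rfl⟩
  obtain ⟨η, hη⟩ : ∃ η : ℝ, η = ρ / 8 := ⟨_, rfl⟩
  have hκ0 : 0 < κ := by rw [hκ]; positivity
  have hη0 : 0 < η := by rw [hη]; positivity
  rw [← hκ]
  set S : W × ℝ →L[ℝ] W × ℝ :=
    (η • ContinuousLinearMap.id ℝ W).prodMap (κ • ContinuousLinearMap.id ℝ ℝ) with hS
  set S' : W × ℝ →L[ℝ] W × ℝ :=
    (η⁻¹ • ContinuousLinearMap.id ℝ W).prodMap (κ⁻¹ • ContinuousLinearMap.id ℝ ℝ) with hS'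
  have hSS' : ∀ z, S (S' z) = z := by
    rintro ⟨x, σ⟩
    simp [hS, hS', smul_smul, hη0.ne', hκ0.ne']
  have hf : HasFPowerSeriesAt (fun v => G ((b₀, s₀) + S v)) (p.compContinuousLinearMap S) 0 := by
    have h1 : HasFPowerSeriesAt (fun v => G ((b₀, s₀) + v)) p (S 0) := by
      have := hp.comp_sub (-(b₀, s₀))
      rw [add_neg_cancel] at this
      rw [map_zero]
      simpa only [sub_neg_eq_add, add_comm] using this
    exact h1.compContinuousLinearMap
  obtain ⟨g, hg, hfg⟩ := exists_analyticOnNhd_ball_of_diag_bound hf hC.le (by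
    rintro m ⟨x, σ⟩ hv
    rw [Prod.norm_def, max_le_iff] at hv
    rw [FormalMultilinearSeries.compContinuousLinearMap_apply]
    have h1 : (S ∘ fun _ : Fin m => (x, σ)) = fun _ => (η • x, κ * σ) := by
      ext <;> simp [hS]
    rw [h1, map_diag_eq_sum_bidegreeCoeff]
    have h2 : ∀ j ∈ Finset.range (m + 1),
        ‖(η ^ j * (κ * σ) ^ (m - j)) • bidegreeCoeff p m j x‖ ≤ C * (1 / 8) ^ m := by
      intro j hj
      obtain ⟨k, rfl⟩ : ∃ k, m = k + j :=
        ⟨m - j, (Nat.sub_add_cancel (Nat.lt_succ_iff.mp (Finset.mem_range.mp hj))).symm⟩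
      rw [Nat.add_sub_cancel, norm_smul, norm_mul, norm_pow, norm_pow, norm_mul,
        Real.norm_of_nonneg hη0.le, Real.norm_of_nonneg hκ0.le]
      calc η ^ j * (κ * ‖σ‖) ^ k * ‖bidegreeCoeff p (k + j) j x‖
          ≤ η ^ j * (κ * 1) ^ k * (C * (2 * M) ^ k / ρ ^ j) := by
            gcongr
            · exact hv.2
            · exact hCρ k j x hv.1
        _ = C * ((η / ρ) ^ j * (κ * (2 * M)) ^ k) := by
            rw [div_pow, mul_one, mul_pow κ (2 * M)]
            ring
        _ = C * (1 / 8) ^ (k + j) := by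
            have e1 : η / ρ = 1 / 8 := by rw [hη]; field_simp
            have e2 : κ * (2 * M) = 1 / 8 := by rw [hκ]; field_simp; norm_num
            rw [e1, e2, pow_add]
            ring
    refine (norm_sum_le_of_le _ h2).trans ?_
    rw [Finset.sum_const, Finset.card_range, nsmul_eq_mul]
    push_cast
    calc ((m : ℝ) + 1) * (C * (1 / 8) ^ m) ≤ 2 ^ m * (C * (1 / 8) ^ m) := by
          gcongr
          exact succ_le_two_pow_real m
      _ = C * (2 * (1 / 8)) ^ m := by rw [mul_pow]; ring
      _ = C * (1 / 4) ^ m := by norm_num)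
  refine ⟨fun z => g (S' (z - (b₀, s₀))), η, hη0, ?_, ?_⟩
  · rintro ⟨b, s⟩ ⟨hb, hs⟩
    refine AnalyticAt.fun_comp (g := g) (hg _ ?_) ?_
    · rw [mem_ball_iff_norm] at hb hs
      rw [mem_ball_zero_iff, Prod.norm_def, max_lt_iff]
      simp only [hS', Prod.mk_sub_mk, ContinuousLinearMap.coe_prodMap', Prod.map_apply,
        smul_apply, ContinuousLinearMap.id_apply, norm_smul, norm_inv,
        Real.norm_of_nonneg hη0.le, Real.norm_of_nonneg hκ0.le]
      rw [inv_mul_lt_one₀ hη0, inv_mul_lt_one₀ hκ0]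
      exact ⟨hb, hs⟩
    · exact (S'.analyticAt _).fun_comp (analyticAt_id.sub analyticAt_const)
  · have hcont : Tendsto (fun z : W × ℝ => S' (z - (b₀, s₀))) (𝓝 (b₀, s₀)) (𝓝 0) := by
      have : Continuous fun z : W × ℝ => S' (z - (b₀, s₀)) := by fun_prop
      simpa using this.tendsto (b₀, s₀)
    filter_upwards [hcont.eventually hfg] with z hz
    rw [← hz, hSS']
    simp

end

/-! ### Functions analytic in one variable along a boundary -/

section

variable {W F : Type*} [NormedAddCommGroup W] [NormedSpace ℝ W] [NormedAddCommGroup F]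
  [NormedSpace ℝ F]

open scoped NNReal ENNReal in
/-- Cauchy estimates for the recentred power series, uniform near the centre. -/
theorem exists_norm_changeOrigin_le {V : Type*} [NormedAddCommGroup V] [NormedSpace ℝ V]
    (p : FormalMultilinearSeries ℝ V F) (hp : 0 < p.radius) :
    ∃ C r : ℝ, 0 ≤ C ∧ 0 < r ∧ ENNReal.ofReal r < p.radius ∧
      ∀ x : V, ‖x‖ ≤ r → ∀ k, ‖p.changeOrigin x k‖ ≤ C / r ^ k := by
  obtain ⟨a, ha0, ha⟩ := ENNReal.lt_iff_exists_nnreal_btwn.mp hp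
  have ha0' : 0 < a := by exact_mod_cast ha0
  set r : ℝ≥0 := a / 2 with hr
  have hr0 : 0 < r := by positivity
  have hrr : ((r + r : ℝ≥0) : ℝ≥0∞) < p.radius := by rwa [hr, add_halves]
  have hrp : (r : ℝ≥0∞) < p.radius := lt_of_le_of_lt (by exact_mod_cast (le_add_right le_rfl)) hrr
  have hs := p.changeOriginSeries_summable_aux₁ (r := r) (r' := r) (by exact_mod_cast hrr)
  refine ⟨_, r, NNReal.coe_nonneg (∑' s : Σ k l : ℕ, { s : Finset (Fin (k + l)) // s.card = l },
    ‖p (s.1 + s.2.1)‖₊ * r ^ s.2.1 * r ^ s.1), by exact_mod_cast hr0, by simpa using hrp,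
    fun x hx k => ?_⟩
  have hx' : ‖x‖₊ ≤ r := hx
  have hxr : (‖x‖₊ : ℝ≥0∞) < p.radius := lt_of_le_of_lt (by exact_mod_cast hx') hrp
  rw [le_div_iff₀ (by positivity)]
  have h1 := p.nnnorm_changeOrigin_le k hxr
  have h2 : ∑' s : Σ l : ℕ, { s : Finset (Fin (k + l)) // s.card = l },
      ‖p (k + s.1)‖₊ * ‖x‖₊ ^ s.1 ≤ ∑' s : Σ l : ℕ, { s : Finset (Fin (k + l)) // s.card = l },
      ‖p (k + s.1)‖₊ * r ^ s.1 := by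
    refine (p.changeOriginSeries_summable_aux₂ hxr k).tsum_le_tsum (fun s => ?_)
      (p.changeOriginSeries_summable_aux₂ hrp k)
    gcongr
  have h3 := (NNReal.summable_sigma.1 hs).2
  have h4 := h3.le_tsum k (fun _ _ => zero_le)
  rw [hs.tsum_sigma' (NNReal.summable_sigma.1 hs).1]
  simp only [NNReal.tsum_mul_right] at h4
  have h5 : ‖p.changeOrigin x k‖₊ * r ^ k ≤ _ := le_trans (by gcongr; exact h1.trans h2) h4
  simp only [NNReal.tsum_mul_right]
  exact_mod_cast h5

open Filter Topology Metric Set in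
/-- A function on `W × [0, ε)` that is analytic where the real variable is positive, and that on
each line `{b} × [0, ε)` extends analytically beyond `0`, is jointly analytic near some boundary
point. By Baire's theorem, the Taylor series on the lines through an open set of parameters `b`,
centred at a common small `s N > 0`, have radii of convergence of at least
`32 * s N`; `exists_analyticOnNhd_of_uniform_bound` then reaches the boundary. -/
theorem exists_analyticAt_of_separately [CompleteSpace W] [CompleteSpace F]
    {G : W × ℝ → F} {ε : ℝ} (hε : 0 < ε)
    (h0 : ∀ b, AnalyticWithinAt ℝ (fun s => G (b, s)) (Ici 0) 0)
    (h1 : ∀ b, ∀ s ∈ Ioo 0 ε, AnalyticAt ℝ G (b, s)) :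
    ∃ (b₀ : W) (H : W × ℝ → F), AnalyticAt ℝ H (b₀, 0) ∧
      ∀ᶠ z in 𝓝 (b₀, (0 : ℝ)), 0 ≤ z.2 → G z = H z := by
  set s : ℕ → ℝ := fun N => 1 / ((N : ℝ) + 1) with hs
  have hs0 : ∀ N, 0 < s N := fun N => by positivity
  -- the constant `1 / 32` makes the radius in `exists_analyticOnNhd_of_uniform_bound` equal `2 * s N`
  set A : ℕ → Set W := fun N => {b | s N < ε ∧ ∀ k : ℕ,
    ‖iteratedFDeriv ℝ k G (b, s N) fun _ => (0, 1)‖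
      ≤ k.factorial * (((N : ℝ) + 1) * (((N : ℝ) + 1) / 32) ^ k)} with hA
  have hclosed : ∀ N, IsClosed (A N) := by
    intro N
    by_cases hN : s N < ε
    · have : A N = ⋂ k : ℕ, {b | ‖iteratedFDeriv ℝ k G (b, s N) fun _ => (0, 1)‖
          ≤ k.factorial * (((N : ℝ) + 1) * (((N : ℝ) + 1) / 32) ^ k)} := by
        ext b
        simp [hA, hN]
      rw [this]
      refine isClosed_iInter fun k => isClosed_le ?_ continuous_const
      have hc : Continuous fun b : W => iteratedFDeriv ℝ k G (b, s N) := by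
        rw [continuous_iff_continuousAt]
        intro b
        have h2 : ContinuousAt (iteratedFDeriv ℝ k G) (b, s N) := by
          obtain ⟨r, hr, han⟩ := (h1 b (s N) ⟨hs0 N, hN⟩).exists_ball_analyticOnNhd
          exact (han.iteratedFDeriv k _ (mem_ball_self hr)).continuousAt
        exact ContinuousAt.comp (f := fun b : W => (b, s N)) h2 (by fun_prop)
      exact ((ContinuousMultilinearMap.apply ℝ (fun _ : Fin k => W × ℝ) F
        (fun _ => (0, 1))).continuous.comp hc).norm
    · have : A N = ∅ := by
        ext b
        simp [hA, hN]
      rw [this]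
      exact isClosed_empty
  have hcover : ⋃ N, A N = univ := by
    rw [eq_univ_iff_forall]
    intro b
    obtain ⟨g, hgG, P, R, hP⟩ := analyticWithinAt_iff_exists_analyticAt.mp (h0 b)
    rw [insert_eq_of_mem self_mem_Ici] at hgG
    obtain ⟨C, r, hC, hr, hrP, hb⟩ := exists_norm_changeOrigin_le P (hP.r_pos.trans_le hP.r_le)
    obtain ⟨δ, hδ, hδg⟩ : ∃ δ > 0, ∀ t, 0 ≤ t → t < δ → G (b, t) = g t := by
      obtain ⟨δ, hδ, h⟩ := Metric.mem_nhdsWithin_iff.mp hgG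
      refine ⟨δ, hδ, fun t ht ht' => h ⟨?_, ht⟩⟩
      simpa [abs_of_nonneg ht] using ht'
    obtain ⟨R', hR', hR'R⟩ : ∃ R' : ℝ, 0 < R' ∧ ENNReal.ofReal R' < R := by
      obtain ⟨a, ha, haR⟩ := ENNReal.lt_iff_exists_nnreal_btwn.mp hP.r_pos
      exact ⟨a, by exact_mod_cast ha, by simpa using haR⟩
    have hev : ∀ᶠ N : ℕ in atTop, s N < ε ∧ s N < δ ∧ s N < r ∧ s N < R' ∧ C ≤ (N : ℝ) + 1 ∧
        32 / r ≤ (N : ℝ) + 1 := by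
      have ht : Tendsto s atTop (𝓝 0) := tendsto_one_div_add_atTop_nhds_zero_nat
      have ht' : Tendsto (fun N : ℕ => (N : ℝ) + 1) atTop atTop :=
        tendsto_atTop_add_const_right _ _ tendsto_natCast_atTop_atTop
      filter_upwards [ht.eventually_lt_const hε, ht.eventually_lt_const hδ,
        ht.eventually_lt_const hr, ht.eventually_lt_const hR', ht'.eventually_ge_atTop C,
        ht'.eventually_ge_atTop (32 / r)] with N a1 a2 a3 a4 a5 a6
      exact ⟨a1, a2, a3, a4, a5, a6⟩
    obtain ⟨N, hNε, hNδ, hNr, hNR, hNC, hN32⟩ := hev.exists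
    refine mem_iUnion.mpr ⟨N, hNε, fun k => ?_⟩
    have hsn : ‖s N‖ = s N := Real.norm_of_nonneg (hs0 N).le
    obtain ⟨q, rq, hq⟩ := h1 b (s N) ⟨hs0 N, hNε⟩
    -- both power series of `t ↦ G (b, t)` at `s N`
    have hq1 : HasFPowerSeriesAt (fun t => G (b, t))
        (q.compContinuousLinearMap (ContinuousLinearMap.inr ℝ W ℝ)) (s N) := by
      have e1 : HasFPowerSeriesAt (fun z => G ((b, 0) + z)) q (ContinuousLinearMap.inr ℝ W ℝ (s N))
          := by
        have := hq.hasFPowerSeriesAt.comp_sub (-(b, (0 : ℝ)))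
        have e0 : (b, s N) + -(b, (0 : ℝ)) = ContinuousLinearMap.inr ℝ W ℝ (s N) := by simp
        rw [e0] at this
        simpa only [sub_neg_eq_add, add_comm] using this
      have e2 := e1.compContinuousLinearMap
      simpa [Function.comp_def] using e2
    have hg1 : HasFPowerSeriesAt g (P.changeOrigin (s N)) (s N) := by
      have := hP.changeOrigin (y := s N) (lt_of_le_of_lt (by
        rw [← ENNReal.ofReal_coe_nnreal, coe_nnnorm, hsn]
        exact ENNReal.ofReal_le_ofReal hNR.le) hR'R)
      rw [zero_add] at this
      exact this.hasFPowerSeriesAt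
    have hgG' : (fun t => G (b, t)) =ᶠ[𝓝 (s N)] g := by
      filter_upwards [lt_mem_nhds (hs0 N), gt_mem_nhds hNδ] with t ht ht'
      exact hδg t ht.le ht'
    have heq := hq1.eq_formalMultilinearSeries (hg1.congr hgG'.symm)
    have e3 := hq.factorial_smul ((0, 1) : W × ℝ) k
    rw [← e3, ← Nat.cast_smul_eq_nsmul ℝ, norm_smul, Real.norm_natCast]
    gcongr
    have e4 : (q k fun _ => ((0, 1) : W × ℝ)) = P.changeOrigin (s N) k fun _ => 1 := by
      rw [← heq, FormalMultilinearSeries.compContinuousLinearMap_apply]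
      rfl
    rw [e4]
    calc ‖P.changeOrigin (s N) k fun _ => 1‖ ≤ ‖P.changeOrigin (s N) k‖ := by
          exact ((P.changeOrigin (s N) k).le_opNorm _).trans_eq (by simp)
      _ ≤ C / r ^ k := hb _ (by rw [hsn]; exact hNr.le) k
      _ = C * (1 / r) ^ k := by rw [one_div, inv_pow, div_eq_mul_inv]
      _ ≤ _ := by
          have h32 : 1 / r ≤ ((N : ℝ) + 1) / 32 := by
            rw [div_le_iff₀ hr] at hN32
            rw [div_le_div_iff₀ hr (by norm_num)]
            linarith
          gcongr
  obtain ⟨N, b₀, hb₀⟩ := nonempty_interior_of_iUnion_of_closed hclosed hcover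
  have hNε : s N < ε := (interior_subset hb₀).1
  obtain ⟨H, δ, hδ, hH, hGH⟩ := exists_analyticOnNhd_of_uniform_bound
    (h1 b₀ (s N) ⟨hs0 N, hNε⟩) (M := ((N : ℝ) + 1) / 32) (N := (N : ℝ) + 1) (by positivity)
    (by positivity) (by
      filter_upwards [mem_interior_iff_mem_nhds.mp hb₀] with b hb
      exact hb.2)
  have hrad : 1 / (16 * (((N : ℝ) + 1) / 32)) = 2 * s N := by
    simp only [hs]
    field_simp
    norm_num
  rw [hrad] at hH
  have hmem : ∀ b ∈ ball b₀ δ, ∀ t : ℝ, 0 ≤ t → t ≤ s N → (b, t) ∈ ball b₀ δ ×ˢ ball (s N) (2 * s N) := by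
    intro b hb t ht ht'
    refine ⟨hb, ?_⟩
    rw [mem_ball_iff_norm, Real.norm_eq_abs, abs_lt]
    constructor <;> linarith [hs0 N]
  refine ⟨b₀, H, hH _ (hmem b₀ (mem_ball_self hδ) 0 le_rfl (hs0 N).le), ?_⟩
  rw [nhds_prod_eq] at hGH ⊢
  obtain ⟨pa, hpa, pb, hpb, hab⟩ := eventually_prod_iff.mp hGH
  have hpa' : ∀ᶠ b in 𝓝 b₀, pa b ∧ b ∈ ball b₀ δ := hpa.and (ball_mem_nhds _ hδ)
  refine (hpa'.prod_mk (gt_mem_nhds (hs0 N))).mono ?_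
  rintro ⟨b, t⟩ ⟨⟨hb1, hb2⟩, ht⟩ ht0
  -- on the line through `b`, the two functions agree by the identity theorem
  have hline : EqOn (fun t => G (b, t)) (fun t => H (b, t)) (Ioc 0 (s N)) := by
    refine AnalyticOnNhd.eqOn_of_preconnected_of_eventuallyEq (𝕜 := ℝ) (z₀ := s N) ?_ ?_
      isPreconnected_Ioc ⟨hs0 N, le_rfl⟩ ?_
    · intro u hu
      refine (h1 b u ⟨hu.1, hu.2.trans_lt hNε⟩).fun_comp_of_eq ?_ rfl
      exact analyticAt_const.prod analyticAt_id
    · intro u hu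
      refine (hH (b, u) (hmem b hb2 u hu.1.le hu.2)).fun_comp_of_eq ?_ rfl
      exact analyticAt_const.prod analyticAt_id
    · filter_upwards [hpb] with u hu
      exact hab hb1 hu
  rcases ht0.eq_or_lt with rfl | ht0
  · have l1 : Tendsto (fun t => G (b, t)) (𝓝[>] 0) (𝓝 (G (b, 0))) :=
      ((h0 b).continuousWithinAt.mono Ioi_subset_Ici_self).tendsto
    have l2 : Tendsto (fun t => H (b, t)) (𝓝[>] 0) (𝓝 (H (b, 0))) := by
      have hc : ContinuousAt (fun t => H (b, t)) 0 :=
        (hH (b, 0) (hmem b hb2 0 le_rfl (hs0 N).le)).continuousAt.comp (f := fun t : ℝ => (b, t))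
          (by fun_prop)
      exact hc.tendsto.mono_left nhdsWithin_le_nhds
    refine tendsto_nhds_unique l1 (l2.congr' ?_)
    filter_upwards [Ioc_mem_nhdsGT (hs0 N)] with u hu
    exact (hline hu).symm
  · exact hline ⟨ht0, le_of_lt ht⟩

end

/-! ### Sign changes, translations and inversions in half-space coordinates -/

section

/-- The sign vectors of product `1`; they index the diagonal matrices of `SO₀ n`. -/
def evenSigns (n : ℕ) : Subgroup (Fin n → ℤˣ) where
  carrier := {ε | ∏ i, ε i = 1}
  one_mem' := by simp
  mul_mem' := by
    intro a b ha hb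
    change ∏ i, a i = 1 at ha
    change ∏ i, b i = 1 at hb
    change ∏ i, (a i * b i) = 1
    rw [Finset.prod_mul_distrib, ha, hb, one_mul]
  inv_mem' := by
    intro a ha
    change ∏ i, a i = 1 at ha
    change ∏ i, (a i)⁻¹ = 1
    rw [Finset.prod_inv_distrib, ha, inv_one]

/-- The diagonal matrix with the given signs, and with `1` in the direction of time. -/
noncomputable def signMatrix {n : ℕ} (ε : Fin n → ℤˣ) : Matrix (Idx n) (Idx n) ℝ :=
  Matrix.diagonal (Sum.elim (fun i => ((ε i : ℤ) : ℝ)) fun _ => 1)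

theorem int_unit_mul_self (e : ℤˣ) : ((e : ℤ) : ℝ) * ((e : ℤ) : ℝ) = 1 := by
  rcases Int.units_eq_one_or e with rfl | rfl <;> simp

/-- The sign changes of the coordinates, as elements of `SO₀ n`. -/
noncomputable def signSO (n : ℕ) : evenSigns n →* SO₀ n where
  toFun ε := ⟨⟨signMatrix ε.1, by
      have h : ∏ i, ε.1 i = 1 := ε.2
      rw [signMatrix, Matrix.det_diagonal, Fintype.prod_sum_type]
      simp only [Sum.elim_inl, Sum.elim_inr, Finset.prod_const_one, mul_one]
      have := congrArg (fun u : ℤˣ => ((u : ℤ) : ℝ)) h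
      simpa using this⟩, by
      refine ⟨?_, by simp [signMatrix]⟩
      simp only [signMatrix, Matrix.diagonal_transpose, J,
        LieAlgebra.Orthogonal.indefiniteDiagonal, Matrix.diagonal_mul_diagonal]
      congr 1
      ext i
      rcases i with i | i <;> simp [int_unit_mul_self]⟩
  map_one' := by
    refine Subtype.ext (Subtype.ext ?_)
    change signMatrix (1 : Fin n → ℤˣ) = 1
    rw [signMatrix, ← Matrix.diagonal_one]
    congr 1
    ext i
    rcases i with i | i <;> simp
  map_mul' ε δ := by
    refine Subtype.ext (Subtype.ext ?_)
    change signMatrix (ε.1 * δ.1) = signMatrix ε.1 * signMatrix δ.1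
    simp only [signMatrix, Matrix.diagonal_mul_diagonal]
    congr 1
    ext i
    rcases i with i | i <;> simp

theorem proj_signSO_apply {n : ℕ} (ε : evenSigns n) (x : CBall n) (i : Fin n) :
    (proj n (signSO n ε) x).1 i = ((ε.1 i : ℤ) : ℝ) * x.1 i := by
  change projFun (signMatrix ε.1) x.1 i = _
  simp [projFun, signMatrix, Matrix.mulVec_diagonal, HypBall.lift]

/-- The sign vector with `-1` exactly at `i` and `j`. -/
def flipSigns {n : ℕ} (i j : Fin n) (hij : i ≠ j) : evenSigns n :=
  ⟨fun k => if k = i ∨ k = j then -1 else 1, by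
    change ∏ k, (if k = i ∨ k = j then (-1 : ℤˣ) else 1) = 1
    have h : (Finset.univ.filter fun k => k = i ∨ k = j) = {i, j} := by
      ext k
      simp
    rw [Finset.prod_ite, Finset.prod_const_one, Finset.prod_const, h, Finset.card_pair hij]
    simp⟩

theorem one_sub_norm_sq_projFun {n : ℕ} (g : SO₀ n) (x : CBall n) :
    1 - ‖projFun g.1.1 x.1‖ ^ 2
      = (1 - ‖x.1‖ ^ 2) / ((g.1.1 *ᵥ HypBall.lift x.1) (.inr ())) ^ 2 := by
  have hd := (den_pos g x).ne'
  have hq := quad_mulVec g (HypBall.lift x.1)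
  have e1 : ∀ j, HypBall.lift x.1 (.inl j) = x.1 j := fun _ => rfl
  have e2 : HypBall.lift x.1 (.inr ()) = 1 := rfl
  simp only [e1, e2] at hq
  rw [EuclideanSpace.real_norm_sq_eq, EuclideanSpace.real_norm_sq_eq]
  simp only [projFun, div_pow]
  rw [← Finset.sum_div]
  field_simp
  linarith

theorem J_transpose {n : ℕ} : (J n)ᵀ = J n := by
  rw [J, LieAlgebra.Orthogonal.indefiniteDiagonal, Matrix.diagonal_transpose]

variable {n : ℕ} [NeZero n]

/-- The horizontal part of a vector: the coordinate of index `0` is replaced by `0`. -/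
noncomputable def horiz (b : E n) : E n := WithLp.toLp 2 (Function.update (WithLp.ofLp b) 0 0)

@[simp] theorem horiz_zero_apply (b : E n) : horiz b 0 = 0 := by simp [horiz]

theorem horiz_apply_of_ne (b : E n) {i : Fin n} (hi : i ≠ 0) : horiz b i = b i := by
  simp [horiz, hi]

/-- The linear form `t - x₀`, as a vector; its kernel is tangent to the light cone along
`lightVec n`. -/
noncomputable def lightDual (n : ℕ) [NeZero n] : Idx n → ℝ :=
  Sum.elim (fun i => if i = 0 then -1 else 0) fun _ => 1

/-- The lightlike vector over the pole of the half-space chart. -/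
noncomputable def lightVec (n : ℕ) [NeZero n] : Idx n → ℝ :=
  Sum.elim (fun i => if i = 0 then 1 else 0) fun _ => 1

/-- The horizontal part of `b`, as a vector of `ℝⁿ⁺¹`. -/
noncomputable def spaceVec (b : E n) : Idx n → ℝ := Sum.elim (horiz b) fun _ => 0

theorem lightDual_dotProduct_lightVec : lightDual n ⬝ᵥ lightVec n = 0 := by
  simp [lightDual, lightVec, dotProduct, Fintype.sum_sum_type]

theorem lightDual_dotProduct_spaceVec (b : E n) : lightDual n ⬝ᵥ spaceVec b = 0 := by
  simp [lightDual, spaceVec, dotProduct, Fintype.sum_sum_type]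

theorem lightVec_dotProduct_spaceVec (b : E n) : lightVec n ⬝ᵥ spaceVec b = 0 := by
  simp [lightVec, spaceVec, dotProduct, Fintype.sum_sum_type]

theorem J_mulVec_lightVec : J n *ᵥ lightVec n = -lightDual n := by
  ext i
  rw [J, LieAlgebra.Orthogonal.indefiniteDiagonal, Matrix.mulVec_diagonal]
  rcases i with i | i
  · by_cases hi : i = 0 <;> simp [lightVec, lightDual, hi]
  · simp [lightVec, lightDual]

theorem J_mulVec_spaceVec (b : E n) : J n *ᵥ spaceVec b = spaceVec b := by
  ext i
  rw [J, LieAlgebra.Orthogonal.indefiniteDiagonal, Matrix.mulVec_diagonal]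
  rcases i with i | i <;> simp [spaceVec]

/-- The parabolic matrix that fixes `lightVec n` and that translates the half-space by `horiz b`. -/
noncomputable def transMatrix (b : E n) : Matrix (Idx n) (Idx n) ℝ :=
  1 + Matrix.vecMulVec (spaceVec b) (lightDual n)
    + Matrix.vecMulVec (lightVec n)
      (spaceVec b + ((spaceVec b ⬝ᵥ spaceVec b) / 2) • lightDual n)

theorem spaceVec_add (b c : E n) : spaceVec (b + c) = spaceVec b + spaceVec c := by
  ext i
  rcases i with i | i
  · by_cases hi : i = 0
    · subst hi; simp [spaceVec]
    · simp [spaceVec, horiz_apply_of_ne, hi]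
  · simp [spaceVec]

theorem transMatrix_add (b c : E n) : transMatrix (b + c) = transMatrix b * transMatrix c := by
  have h1 := lightDual_dotProduct_lightVec (n := n)
  have h3 := lightDual_dotProduct_spaceVec c
  have h4 := lightVec_dotProduct_spaceVec b
  have h5 := dotProduct_comm (spaceVec b) (lightVec n)
  have h6 := dotProduct_comm (spaceVec b) (spaceVec c)
  have h7 : spaceVec b ⬝ᵥ lightVec n = 0 := h5.trans h4
  simp only [transMatrix, Matrix.add_mul, Matrix.mul_add, Matrix.one_mul, Matrix.mul_one,
    Matrix.vecMulVec_mul_vecMulVec, spaceVec_add, add_dotProduct, dotProduct_add,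
    h1, h3, h7, Matrix.vecMulVec_add, Matrix.add_vecMulVec, Matrix.vecMulVec_smul,
    add_zero, zero_smul, h6, smul_zero,
    Matrix.smul_mul, Matrix.mul_smul, Matrix.vecMulVec_zero]
  module

theorem transMatrix_transpose_mul (b : E n) :
    (transMatrix b)ᵀ * J n * transMatrix b = J n := by
  have h1 := lightDual_dotProduct_lightVec (n := n)
  have h1' : lightVec n ⬝ᵥ lightDual n = 0 := (dotProduct_comm _ _).trans h1
  have h2 := lightDual_dotProduct_spaceVec b
  have h2' : spaceVec b ⬝ᵥ lightDual n = 0 := (dotProduct_comm _ _).trans h2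
  have h4 := lightVec_dotProduct_spaceVec b
  have k1 : lightVec n ᵥ* J n = -lightDual n := by
    rw [← Matrix.mulVec_transpose, J_transpose, J_mulVec_lightVec]
  have k2 : spaceVec b ᵥ* J n = spaceVec b := by
    rw [← Matrix.mulVec_transpose, J_transpose, J_mulVec_spaceVec]
  have hJ : J n * transMatrix b = J n + Matrix.vecMulVec (spaceVec b) (lightDual n)
      - Matrix.vecMulVec (lightDual n)
        (spaceVec b + ((spaceVec b ⬝ᵥ spaceVec b) / 2) • lightDual n) := by
    rw [transMatrix, Matrix.mul_add, Matrix.mul_add, Matrix.mul_one, Matrix.mul_vecMulVec,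
      Matrix.mul_vecMulVec, J_mulVec_lightVec, J_mulVec_spaceVec, Matrix.neg_vecMulVec,
      sub_eq_add_neg]
  have hT : (transMatrix b)ᵀ = 1 + Matrix.vecMulVec (lightDual n) (spaceVec b)
      + Matrix.vecMulVec (spaceVec b + ((spaceVec b ⬝ᵥ spaceVec b) / 2) • lightDual n)
        (lightVec n) := by
    rw [transMatrix, Matrix.transpose_add, Matrix.transpose_add, Matrix.transpose_one,
      Matrix.transpose_vecMulVec, Matrix.transpose_vecMulVec]
  have e1 : Matrix.vecMulVec (lightDual n) (spaceVec b) * J n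
      = Matrix.vecMulVec (lightDual n) (spaceVec b) := by rw [Matrix.vecMulVec_mul, k2]
  have e2 : ∀ u : Idx n → ℝ, Matrix.vecMulVec u (lightVec n) * J n = -Matrix.vecMulVec u (lightDual n) := by
    intro u
    rw [Matrix.vecMulVec_mul, k1, Matrix.vecMulVec_neg]
  rw [Matrix.mul_assoc, hJ, hT]
  simp only [Matrix.add_mul, Matrix.mul_add, Matrix.mul_sub, Matrix.one_mul, e1, e2,
    Matrix.vecMulVec_mul_vecMulVec, h1', h2', h4,
    Matrix.vecMulVec_add, Matrix.add_vecMulVec, Matrix.vecMulVec_smul, Matrix.smul_vecMulVec,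
    zero_smul, Matrix.vecMulVec_zero, add_zero, Matrix.smul_mul, Matrix.mul_smul,
    smul_zero]
  module

/-- The determinant is a sign, and a square since `transMatrix b` is the square of
`transMatrix (b / 2)`. -/
theorem det_transMatrix (b : E n) : (transMatrix b).det = 1 := by
  have h1 : ∀ c : E n, (transMatrix c).det ^ 2 = 1 := by
    intro c
    have h := congrArg Matrix.det (transMatrix_transpose_mul c)
    rw [Matrix.det_mul, Matrix.det_mul, Matrix.det_transpose] at h
    have hJ : (J n).det ≠ 0 := by
      have := congrArg Matrix.det (J_mul_J n)
      rw [Matrix.det_mul, Matrix.det_one] at this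
      exact left_ne_zero_of_mul_eq_one this
    have h' : ((transMatrix c).det ^ 2 - 1) * (J n).det = 0 := by linear_combination h
    rcases mul_eq_zero.mp h' with h' | h'
    · linarith
    · exact absurd h' hJ
  have h2 : b = (1 / 2 : ℝ) • b + (1 / 2 : ℝ) • b := by module
  rw [h2, transMatrix_add, Matrix.det_mul, ← sq, h1]

/-- The horizontal translation of the half-space by `b`, as an element of `SO₀ n`. -/
noncomputable def transSO (b : E n) : SO₀ n :=
  ⟨⟨transMatrix b, det_transMatrix b⟩, transMatrix_transpose_mul b, by
    have h : 0 ≤ spaceVec b ⬝ᵥ spaceVec b :=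
      Finset.sum_nonneg fun i _ => mul_self_nonneg _
    simp only [transMatrix, Matrix.add_apply, Matrix.vecMulVec_apply]
    simp [spaceVec, lightDual, lightVec] at h ⊢
    linarith⟩

theorem transMatrix_mulVec_lift (b x : E n) :
    transMatrix b *ᵥ HypBall.lift x = HypBall.lift x + (1 - x 0) • spaceVec b
      + (spaceVec b ⬝ᵥ HypBall.lift x + (spaceVec b ⬝ᵥ spaceVec b) / 2 * (1 - x 0)) • lightVec n := by
  have h : lightDual n ⬝ᵥ HypBall.lift x = 1 - x 0 := by
    simp [lightDual, dotProduct, Fintype.sum_sum_type, HypBall.lift]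
    ring
  rw [transMatrix, Matrix.add_mulVec, Matrix.add_mulVec, Matrix.one_mulVec,
    Matrix.vecMulVec_mulVec, Matrix.vecMulVec_mulVec, add_dotProduct, smul_dotProduct, h]
  simp only [op_smul_eq_smul, smul_eq_mul]

/-- In the half-space chart, the parabolic elements act as the horizontal translations. -/
theorem kleinFun_proj_transSO (b : E n) {x : CBall n} (hx : x.1 0 < 1) :
    kleinFun (proj n (transSO b) x).1 = kleinFun x.1 + horiz b := by
  have hd := den_pos (transSO b) x
  have hn := one_sub_norm_sq_projFun (transSO b) x
  change kleinFun (projFun (transMatrix b) x.1) = _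
  change 0 < (transMatrix b *ᵥ HypBall.lift x.1) (.inr ()) at hd
  change 1 - ‖projFun (transMatrix b) x.1‖ ^ 2
    = (1 - ‖x.1‖ ^ 2) / ((transMatrix b *ᵥ HypBall.lift x.1) (.inr ())) ^ 2 at hn
  have hx1 : 1 - x.1 0 ≠ 0 := by linarith
  set s : ℝ := spaceVec b ⬝ᵥ HypBall.lift x.1 + (spaceVec b ⬝ᵥ spaceVec b) / 2 * (1 - x.1 0) with hs
  have ht : (transMatrix b *ᵥ HypBall.lift x.1) (.inr ()) = 1 + s := by
    rw [transMatrix_mulVec_lift, ← hs]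
    simp [HypBall.lift, spaceVec, lightVec]
  have h0 : (transMatrix b *ᵥ HypBall.lift x.1) (.inl 0) = x.1 0 + s := by
    rw [transMatrix_mulVec_lift, ← hs]
    simp [HypBall.lift, spaceVec, lightVec]
  have hi : ∀ i, i ≠ 0 → (transMatrix b *ᵥ HypBall.lift x.1) (.inl i)
      = x.1 i + (1 - x.1 0) * b i := by
    intro i hi
    rw [transMatrix_mulVec_lift, ← hs]
    simp [HypBall.lift, spaceVec, lightVec, hi, horiz_apply_of_ne]
  rw [ht] at hd hn
  have hp0 : 1 - projFun (transMatrix b) x.1 0 = (1 - x.1 0) / (1 + s) := by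
    simp only [projFun, ht, h0]
    field_simp
    ring
  ext i
  rw [PiLp.add_apply]
  by_cases hi0 : i = 0
  · subst hi0
    simp only [kleinFun, if_true, horiz_zero_apply, add_zero, hn, hp0]
    field_simp
  · have : projFun (transMatrix b) x.1 i = (x.1 i + (1 - x.1 0) * b i) / (1 + s) := by
      simp only [projFun, ht, hi i hi0]
    simp only [kleinFun, hi0, if_false, horiz_apply_of_ne b hi0, hp0, this]
    field_simp

/-- In the half-space chart, the sign changes that exchange the two poles act as inversions
(composed with sign changes). -/
theorem kleinFun_proj_signSO {ε : evenSigns n} (hε : ε.1 0 = -1) {x : CBall n} (hx : x.1 0 < 1)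
    (hx' : -1 < x.1 0) {z : E n} (hz : kleinFun x.1 = z) :
    kleinFun (proj n (signSO n ε) x).1 = WithLp.toLp 2 fun i =>
      if i = 0 then z 0 / (‖z‖ ^ 2 - z 0 ^ 2 + z 0) ^ 2
      else ((ε.1 i : ℤ) : ℝ) * z i / (‖z‖ ^ 2 - z 0 ^ 2 + z 0) := by
  have h1 : 1 - x.1 0 ≠ 0 := by linarith
  have h2 : 1 + x.1 0 ≠ 0 := by linarith
  have hz0 : z 0 = (1 - ‖x.1‖ ^ 2) / (1 - x.1 0) ^ 2 := by rw [← hz]; simp [kleinFun]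
  have hD : ‖z‖ ^ 2 - z 0 ^ 2 + z 0 = (1 + x.1 0) / (1 - x.1 0) := by
    rw [← hz, norm_sq_kleinFun, hz, hz0]
    field_simp
    ring
  have hy0 : (proj n (signSO n ε) x).1 0 = - x.1 0 := by
    rw [proj_signSO_apply, hε]
    simp
  have hyn : ‖(proj n (signSO n ε) x).1‖ ^ 2 = ‖x.1‖ ^ 2 := by
    rw [EuclideanSpace.real_norm_sq_eq, EuclideanSpace.real_norm_sq_eq]
    refine Finset.sum_congr rfl fun i _ => ?_
    rw [proj_signSO_apply, mul_pow, sq ((_ : ℤ) : ℝ), int_unit_mul_self, one_mul]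
  ext i
  simp only [kleinFun, hy0, hyn, hD, sub_neg_eq_add]
  by_cases hi : i = 0
  · simp only [hi, if_true, hz0]
    field_simp
  · have hzi : z i = x.1 i / (1 - x.1 0) := by rw [← hz]; simp [kleinFun, hi]
    simp only [hi, if_false, proj_signSO_apply, hzi]
    field_simp

end

/-! ### Analytic self-maps of the ball and rigidity -/

section

variable {n : ℕ}

open Classical in
/-- A self-map of the closed ball as a map of the ambient space, extended by `0`. -/
noncomputable def ballExt (f : CBall n → CBall n) (x : E n) : E n :=
  if h : x ∈ Metric.closedBall (0 : E n) 1 then (f ⟨x, h⟩).1 else 0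

theorem ballExt_of_mem (f : CBall n → CBall n) {x : E n} (h : x ∈ Metric.closedBall (0 : E n) 1) :
    ballExt f x = (f ⟨x, h⟩).1 := dif_pos h

@[simp] theorem ballExt_coe (f : CBall n → CBall n) (x : CBall n) : ballExt f x.1 = (f x).1 :=
  ballExt_of_mem f x.2

theorem ballExt_mem (f : CBall n → CBall n) (x : E n) :
    ballExt f x ∈ Metric.closedBall (0 : E n) 1 := by
  unfold ballExt
  split_ifs
  · exact (f _).2
  · simp

theorem analyticBallMapOn_iff {f : CBall n → CBall n} {s : Set (E n)}
    (hs : s ⊆ Metric.closedBall 0 1) : AnalyticBallMapOn f s ↔ AnalyticOn ℝ (ballExt f) s := by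
  constructor
  · rintro ⟨F, hF, hFf⟩
    refine hF.congr fun x hx => ?_
    rw [ballExt_of_mem f (hs hx)]
    exact (hFf ⟨x, hs hx⟩ hx).symm
  · intro h
    exact ⟨ballExt f, h, fun x _ => ballExt_coe f x⟩

theorem continuousOn_ballExt {f : CBall n → CBall n} (hf : Continuous f) :
    ContinuousOn (ballExt f) (Metric.closedBall 0 1) := by
  rw [continuousOn_iff_continuous_domRestrict]
  have : (Metric.closedBall (0 : E n) 1).domRestrict (ballExt f) = fun x : CBall n => (f x).1 :=
    funext fun x => ballExt_coe f x
  rw [this]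
  exact continuous_subtype_val.comp hf

theorem ballExt_comp (f g : CBall n → CBall n) {x : E n} (h : x ∈ Metric.closedBall (0 : E n) 1) :
    ballExt (f ∘ g) x = ballExt f (ballExt g x) := by
  rw [ballExt_of_mem _ h, ballExt_of_mem g h, ballExt_coe]
  rfl

theorem analyticBallMapOn_id : AnalyticBallMapOn (id : CBall n → CBall n) (Metric.closedBall 0 1) :=
  ⟨id, analyticOn_id, fun _ _ => rfl⟩

/-- By continuity, the analytic extension of the action is the conjugated action itself. -/
theorem HypBall.IsCompactification.analyticBallMapOn_conjAction {φ : CBall n ≃ₜ CBall n}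
    (hφ : IsCompactification φ) (g : SO₀ n) :
    AnalyticBallMapOn (conjAction φ g) (Metric.closedBall 0 1) := by
  obtain ⟨F, hF, hFφ⟩ := hφ.extension g
  have h : Set.EqOn F (ballExt (conjAction φ g)) (Metric.closedBall 0 1) := by
    refine Set.EqOn.of_subset_closure (s := Metric.ball 0 1) ?_ hF.continuousOn
      (continuousOn_ballExt (conjAction φ g).continuous) Metric.ball_subset_closedBall
      (closure_ball _ one_ne_zero).ge
    intro x hx
    rw [ballExt_of_mem _ (Metric.ball_subset_closedBall hx)]
    exact hFφ ⟨x, Metric.ball_subset_closedBall hx⟩ (mem_ball_zero_iff.mp hx)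
  exact ⟨F, hF, fun x _ => (h x.2).trans (ballExt_coe _ x)⟩

theorem ballExt_symm_ballExt {ψ : CBall n ≃ₜ CBall n} {v : E n}
    (hv : v ∈ Metric.closedBall (0 : E n) 1) :
    ballExt ψ.symm (ballExt ψ v) = v := by
  rw [ballExt_of_mem _ hv, ballExt_coe]; simp

theorem ballExt_ballExt_symm {ψ : CBall n ≃ₜ CBall n} {v : E n}
    (hv : v ∈ Metric.closedBall (0 : E n) 1) :
    ballExt ψ (ballExt ψ.symm v) = v := by
  rw [ballExt_of_mem _ hv, ballExt_coe]; simp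

theorem HypBall.AnalyticallyConjugate.symm {φ ψ : CBall n ≃ₜ CBall n} (h : AnalyticallyConjugate φ ψ) :
    AnalyticallyConjugate ψ φ := by
  obtain ⟨k, hk, hc⟩ := h
  refine ⟨k.symm, ⟨hk.2, by simpa using hk.1⟩, fun g x => ?_⟩
  rw [k.symm_apply_eq, hc, k.apply_symm_apply]

theorem analyticallyConjugate_refl (φ : CBall n ≃ₜ CBall n) : AnalyticallyConjugate φ φ :=
  ⟨Homeomorph.refl _, ⟨analyticBallMapOn_id, analyticBallMapOn_id⟩, fun _ _ => rfl⟩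

/-! ### Transitivity on the open ball, and rigidity of intertwiners -/

theorem norm_proj_lt_one_iff (g : SO₀ n) (x : CBall n) : ‖(proj n g x).1‖ < 1 ↔ ‖x.1‖ < 1 := by
  have hd := den_pos g x
  have h := one_sub_norm_sq_projFun g x
  have h1 : ∀ y : E n, ‖y‖ < 1 ↔ 0 < 1 - ‖y‖ ^ 2 := fun y => by
    rw [sub_pos, sq_lt_one_iff₀ (norm_nonneg _)]
  rw [h1, h1]
  change 0 < 1 - ‖projFun g.1.1 x.1‖ ^ 2 ↔ _
  rw [h]
  exact div_pos_iff_of_pos_right (by positivity)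

theorem abs_coord_lt_one {x : E n} (hx : ‖x‖ < 1) (i : Fin n) : |x i| < 1 :=
  (PiLp.norm_apply_le x i).trans_lt hx

/-- The centre of the ball. -/
def ballZero (n : ℕ) : CBall n := ⟨0, by simp⟩

theorem eq_zero_of_fixed_by_signs (hn : 2 ≤ n) {x : CBall n}
    (hx : ∀ ε, proj n (signSO n ε) x = x) : x = ballZero n := by
  refine Subtype.ext ?_
  ext i
  have : Nontrivial (Fin n) := Fin.nontrivial_iff_two_le.mpr hn
  obtain ⟨j, hj⟩ := exists_ne i
  have h := congrArg (fun y : CBall n => y.1 i) (hx (flipSigns i j hj.symm))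
  simp only [proj_signSO_apply] at h
  have h2 : (flipSigns i j hj.symm).1 i = -1 := by simp [flipSigns]
  rw [h2] at h
  simp only [Units.val_neg, Units.val_one, Int.cast_neg, Int.cast_one] at h
  change x.1 i = 0
  linarith

theorem proj_signSO_ballZero (ε : evenSigns n) : proj n (signSO n ε) (ballZero n) = ballZero n := by
  refine Subtype.ext ?_
  ext i
  rw [proj_signSO_apply]
  simp [ballZero]

theorem dense_interior_cball : Dense {x : CBall n | ‖x.1‖ < 1} := by
  rw [Subtype.dense_iff]
  have : Subtype.val '' {x : CBall n | ‖x.1‖ < 1} = Metric.ball (0 : E n) 1 := by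
    ext y
    simp only [Set.mem_image, Set.mem_ofPred_eq, mem_ball_zero_iff]
    constructor
    · rintro ⟨x, hx, rfl⟩; exact hx
    · intro hy
      exact ⟨⟨y, mem_closedBall_zero_iff.mpr hy.le⟩, hy, rfl⟩
  rw [this, closure_ball _ one_ne_zero]

variable [NeZero n]

theorem eq_of_kleinFun_eq {x y : CBall n} (hx : x.1 0 < 1) (hy : y.1 0 < 1)
    (h : kleinFun x.1 = kleinFun y.1) : x = y :=
  Subtype.ext (by rw [← kleinInv_kleinFun hx, h, kleinInv_kleinFun hy])

theorem kleinFun_zero_pos {x : E n} (hx : ‖x‖ < 1) : 0 < kleinFun x 0 := by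
  have h1 := abs_lt.mp (abs_coord_lt_one hx 0)
  have h2 : ‖x‖ ^ 2 < 1 := (sq_lt_one_iff₀ (norm_nonneg _)).mpr hx
  have h3 : 0 < 1 - x 0 := by linarith [h1.2]
  simp only [kleinFun, if_true]
  exact div_pos (by linarith) (by positivity)

/-- The translations move each point of the orbit of the centre to the vertical axis. -/
theorem exists_orbit_of_height (t : ℝ) {g : SO₀ n} {x : CBall n}
    (hx : ‖x.1‖ < 1) (hg : proj n g (ballZero n) = x)
    (hz : kleinFun x.1 0 = t) : ∃ g' : SO₀ n,
      kleinFun (proj n g' (ballZero n)).1 = EuclideanSpace.single 0 t := by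
  have h0 : x.1 0 < 1 := (abs_lt.mp (abs_coord_lt_one hx 0)).2
  refine ⟨transSO (-kleinFun x.1) * g, ?_⟩
  have e : proj n (transSO (-kleinFun x.1) * g) (ballZero n)
      = proj n (transSO (-kleinFun x.1)) x := by
    rw [← hg, map_mul]; rfl
  rw [e, kleinFun_proj_transSO _ h0]
  ext i
  by_cases hi : i = 0
  · subst hi; simp [hz]
  · simp [horiz_apply_of_ne, hi]

/-- A translation, followed by an inversion, changes the height `t` into `t / (a ^ 2 + t) ^ 2`. -/
theorem exists_orbit_height_step (hn : 2 ≤ n) {t : ℝ} (a : ℝ)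
    (h : ∃ g : SO₀ n, kleinFun (proj n g (ballZero n)).1 = EuclideanSpace.single 0 t) :
    ∃ g : SO₀ n, kleinFun (proj n g (ballZero n)).1
      = EuclideanSpace.single 0 (t / (a ^ 2 + t) ^ 2) := by
  obtain ⟨g, hg⟩ := h
  have hint : ∀ g : SO₀ n, ‖(proj n g (ballZero n)).1‖ < 1 := fun g => by
    rw [norm_proj_lt_one_iff]
    simp [ballZero]
  have : Nontrivial (Fin n) := Fin.nontrivial_iff_two_le.mpr hn
  obtain ⟨j, hj⟩ := exists_ne (0 : Fin n)
  set b : E n := EuclideanSpace.single j a with hb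
  set x : CBall n := proj n g (ballZero n) with hxdef
  have hx0 := (abs_lt.mp (abs_coord_lt_one (hint g) 0)).2
  set y : CBall n := proj n (transSO b) x with hydef
  have hy : y = proj n (transSO b * g) (ballZero n) := by rw [map_mul]; rfl
  have hyint : ‖y.1‖ < 1 := by rw [hy]; exact hint _
  have hy0 := abs_lt.mp (abs_coord_lt_one hyint 0)
  have hky : kleinFun y.1 = EuclideanSpace.single 0 t + horiz b := by
    rw [hydef, kleinFun_proj_transSO _ hx0, hg]
  have hw := kleinFun_proj_signSO (ε := flipSigns 0 j hj.symm) (by simp [flipSigns]) hy0.2 hy0.1 hky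
  have hzz : (EuclideanSpace.single 0 t + horiz b : E n) 0 = t := by simp
  have hnn : ‖(EuclideanSpace.single 0 t + horiz b : E n)‖ ^ 2
      - (EuclideanSpace.single 0 t + horiz b : E n) 0 ^ 2 = a ^ 2 := by
    rw [norm_sq_split, add_sub_cancel_left, Finset.sum_eq_single j]
    · simp [hj, hb, horiz_apply_of_ne]
    · intro i hi hij
      simp [(Finset.mem_erase.mp hi).1, hb, horiz_apply_of_ne, hij]
    · simp [hj]
  refine exists_orbit_of_height (g := signSO n (flipSigns 0 j hj.symm) * (transSO b * g)) _
    (x := proj n (signSO n (flipSigns 0 j hj.symm)) y) ?_ ?_ ?_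
  · rw [norm_proj_lt_one_iff]; exact hyint
  · rw [hy, map_mul]; rfl
  · rw [hw, hnn, hzz]
    simp

/-- `SO₀ n` acts transitively on the open ball. -/
theorem exists_proj_ballZero_eq (hn : 2 ≤ n) {x : CBall n} (hx : ‖x.1‖ < 1) :
    ∃ g : SO₀ n, proj n g (ballZero n) = x := by
  have h1 : ∃ g : SO₀ n, kleinFun (proj n g (ballZero n)).1 = EuclideanSpace.single 0 1 := by
    refine ⟨1, ?_⟩
    rw [map_one]
    change kleinFun (0 : E n) = _
    ext i
    by_cases hi : i = 0
    · subst hi; simp [kleinFun]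
    · simp [kleinFun, hi]
  have h2 : ∀ t : ℝ, 0 < t → t ≤ 1 →
      ∃ g : SO₀ n, kleinFun (proj n g (ballZero n)).1 = EuclideanSpace.single 0 t := by
    intro t ht ht1
    have hs : 0 < √t := Real.sqrt_pos.mpr ht
    have hs1 : √t ≤ 1 := Real.sqrt_le_one.mpr ht1
    have hs2 : √(√t) ≤ 1 := Real.sqrt_le_one.mpr hs1
    have h3 : 0 ≤ 1 / √t - 1 := by
      rw [sub_nonneg, one_le_div hs]
      exact hs1
    have h := exists_orbit_height_step hn (√(1 / √t - 1)) h1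
    rw [Real.sq_sqrt h3, sub_add_cancel, div_pow, one_pow, Real.sq_sqrt ht.le, one_div_one_div] at h
    exact h
  have h4 : ∀ t : ℝ, 0 < t →
      ∃ g : SO₀ n, kleinFun (proj n g (ballZero n)).1 = EuclideanSpace.single 0 t := by
    intro t ht
    rcases le_total t 1 with h | h
    · exact h2 t ht h
    · have := exists_orbit_height_step hn (t := 1 / t) 0
        (h2 (1 / t) (by positivity) (by rw [div_le_one ht]; exact h))
      have e : 1 / t / (0 ^ 2 + 1 / t) ^ 2 = t := by field_simp; ring
      rwa [e] at this
  obtain ⟨g, hg⟩ := h4 _ (kleinFun_zero_pos hx)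
  have hint : ‖(proj n g (ballZero n)).1‖ < 1 := by
    rw [norm_proj_lt_one_iff]
    simp [ballZero]
  refine ⟨transSO (kleinFun x.1) * g, ?_⟩
  have e : proj n (transSO (kleinFun x.1) * g) (ballZero n)
      = proj n (transSO (kleinFun x.1)) (proj n g (ballZero n)) := by
    rw [map_mul]; rfl
  rw [e]
  refine eq_of_kleinFun_eq ?_ (abs_lt.mp (abs_coord_lt_one hx 0)).2 ?_
  · refine (abs_lt.mp (abs_coord_lt_one ?_ 0)).2
    rw [norm_proj_lt_one_iff]
    exact hint
  · rw [kleinFun_proj_transSO _ (abs_lt.mp (abs_coord_lt_one hint 0)).2, hg]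
    ext i
    by_cases hi : i = 0
    · subst hi; simp
    · simp [horiz_apply_of_ne, hi]

/-- A continuous map that commutes with the projective action fixes the centre, the only fixed point
of the sign changes, and so all points. -/
theorem eq_self_of_commutes_proj (hn : 2 ≤ n) {k : CBall n → CBall n} (hc : Continuous k)
    (hk : ∀ g x, k (proj n g x) = proj n g (k x)) (x : CBall n) : k x = x := by
  have h0 : k (ballZero n) = ballZero n := by
    refine eq_zero_of_fixed_by_signs hn fun ε => ?_
    rw [← hk, proj_signSO_ballZero]
  have : k = id := by
    refine hc.ext_on dense_interior_cball continuous_id ?_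
    intro x hx
    obtain ⟨g, rfl⟩ := exists_proj_ballZero_eq hn hx
    rw [hk, h0]
    rfl
  rw [this]
  rfl

/-- Only one map can intertwine the actions of two compactifications, namely `ψ⁻¹ ∘ φ`. -/
theorem eq_of_intertwines (hn : 2 ≤ n) {φ ψ h : CBall n ≃ₜ CBall n}
    (hh : ∀ (g : SO₀ n) (x : CBall n), h (conjAction φ g x) = conjAction ψ g (h x))
    (x : CBall n) : ψ (h x) = φ x := by
  have := eq_self_of_commutes_proj hn (k := fun y => ψ (h (φ.symm y))) (by fun_prop) (by
    intro g y
    have h1 := hh g (φ.symm y)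
    have h2 : conjAction φ g (φ.symm y) = φ.symm (proj n g y) := by simp [conjAction]
    rw [h2] at h1
    rw [h1]
    simp [conjAction]) (φ x)
  simpa using this

end

/-! ### Half-space charts and the exponent of a compactification -/

section

variable {n : ℕ} [NeZero n]

theorem powerMap_apply_zero (p : ℕ) (z : E n) : powerMap p z 0 = z 0 ^ p := by
  simp [powerMap]

theorem powerMap_apply_of_ne (p : ℕ) (z : E n) {i : Fin n} (hi : i ≠ 0) :
    powerMap p z i = z i := by
  simp [powerMap, hi]

theorem powerMap_injOn {p : ℕ} (hp : 1 ≤ p) : Set.InjOn (powerMap p) {z : E n | 0 ≤ z 0} := by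
  intro z hz w hw h
  ext i
  by_cases hi : i = 0
  · subst hi
    have := congrArg (fun v : E n => v 0) h
    simp only [powerMap_apply_zero] at this
    exact (pow_left_inj₀ hz hw (by omega)).mp this
  · have := congrArg (fun v : E n => v i) h
    simpa only [powerMap_apply_of_ne _ _ hi] using this

theorem powerMap_mem {p : ℕ} {z : E n} (hz : 0 ≤ z 0) : 0 ≤ powerMap p z 0 := by
  rw [powerMap_apply_zero]
  positivity

section charts

variable (c : HalfSpaceChart n)

theorem HypBall.HalfSpaceChart.mem_source {x : E n} (hx : x ∈ Metric.closedBall (0 : E n) 1)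
    (h : x ≠ c.pole) : x ∈ c.equiv.source := by
  rw [c.source_eq]
  exact ⟨hx, h⟩

theorem HypBall.HalfSpaceChart.equiv_zero_nonneg {x : E n} (hx : x ∈ c.equiv.source) :
    0 ≤ c.equiv x 0 := by
  have := c.equiv.map_source hx
  rwa [c.target_eq] at this

theorem HypBall.HalfSpaceChart.symm_mem {z : E n} (hz : 0 ≤ z 0) :
    c.equiv.symm z ∈ Metric.closedBall (0 : E n) 1 ∧ c.equiv.symm z ≠ c.pole := by
  have := c.equiv.map_target (x := z) (by rw [c.target_eq]; exact hz)
  rw [c.source_eq] at this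
  exact this

end charts

theorem HypBall.IsPowerMapIn.ne_pole {c c' : HalfSpaceChart n} {p : ℕ} {φ : CBall n ≃ₜ CBall n}
    (h : IsPowerMapIn c c' p φ) {x : CBall n} (hx : (φ x).1 ≠ c'.pole) : x.1 ≠ c.pole :=
  fun hxc => hx ((h x).1 hxc)

open Filter Topology in
/-- If an analytic map of the ball turns a compactification given by `φ_p` into one given by `φ_q`,
then `q ≤ p`: over the origin of the chart, its height `y` satisfies `y ^ q = t ^ p` and vanishes at
least to the first order in `t`. -/
theorem le_of_powerMapIn_of_analytic {c c' c'' : HalfSpaceChart n} {p q : ℕ} (hp : 1 ≤ p)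
    {φ ψ h : CBall n ≃ₜ CBall n} (hφ : IsPowerMapIn c c'' p φ)
    (hψ : IsPowerMapIn c' c'' q ψ) (hh : AnalyticBallMapOn h (Metric.closedBall 0 1))
    (hψh : ∀ x, ψ (h x) = φ x) : q ≤ p := by
  by_contra! hpq
  rw [analyticBallMapOn_iff subset_rfl] at hh
  set e : E n := EuclideanSpace.single 0 1 with he
  have he0 : ∀ t : ℝ, (t • e) 0 = t := fun t => by simp [he]
  have hz : ∀ t : ℝ, 0 ≤ t → 0 ≤ (t • e) 0 := fun t ht => by rwa [he0]
  -- the point of height `t` above the origin of the chart `c`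
  set X : ℝ → E n := fun t => c.equiv.symm (t • e) with hX
  set Y : ℝ → E n := fun t => c'.equiv (ballExt h (X t)) with hY
  have hXm : ∀ t, 0 ≤ t → X t ∈ Metric.closedBall (0 : E n) 1 ∧ X t ≠ c.pole := fun t ht =>
    c.symm_mem (hz t ht)
  have hhX : ∀ t, 0 ≤ t → ballExt h (X t) ∈ c'.equiv.source := by
    intro t ht
    refine c'.mem_source (ballExt_mem _ _) ?_
    rw [ballExt_of_mem _ (hXm t ht).1]
    refine hψ.ne_pole ?_
    rw [hψh]
    exact ((hφ ⟨X t, (hXm t ht).1⟩).2 (hXm t ht).2).1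
  have hYpow : ∀ t, 0 ≤ t → Y t 0 ^ q = t ^ p := by
    intro t ht
    have e1 := ((hφ ⟨X t, (hXm t ht).1⟩).2 (hXm t ht).2).2
    have hne : (h ⟨X t, (hXm t ht).1⟩).1 ≠ c'.pole := by
      have := hhX t ht
      rw [c'.source_eq, ballExt_of_mem _ (hXm t ht).1] at this
      exact this.2
    have e2 := ((hψ (h ⟨X t, (hXm t ht).1⟩)).2 hne).2
    rw [hψh, e1] at e2
    have e3 := congrArg (fun v : E n => v 0) e2
    simp only [powerMap_apply_zero] at e3
    have e4 : c.equiv (X t) = t • e := by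
      rw [hX]
      exact c.equiv.right_inv (by rw [c.target_eq]; exact hz t ht)
    rw [e4, he0] at e3
    simp only [hY, ballExt_of_mem _ (hXm t ht).1]
    rw [← e3]
  have hYan : AnalyticWithinAt ℝ Y (Set.Ici 0) 0 := by
    have a1 : AnalyticOn ℝ (fun t : ℝ => t • e) (Set.Ici 0) :=
      analyticOn_id.smul analyticOn_const
    have a2 : AnalyticOn ℝ X (Set.Ici 0) :=
      c.analytic_symm.comp a1 (fun t ht => by rw [c.target_eq]; exact hz t ht)
    have a3 := hh.comp a2 (fun t ht => (hXm t ht).1)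
    exact (c'.analytic.comp a3 (fun t ht => hhX t ht)) 0 Set.self_mem_Ici
  have hY0 : Y 0 0 = 0 := by
    have := hYpow 0 le_rfl
    rw [zero_pow (by omega)] at this
    exact pow_eq_zero_iff (by omega) |>.mp this
  have hd : DifferentiableWithinAt ℝ (fun t => Y t 0) (Set.Ici 0) 0 := by
    have := hYan.differentiableWithinAt
    rw [Set.insert_eq_of_mem Set.self_mem_Ici] at this
    exact (EuclideanSpace.proj (𝕜 := ℝ) (0 : Fin n)).differentiableAt.comp_differentiableWithinAt
      _ this
  obtain ⟨C, hC, hbound⟩ := hd.isBigO_sub.exists_pos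
  have hev : ∀ᶠ t : ℝ in 𝓝[>] 0, C ^ q * t < 1 ∧ t < 1 ∧ ‖Y t 0 - Y 0 0‖ ≤ C * ‖t - 0‖ := by
    refine Filter.Eventually.and ?_ (Filter.Eventually.and ?_ ?_)
    · refine nhdsWithin_le_nhds ?_
      have : ContinuousAt (fun t : ℝ => C ^ q * t) 0 := by fun_prop
      exact this.eventually_lt_const (by simp)
    · exact nhdsWithin_le_nhds (gt_mem_nhds one_pos)
    · exact nhdsWithin_mono _ Set.Ioi_subset_Ici_self hbound.bound
  obtain ⟨t, ⟨h1, h2, h3⟩, ht⟩ := (hev.and self_mem_nhdsWithin).exists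
  have ht : 0 < t := ht
  rw [hY0, sub_zero, sub_zero, Real.norm_of_nonneg ht.le] at h3
  have h4 : t ^ p ≤ C ^ q * t ^ q := by
    rw [← hYpow t ht.le, ← mul_pow]
    refine (le_abs_self _).trans ?_
    rw [abs_pow]
    exact pow_le_pow_left₀ (abs_nonneg _) h3 q
  have h5 : t ^ q ≤ t ^ (p + 1) := pow_le_pow_of_le_one ht.le h2.le hpq
  have h6 : C ^ q * t ^ q ≤ C ^ q * t * t ^ p := by
    calc _ ≤ C ^ q * t ^ (p + 1) := by gcongr
      _ = _ := by ring
  have h7 : 0 < t ^ p := by positivity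
  nlinarith

/-- The sign changes of the coordinate of index `0` move the pole. -/
theorem proj_signSO_pole {ε : evenSigns n} (hε : ε.1 0 = -1) (x : CBall n)
    (hx : x.1 = (kleinChart n).pole) : (proj n (signSO n ε) x).1 ≠ (kleinChart n).pole := by
  intro h
  have h1 := congrArg (fun v : E n => v 0) h
  have h2 : (kleinChart n).pole 0 = 1 := by simp [kleinChart]
  simp only [proj_signSO_apply, hε, hx, h2] at h1
  norm_num at h1

/-- Two compactifications given by the same `φ_p` differ by an analytic map: in the charts it is the
identity, and an inversion carries the remaining point to the domain of the chart. -/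
theorem analyticBallMapOn_of_powerMapIn (hn : 2 ≤ n) {c c' : HalfSpaceChart n} {p : ℕ} (hp : 1 ≤ p)
    {φ ψ : CBall n ≃ₜ CBall n} (hφc : IsCompactification φ) (hψc : IsCompactification ψ)
    (hφ : IsPowerMapIn c (kleinChart n) p φ) (hψ : IsPowerMapIn c' (kleinChart n) p ψ) :
    AnalyticBallMapOn (φ.trans ψ.symm) (Metric.closedBall 0 1) := by
  set h : CBall n ≃ₜ CBall n := φ.trans ψ.symm with hh
  have hψh : ∀ x, ψ (h x) = φ x := fun x => by simp [hh]
  have hne : ∀ x : CBall n, x.1 ≠ c.pole → (h x).1 ≠ c'.pole := by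
    intro x hx
    refine hψ.ne_pole ?_
    rw [hψh]
    exact ((hφ x).2 hx).1
  -- away from the pole, in the half-space charts, the map is the identity
  have hch : ∀ x : CBall n, x.1 ≠ c.pole → (h x).1 = c'.equiv.symm (c.equiv x.1) := by
    intro x hx
    have e1 := ((hφ x).2 hx).2
    have e2 := ((hψ (h x)).2 (hne x hx)).2
    rw [hψh, e1] at e2
    have e3 := powerMap_injOn hp (c.equiv_zero_nonneg (c.mem_source x.2 hx))
      (c'.equiv_zero_nonneg (c'.mem_source (h x).2 (hne x hx))) e2
    rw [e3, c'.equiv.left_inv (c'.mem_source (h x).2 (hne x hx))]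
  have haway : AnalyticOn ℝ (ballExt h) c.equiv.source := by
    have := c'.analytic_symm.comp c.analytic (fun x hx => by
      rw [c'.target_eq]
      exact c.equiv_zero_nonneg hx)
    refine this.congr fun x hx => ?_
    rw [c.source_eq] at hx
    rw [ballExt_of_mem _ hx.1]
    exact hch ⟨x, hx.1⟩ hx.2
  have hnt : Nontrivial (Fin n) := Fin.nontrivial_iff_two_le.mpr hn
  obtain ⟨j, hj⟩ := exists_ne (0 : Fin n)
  set g : SO₀ n := signSO n (flipSigns 0 j hj.symm) with hg
  rw [analyticBallMapOn_iff subset_rfl]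
  have haway' : ∀ x : E n, x ∈ Metric.closedBall (0 : E n) 1 → x ≠ c.pole →
      AnalyticWithinAt ℝ (ballExt h) (Metric.closedBall 0 1) x := by
    intro x hx hxc
    have hxs := c.mem_source hx hxc
    refine (haway x hxs).mono_of_mem_nhdsWithin ?_
    rw [c.source_eq]
    exact Filter.inter_mem self_mem_nhdsWithin
      (nhdsWithin_le_nhds (isOpen_compl_singleton.mem_nhds hxc))
  intro x hx
  by_cases hxc : x = c.pole
  · have hgφ := (analyticBallMapOn_iff subset_rfl).mp (hφc.analyticBallMapOn_conjAction g)
    have hgψ := (analyticBallMapOn_iff subset_rfl).mp (hψc.analyticBallMapOn_conjAction g⁻¹)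
    have hy : ballExt (conjAction φ g) x ≠ c.pole := by
      rw [ballExt_of_mem _ hx]
      intro hcon
      have h1 := (hφ _).1 hcon
      have h2 := (hφ ⟨x, hx⟩).1 hxc
      have h3 : φ (conjAction φ g ⟨x, hx⟩) = proj n g (φ ⟨x, hx⟩) := by simp [conjAction]
      rw [h3] at h1
      exact proj_signSO_pole (by simp [flipSigns]) _ h2 h1
    have a1 := (haway' _ (ballExt_mem _ _) hy).comp (hgφ x hx) fun y _ => ballExt_mem _ y
    have a2 := AnalyticWithinAt.comp (g := ballExt (conjAction ψ g⁻¹))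
      (f := ballExt h ∘ ballExt (conjAction φ g)) (hgψ _ (ballExt_mem _ _)) a1
      fun y _ => ballExt_mem _ _
    refine a2.congr ?_ ?_
    · intro y hy
      simp only [Function.comp_apply, ballExt_of_mem _ hy, ballExt_coe]
      congr 1
      simp [conjAction, hh]
    · simp only [Function.comp_apply, ballExt_of_mem _ hx, ballExt_coe]
      congr 1
      simp [conjAction, hh]
  · exact haway' x hx hxc

theorem analyticallyConjugate_iff (hn : 2 ≤ n) {p q : ℕ} (hp : 1 ≤ p) (hq : 1 ≤ q)
    {φ ψ : CBall n ≃ₜ CBall n} (hφ : IsPowerCompactification p φ)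
    (hψ : IsPowerCompactification q ψ) : AnalyticallyConjugate φ ψ ↔ p = q := by
  obtain ⟨hφc, c, hc⟩ := hφ
  obtain ⟨hψc, c', hc'⟩ := hψ
  constructor
  · rintro ⟨h, ⟨hh, hh'⟩, hint⟩
    have h1 := eq_of_intertwines hn hint
    refine le_antisymm ?_ ?_
    · exact le_of_powerMapIn_of_analytic hq hc' hc hh' fun x => by
        rw [← h1, h.apply_symm_apply]
    · exact le_of_powerMapIn_of_analytic hp hc hc' hh h1
  · rintro rfl
    refine ⟨φ.trans ψ.symm, ⟨analyticBallMapOn_of_powerMapIn hn hp hφc hψc hc hc', ?_⟩, ?_⟩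
    · have := analyticBallMapOn_of_powerMapIn hn hp hψc hφc hc' hc
      exact this
    · intro g x
      simp [conjAction]

end

/-! ### A compactification read in half-space coordinates -/

section

variable {n : ℕ} [NeZero n]

theorem kleinInv_mem {z : E n} (hz : 0 ≤ z 0) :
    kleinInv z ∈ Metric.closedBall (0 : E n) 1 ∧ kleinInv z ≠ (kleinChart n).pole :=
  (kleinChart n).symm_mem hz

theorem analyticAt_kleinFun {v : E n} (hv : v 0 < 1) : AnalyticAt ℝ kleinFun v := by
  have hu : 1 - v 0 ≠ 0 := by linarith
  refine ContDiffAt.analyticAt (contDiffAt_euclidean.mpr fun i => ?_)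
  have h1 : ContDiffAt ℝ ω (fun x : E n => x i) v := by fun_prop
  have h2 : ContDiffAt ℝ ω (fun x : E n => 1 - x 0) v := by fun_prop
  have h3 : ContDiffAt ℝ ω (fun x : E n => 1 - ‖x‖ ^ 2) v :=
    contDiffAt_const.sub (contDiff_norm_sq ℝ).contDiffAt
  by_cases hi : i = 0
  · simp only [kleinFun, hi, if_true]
    exact h3.div (h2.pow 2) (pow_ne_zero 2 hu)
  · simp only [kleinFun, hi, if_false]
    exact h1.div h2 hu

theorem analyticAt_kleinInv {z : E n} (hz : 0 ≤ z 0) : AnalyticAt ℝ kleinInv z := by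
  have hd := (den_klein_pos hz).ne'
  refine ContDiffAt.analyticAt (contDiffAt_euclidean.mpr fun i => ?_)
  have h0 : ContDiffAt ℝ ω (fun x : E n => x 0) z := by fun_prop
  have h1 : ContDiffAt ℝ ω (fun x : E n => x i) z := by fun_prop
  have h2 : ContDiffAt ℝ ω (fun x : E n => 2 / (1 + (‖x‖ ^ 2 - x 0 ^ 2) + x 0)) z :=
    contDiffAt_const.div ((contDiffAt_const.add
      ((contDiff_norm_sq ℝ).contDiffAt.sub (h0.pow 2))).add h0) hd
  change ContDiffAt ℝ ω (fun x : E n => kleinInv x i) z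
  by_cases hi : i = 0
  · simp only [kleinInv, hi, if_true]
    exact contDiffAt_const.sub h2
  · simp only [kleinInv, hi, if_false]
    exact h2.mul h1

theorem norm_kleinInv_lt_one_iff {z : E n} (hz : 0 ≤ z 0) : ‖kleinInv z‖ < 1 ↔ 0 < z 0 := by
  have h := one_sub_norm_sq_kleinInv hz
  have hd := den_klein_pos hz
  rw [← sq_lt_one_iff₀ (norm_nonneg _), ← sub_pos, h, div_pos_iff_of_pos_right (by positivity)]
  constructor <;> intro <;> linarith

/-- The homeomorphism `ψ`, read in the chart `kleinFun` at the goal. -/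
noncomputable def kleinOf (ψ : CBall n ≃ₜ CBall n) (v : E n) : E n := kleinFun (ballExt ψ v)

/-- The inverse of `kleinOf ψ`, from the closed half-space to the ball minus `poleOf ψ`. -/
noncomputable def kleinOfInv (ψ : CBall n ≃ₜ CBall n) (z : E n) : E n :=
  ballExt ψ.symm (kleinInv z)

/-- The point that `ψ` sends to the pole of the chart `kleinFun`. -/
noncomputable def poleOf (ψ : CBall n ≃ₜ CBall n) : E n := ballExt ψ.symm (kleinChart n).pole

section

variable {ψ : CBall n ≃ₜ CBall n}

theorem pole_mem : (kleinChart n).pole ∈ Metric.closedBall (0 : E n) 1 := by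
  rw [mem_closedBall_zero_iff, (kleinChart n).norm_pole]

theorem ballExt_poleOf : ballExt ψ (poleOf ψ) = (kleinChart n).pole :=
  ballExt_ballExt_symm pole_mem

theorem ballExt_ne_pole {v : E n} (hv : v ∈ Metric.closedBall (0 : E n) 1) (h : v ≠ poleOf ψ) :
    ballExt ψ v ≠ (kleinChart n).pole := by
  intro hc
  apply h
  rw [← ballExt_symm_ballExt (ψ := ψ) hv, hc]
  rfl

theorem ballExt_zero_lt_one {v : E n} (hv : v ∈ Metric.closedBall (0 : E n) 1)
    (h : v ≠ poleOf ψ) : ballExt ψ v 0 < 1 :=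
  coord_lt_one (mem_closedBall_zero_iff.mp (ballExt_mem _ _)) (ballExt_ne_pole hv h)

theorem kleinOf_zero_nonneg (v : E n) : 0 ≤ kleinOf ψ v 0 := by
  have := mem_closedBall_zero_iff.mp (ballExt_mem ψ v)
  have h : ‖ballExt ψ v‖ ^ 2 ≤ 1 := by nlinarith [norm_nonneg (ballExt ψ v)]
  simp only [kleinOf, kleinFun, if_true]
  exact div_nonneg (by linarith) (sq_nonneg _)

theorem kleinOfInv_mem (z : E n) : kleinOfInv ψ z ∈ Metric.closedBall (0 : E n) 1 :=
  ballExt_mem _ _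

theorem kleinOfInv_ne {z : E n} (hz : 0 ≤ z 0) : kleinOfInv ψ z ≠ poleOf ψ := by
  intro h
  have := congrArg (ballExt ψ) h
  rw [ballExt_poleOf, kleinOfInv, ballExt_ballExt_symm (kleinInv_mem hz).1] at this
  exact (kleinInv_mem hz).2 this

theorem kleinOf_kleinOfInv {z : E n} (hz : 0 ≤ z 0) : kleinOf ψ (kleinOfInv ψ z) = z := by
  rw [kleinOf, kleinOfInv, ballExt_ballExt_symm (kleinInv_mem hz).1, kleinFun_kleinInv hz]

theorem kleinOfInv_kleinOf {v : E n} (hv : v ∈ Metric.closedBall (0 : E n) 1)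
    (h : v ≠ poleOf ψ) : kleinOfInv ψ (kleinOf ψ v) = v := by
  rw [kleinOf, kleinOfInv, kleinInv_kleinFun (ballExt_zero_lt_one hv h), ballExt_symm_ballExt hv]

theorem continuousOn_kleinOf :
    ContinuousOn (kleinOf ψ) (Metric.closedBall 0 1 \ {poleOf ψ}) := by
  intro v hv
  have h1 := (analyticAt_kleinFun (ballExt_zero_lt_one hv.1 hv.2)).continuousAt
  exact h1.comp_continuousWithinAt
    ((continuousOn_ballExt ψ.continuous v hv.1).mono Set.sdiff_subset)

theorem proj_transSO_pole (b : E n) :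
    (proj n (transSO b) ⟨(kleinChart n).pole, pole_mem⟩).1 = (kleinChart n).pole := by
  have h : transMatrix b *ᵥ HypBall.lift (kleinChart n).pole
      = HypBall.lift (kleinChart n).pole := by
    have h1 : spaceVec b ⬝ᵥ HypBall.lift (EuclideanSpace.single (0 : Fin n) (1 : ℝ)) = 0 := by
      simp [spaceVec, HypBall.lift, dotProduct, Fintype.sum_sum_type, Pi.single_apply]
    rw [transMatrix_mulVec_lift]
    simp [kleinChart, h1]
  change projFun (transMatrix b) (kleinChart n).pole = _
  ext i
  simp only [projFun, h]
  simp [HypBall.lift]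

/-- The conjugated action of the horizontal translations, read in the chart at the goal. -/
theorem ballExt_conjAction_kleinOfInv (b : E n) {z : E n} (hz : 0 ≤ z 0) :
    ballExt (conjAction ψ (transSO b)) (kleinOfInv ψ z) = kleinOfInv ψ (z + horiz b) := by
  have hz' : 0 ≤ (z + horiz b) 0 := by simpa using hz
  have h1 := coord_lt_one (mem_closedBall_zero_iff.mp (kleinInv_mem hz).1) (kleinInv_mem hz).2
  have h2 : kleinInv (z + horiz b) = (proj n (transSO b) ⟨kleinInv z, (kleinInv_mem hz).1⟩).1 := by
    have hk := kleinFun_proj_transSO b (x := ⟨kleinInv z, (kleinInv_mem hz).1⟩) h1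
    rw [kleinFun_kleinInv hz] at hk
    rw [← hk]
    refine kleinInv_kleinFun (coord_lt_one (mem_closedBall_zero_iff.mp (Subtype.prop _)) ?_)
    intro hc
    have h3 : proj n (transSO b) ⟨(kleinChart n).pole, pole_mem⟩
        = proj n (transSO b) ⟨kleinInv z, (kleinInv_mem hz).1⟩ :=
      Subtype.ext ((proj_transSO_pole b).trans hc.symm)
    exact (kleinInv_mem hz).2 (congrArg Subtype.val ((proj n (transSO b)).injective h3)).symm
  rw [kleinOfInv, kleinOfInv, h2, ballExt_of_mem _ (kleinInv_mem hz).1, ballExt_coe, ballExt_coe]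
  simp [conjAction]

theorem kleinOf_zero_pos_iff {v : E n} (hv : v ∈ Metric.closedBall (0 : E n) 1)
    (h : v ≠ poleOf ψ) (hψ : IsCompactification ψ) : 0 < kleinOf ψ v 0 ↔ ‖v‖ < 1 := by
  have h1 := norm_kleinInv_lt_one_iff (kleinOf_zero_nonneg (ψ := ψ) v)
  rw [kleinOf, kleinInv_kleinFun (ballExt_zero_lt_one hv h), ← kleinOf] at h1
  rw [← h1, ballExt_of_mem _ hv]
  exact hψ.interior ⟨v, hv⟩

theorem norm_poleOf (hψ : IsCompactification ψ) : ‖poleOf ψ‖ = 1 := by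
  have h1 := hψ.interior ⟨poleOf ψ, ballExt_mem _ _⟩
  rw [← ballExt_coe, ballExt_poleOf, (kleinChart n).norm_pole] at h1
  have h2 : ‖poleOf ψ‖ ≤ 1 := mem_closedBall_zero_iff.mp (ballExt_mem _ _)
  have h3 : ¬ ‖poleOf ψ‖ < 1 := fun h => lt_irrefl _ (h1.mpr h)
  linarith

theorem ne_poleOf_of_norm_lt {v : E n} (hψ : IsCompactification ψ) (hv : ‖v‖ < 1) :
    v ≠ poleOf ψ := by
  rintro rfl
  exact hv.ne (norm_poleOf hψ)

theorem norm_kleinOfInv_lt_one_iff (hψ : IsCompactification ψ) {z : E n} (hz : 0 ≤ z 0) :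
    ‖kleinOfInv ψ z‖ < 1 ↔ 0 < z 0 := by
  rw [← kleinOf_zero_pos_iff (kleinOfInv_mem z) (kleinOfInv_ne hz) hψ, kleinOf_kleinOfInv hz]

theorem analyticAt_kleinOf (hψ : IsCompactification ψ) {v : E n} (hv : ‖v‖ < 1) :
    AnalyticAt ℝ (kleinOf ψ) v := by
  have h1 := (analyticBallMapOn_iff Metric.ball_subset_closedBall).mp hψ.analytic
  rw [Metric.isOpen_ball.analyticOn_iff_analyticOnNhd] at h1
  exact (analyticAt_kleinFun (ballExt_zero_lt_one (mem_closedBall_zero_iff.mpr hv.le)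
    (ne_poleOf_of_norm_lt hψ hv))).comp (h1 v (mem_ball_zero_iff.mpr hv))

theorem analyticAt_kleinOfInv (hψ : IsCompactification ψ) {z : E n} (hz : 0 < z 0) :
    AnalyticAt ℝ (kleinOfInv ψ) z := by
  have h1 := (analyticBallMapOn_iff Metric.ball_subset_closedBall).mp hψ.analytic_symm
  rw [Metric.isOpen_ball.analyticOn_iff_analyticOnNhd] at h1
  exact (h1 _ (mem_ball_zero_iff.mpr ((norm_kleinInv_lt_one_iff hz.le).mpr hz))).comp
    (analyticAt_kleinInv hz.le)

theorem kleinOf_conjAction (b : E n) {v : E n}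
    (hv : v ∈ Metric.closedBall (0 : E n) 1) (h : v ≠ poleOf ψ) :
    kleinOf ψ (ballExt (conjAction ψ (transSO b)) v) = kleinOf ψ v + horiz b := by
  conv_lhs => rw [← kleinOfInv_kleinOf hv h, ballExt_conjAction_kleinOfInv b (kleinOf_zero_nonneg v)]
  exact kleinOf_kleinOfInv (by simpa using kleinOf_zero_nonneg v)

theorem horiz_add_single (z : E n) : horiz z + EuclideanSpace.single 0 (z 0) = z := by
  ext i
  by_cases hi : i = 0
  · subst hi; simp
  · simp [horiz_apply_of_ne, hi]

theorem horiz_eq_self {z : E n} (hz : z 0 = 0) : horiz z = z := by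
  conv_rhs => rw [← horiz_add_single z, hz]
  simp

/-- The inverse of `powerMap p` on the closed half-space. -/
noncomputable def rootMap (p : ℕ) (z : E n) : E n :=
  WithLp.toLp 2 (Function.update (WithLp.ofLp z) 0 (z 0 ^ ((p : ℝ)⁻¹)))

theorem rootMap_apply_zero (p : ℕ) (z : E n) : rootMap p z 0 = z 0 ^ ((p : ℝ)⁻¹) := by
  simp [rootMap]

theorem rootMap_apply_of_ne (p : ℕ) (z : E n) {i : Fin n} (hi : i ≠ 0) :
    rootMap p z i = z i := by
  simp [rootMap, hi]

theorem powerMap_rootMap {p : ℕ} (hp : 1 ≤ p) {z : E n} (hz : 0 ≤ z 0) :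
    powerMap p (rootMap p z) = z := by
  ext i
  by_cases hi : i = 0
  · subst hi
    rw [powerMap_apply_zero, rootMap_apply_zero, Real.rpow_inv_natCast_pow hz (by omega)]
  · rw [powerMap_apply_of_ne _ _ hi, rootMap_apply_of_ne _ _ hi]

theorem rootMap_powerMap {p : ℕ} (hp : 1 ≤ p) {z : E n} (hz : 0 ≤ z 0) :
    rootMap p (powerMap p z) = z := by
  ext i
  by_cases hi : i = 0
  · subst hi
    rw [rootMap_apply_zero, powerMap_apply_zero, Real.pow_rpow_inv_natCast hz (by omega)]
  · rw [rootMap_apply_of_ne _ _ hi, powerMap_apply_of_ne _ _ hi]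

theorem rootMap_mem {p : ℕ} {z : E n} (hz : 0 ≤ z 0) : 0 ≤ rootMap p z 0 := by
  rw [rootMap_apply_zero]
  positivity

theorem rootMap_add_horiz (p : ℕ) (z b : E n) :
    rootMap p (z + horiz b) = rootMap p z + horiz b := by
  ext i
  by_cases hi : i = 0
  · subst hi; simp [rootMap_apply_zero]
  · simp [rootMap_apply_of_ne, hi]

theorem powerMap_add_horiz (p : ℕ) (z b : E n) :
    powerMap p (z + horiz b) = powerMap p z + horiz b := by
  ext i
  by_cases hi : i = 0
  · subst hi; simp [powerMap_apply_zero]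
  · simp [powerMap_apply_of_ne, hi]

theorem analyticAt_powerMap (p : ℕ) (z : E n) : AnalyticAt ℝ (powerMap p) z := by
  refine ContDiffAt.analyticAt (contDiffAt_euclidean.mpr fun i => ?_)
  by_cases hi : i = 0
  · subst hi
    simp only [powerMap_apply_zero]
    fun_prop
  · simp only [powerMap_apply_of_ne _ _ hi]
    fun_prop

theorem analyticAt_rootMap (p : ℕ) {z : E n} (hz : 0 < z 0) : AnalyticAt ℝ (rootMap p) z := by
  refine ContDiffAt.analyticAt (contDiffAt_euclidean.mpr fun i => ?_)
  by_cases hi : i = 0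
  · subst hi
    simp only [rootMap_apply_zero]
    have h1 : ContDiffAt ℝ ω (fun x : E n => x 0) z := by fun_prop
    exact h1.rpow_const_of_ne hz.ne'
  · simp only [rootMap_apply_of_ne _ _ hi]
    fun_prop

open Filter Topology in
/-- A compactification is given by `φ_p` as soon as, in the candidate half-space chart, analyticity
holds at one boundary point: the horizontal translations carry it to the others. -/
theorem isPowerCompactification_of_analyticWithinAt {p : ℕ} (hp : 1 ≤ p)
    (hψ : IsCompactification ψ)
    (h1 : AnalyticWithinAt ℝ (fun v => rootMap p (kleinOf ψ v)) (Metric.closedBall 0 1)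
      (kleinOfInv ψ 0))
    (h2 : AnalyticWithinAt ℝ (fun z => kleinOfInv ψ (powerMap p z)) {z : E n | 0 ≤ z 0} 0) :
    IsPowerCompactification p ψ := by
  have hR : ∀ b : E n, AnalyticOn ℝ (ballExt (conjAction ψ (transSO b))) (Metric.closedBall 0 1) :=
    fun b => (analyticBallMapOn_iff subset_rfl).mp (hψ.analyticBallMapOn_conjAction _)
  refine ⟨hψ, ⟨poleOf ψ, norm_poleOf hψ,
    { toFun := fun v => rootMap p (kleinOf ψ v)
      invFun := fun z => kleinOfInv ψ (powerMap p z)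
      source := Metric.closedBall 0 1 \ {poleOf ψ}
      target := {z | 0 ≤ z 0}
      map_source' := fun v _ => rootMap_mem (kleinOf_zero_nonneg v)
      map_target' := fun z hz => ⟨kleinOfInv_mem _, kleinOfInv_ne (powerMap_mem hz)⟩
      left_inv' := fun v hv => by
        rw [powerMap_rootMap hp (kleinOf_zero_nonneg v), kleinOfInv_kleinOf hv.1 hv.2]
      right_inv' := fun z hz => by
        rw [kleinOf_kleinOfInv (powerMap_mem hz), rootMap_powerMap hp hz] },
    rfl, rfl, ?_, ?_⟩, ?_⟩
  · rintro v ⟨hv, hvp⟩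
    change AnalyticWithinAt ℝ (fun v => rootMap p (kleinOf ψ v)) _ v
    rcases lt_or_eq_of_le (mem_closedBall_zero_iff.mp hv) with hlt | heq
    · exact ((analyticAt_rootMap p ((kleinOf_zero_pos_iff hv hvp hψ).mpr hlt)).comp
        (analyticAt_kleinOf hψ hlt)).analyticWithinAt
    · have h0 : kleinOf ψ v 0 = 0 := by
        refine le_antisymm ?_ (kleinOf_zero_nonneg v)
        by_contra! hc
        exact heq.not_lt ((kleinOf_zero_pos_iff hv hvp hψ).mp hc)
      obtain ⟨z, hz⟩ : ∃ z, z = kleinOf ψ v := ⟨_, rfl⟩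
      rw [← hz] at h0
      have hz' : horiz (-z) = -z := horiz_eq_self (by simp [h0])
      have hRv : ballExt (conjAction ψ (transSO (-z))) v = kleinOfInv ψ 0 := by
        conv_lhs => rw [← kleinOfInv_kleinOf hv hvp]
        rw [ballExt_conjAction_kleinOfInv _ (kleinOf_zero_nonneg v), hz', ← hz, add_neg_cancel]
      have a1 : AnalyticWithinAt ℝ (fun u => rootMap p (kleinOf ψ u)) (Metric.closedBall 0 1)
          (ballExt (conjAction ψ (transSO (-z))) v) := by rw [hRv]; exact h1
      have a2 := AnalyticWithinAt.comp (g := fun u => rootMap p (kleinOf ψ u)) a1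
        ((hR (-z) v hv).mono (Set.sdiff_subset (t := {poleOf ψ}))) fun u hu => ballExt_mem _ _
      have a3 := a2.add (analyticWithinAt_const (v := horiz z))
      refine a3.congr ?_ ?_
      · rintro u ⟨hu, hup⟩
        simp only [Function.comp_apply, Pi.add_apply]
        rw [kleinOf_conjAction _ hu hup, rootMap_add_horiz, hz', horiz_eq_self h0]
        abel
      · simp only [Function.comp_apply, Pi.add_apply]
        rw [kleinOf_conjAction _ hv hvp, rootMap_add_horiz, hz', horiz_eq_self h0]
        abel
  · intro z hz
    change AnalyticWithinAt ℝ (fun z => kleinOfInv ψ (powerMap p z)) {z | 0 ≤ z 0} z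
    have hz : 0 ≤ z 0 := hz
    rcases hz.lt_or_eq with hlt | heq
    · have h0 : 0 < powerMap p z 0 := by rw [powerMap_apply_zero]; positivity
      exact ((analyticAt_kleinOfInv hψ h0).comp (analyticAt_powerMap p z)).analyticWithinAt
    · have hzz := horiz_eq_self heq.symm
      have a0 : AnalyticWithinAt ℝ (fun u : E n => u - z) {u : E n | 0 ≤ u 0} z :=
        (analyticAt_id.sub analyticAt_const).analyticWithinAt
      have hm : Set.MapsTo (fun u : E n => u - z) {u : E n | 0 ≤ u 0} {u : E n | 0 ≤ u 0} := by
        intro u hu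
        simpa [← heq] using hu
      have a1 : AnalyticWithinAt ℝ (fun u => kleinOfInv ψ (powerMap p (u - z)))
          {u : E n | 0 ≤ u 0} z :=
        AnalyticWithinAt.comp (g := fun u => kleinOfInv ψ (powerMap p u)) (f := fun u => u - z)
          (by simpa using h2) a0 hm
      have a2 := AnalyticWithinAt.comp (f := fun u => kleinOfInv ψ (powerMap p (u - z)))
        (hR z _ (kleinOfInv_mem _)) a1 fun u hu => kleinOfInv_mem _
      have key : ∀ u : E n, 0 ≤ u 0 → kleinOfInv ψ (powerMap p u)
          = ballExt (conjAction ψ (transSO z)) (kleinOfInv ψ (powerMap p (u - z))) := by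
        intro u hu
        rw [ballExt_conjAction_kleinOfInv _ (powerMap_mem (hm hu)), ← powerMap_add_horiz, hzz,
          sub_add_cancel]
      exact a2.congr (fun u hu => key u hu) (key z hz)
  · intro x
    refine ⟨fun hx => ?_, fun hx => ⟨?_, ?_⟩⟩
    · have hx : x.1 = poleOf ψ := hx
      rw [← ballExt_coe, hx, ballExt_poleOf]
    · rw [← ballExt_coe]
      exact ballExt_ne_pole x.2 hx
    · change kleinFun (ψ x).1 = powerMap p (rootMap p (kleinOf ψ x.1))
      rw [powerMap_rootMap hp (kleinOf_zero_nonneg _), kleinOf, ballExt_coe]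

end

end

/-! ### Existence: the radial compactifications -/

section

/-- The polynomial `1 + (1 - s) + ⋯ + (1 - s) ^ (p - 1)`, that is `(1 - (1 - s) ^ p) / s`. -/
def truncGeom (p : ℕ) (s : ℝ) : ℝ := ∑ k ∈ Finset.range p, (1 - s) ^ k

theorem mul_truncGeom (p : ℕ) (s : ℝ) : s * truncGeom p s = 1 - (1 - s) ^ p := by
  have := mul_neg_geom_sum (1 - s) p
  rwa [sub_sub_cancel] at this

theorem truncGeom_pos {p : ℕ} (hp : 1 ≤ p) {s : ℝ} (hs : s ≤ 1) : 0 < truncGeom p s := by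
  obtain ⟨q, rfl⟩ := Nat.exists_eq_add_of_le' hp
  rw [truncGeom, Finset.sum_range_succ']
  have : 0 ≤ ∑ k ∈ Finset.range q, (1 - s) ^ (k + 1) :=
    Finset.sum_nonneg fun k _ => pow_nonneg (by linarith) _
  simp only [pow_zero]
  linarith

theorem contDiff_truncGeom (p : ℕ) : ContDiff ℝ ω (truncGeom p) := by
  unfold truncGeom
  fun_prop

variable {n : ℕ}

/-- The radial map of the ball that turns `1 - ‖v‖ ^ 2` into its `p`-th power. -/
noncomputable def radialMap (p : ℕ) (v : E n) : E n := √(truncGeom p (‖v‖ ^ 2)) • v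

/-- The inverse of `radialMap` on the closed ball; it is not analytic at the boundary for `p ≥ 2`. -/
noncomputable def radialInv (p : ℕ) (w : E n) : E n :=
  (√(truncGeom p (1 - (1 - ‖w‖ ^ 2) ^ ((p : ℝ)⁻¹))))⁻¹ • w

theorem norm_sq_le_one {v : E n} (hv : v ∈ Metric.closedBall (0 : E n) 1) : ‖v‖ ^ 2 ≤ 1 := by
  have := mem_closedBall_zero_iff.mp hv
  nlinarith [norm_nonneg v]

theorem mem_closedBall_of_norm_sq {v : E n} (hv : 0 ≤ 1 - ‖v‖ ^ 2) :
    v ∈ Metric.closedBall (0 : E n) 1 := by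
  rw [mem_closedBall_zero_iff, ← sq_le_one_iff₀ (norm_nonneg _)]
  linarith

theorem norm_sq_radialMap {p : ℕ} (hp : 1 ≤ p) {v : E n} (hv : v ∈ Metric.closedBall (0 : E n) 1) :
    1 - ‖radialMap p v‖ ^ 2 = (1 - ‖v‖ ^ 2) ^ p := by
  have h := mul_truncGeom p (‖v‖ ^ 2)
  rw [radialMap, norm_smul, mul_pow, Real.norm_eq_abs, sq_abs,
    Real.sq_sqrt (truncGeom_pos hp (norm_sq_le_one hv)).le]
  linarith

theorem norm_sq_radialInv {p : ℕ} (hp : 1 ≤ p) {w : E n} (hw : w ∈ Metric.closedBall (0 : E n) 1) :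
    ‖radialInv p w‖ ^ 2 = 1 - (1 - ‖w‖ ^ 2) ^ ((p : ℝ)⁻¹) := by
  have hw' : 0 ≤ 1 - ‖w‖ ^ 2 := sub_nonneg.mpr (norm_sq_le_one hw)
  have h0 : 0 ≤ (1 - ‖w‖ ^ 2) ^ ((p : ℝ)⁻¹) := by positivity
  have hpow : ((1 - ‖w‖ ^ 2) ^ ((p : ℝ)⁻¹)) ^ p = 1 - ‖w‖ ^ 2 :=
    Real.rpow_inv_natCast_pow hw' (by omega)
  rw [radialInv]
  generalize (1 - ‖w‖ ^ 2) ^ ((p : ℝ)⁻¹) = a at h0 hpow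
  have h := mul_truncGeom p (1 - a)
  have hpos := truncGeom_pos (s := 1 - a) hp (by linarith)
  rw [norm_smul, mul_pow, norm_inv, Real.norm_eq_abs, inv_pow, sq_abs, Real.sq_sqrt hpos.le]
  rw [sub_sub_cancel, hpow, sub_sub_cancel] at h
  rw [← h]
  field_simp

theorem radialInv_radialMap {p : ℕ} (hp : 1 ≤ p) {v : E n}
    (hv : v ∈ Metric.closedBall (0 : E n) 1) : radialInv p (radialMap p v) = v := by
  have hv' : 0 ≤ 1 - ‖v‖ ^ 2 := sub_nonneg.mpr (norm_sq_le_one hv)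
  have hpos := Real.sqrt_pos.mpr (truncGeom_pos hp (norm_sq_le_one hv))
  rw [radialInv, norm_sq_radialMap hp hv, Real.pow_rpow_inv_natCast hv' (by omega), sub_sub_cancel,
    radialMap, smul_smul, inv_mul_cancel₀ hpos.ne', one_smul]

theorem radialMap_radialInv {p : ℕ} (hp : 1 ≤ p) {w : E n}
    (hw : w ∈ Metric.closedBall (0 : E n) 1) : radialMap p (radialInv p w) = w := by
  have hw' : 0 ≤ 1 - ‖w‖ ^ 2 := sub_nonneg.mpr (norm_sq_le_one hw)
  have h0 : 0 ≤ (1 - ‖w‖ ^ 2) ^ ((p : ℝ)⁻¹) := by positivity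
  have hpos := Real.sqrt_pos.mpr (truncGeom_pos (s := 1 - (1 - ‖w‖ ^ 2) ^ ((p : ℝ)⁻¹)) hp
    (by linarith))
  rw [radialMap, norm_sq_radialInv hp hw, radialInv, smul_smul, mul_inv_cancel₀ hpos.ne', one_smul]

theorem radialMap_mem {p : ℕ} (hp : 1 ≤ p) {v : E n} (hv : v ∈ Metric.closedBall (0 : E n) 1) :
    radialMap p v ∈ Metric.closedBall (0 : E n) 1 := by
  refine mem_closedBall_of_norm_sq ?_
  rw [norm_sq_radialMap hp hv]
  exact pow_nonneg (sub_nonneg.mpr (norm_sq_le_one hv)) _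

theorem radialInv_mem {p : ℕ} (hp : 1 ≤ p) {w : E n} (hw : w ∈ Metric.closedBall (0 : E n) 1) :
    radialInv p w ∈ Metric.closedBall (0 : E n) 1 := by
  refine mem_closedBall_of_norm_sq ?_
  have := sub_nonneg.mpr (norm_sq_le_one hw)
  rw [norm_sq_radialInv hp hw, sub_sub_cancel]
  positivity

theorem contDiffAt_radialMap {p : ℕ} (hp : 1 ≤ p) {v : E n}
    (hv : v ∈ Metric.closedBall (0 : E n) 1) : ContDiffAt ℝ ω (radialMap p) v := by
  have h1 : ContDiffAt ℝ ω (fun v : E n => truncGeom p (‖v‖ ^ 2)) v :=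
    (contDiff_truncGeom p).contDiffAt.comp v (contDiff_norm_sq ℝ).contDiffAt
  exact (h1.sqrt (truncGeom_pos hp (norm_sq_le_one hv)).ne').smul contDiffAt_id

theorem contDiffAt_inv_sqrt_truncGeom_smul {p : ℕ} (hp : 1 ≤ p) {X Y : Type*}
    [NormedAddCommGroup X] [NormedSpace ℝ X] [NormedAddCommGroup Y] [NormedSpace ℝ Y]
    {r : X → ℝ} {f : X → Y} {x : X} (hr : ContDiffAt ℝ ω r x) (hf : ContDiffAt ℝ ω f x)
    (hx : r x ≤ 1) : ContDiffAt ℝ ω (fun y => (√(truncGeom p (r y)))⁻¹ • f y) x := by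
  have hpos := truncGeom_pos hp hx
  have h1 : ContDiffAt ℝ ω (fun y => truncGeom p (r y)) x :=
    (contDiff_truncGeom p).contDiffAt.comp x hr
  exact ((h1.sqrt hpos.ne').inv (Real.sqrt_pos.mpr hpos).ne').smul hf

theorem analyticAt_radialInv {p : ℕ} (hp : 1 ≤ p) {w : E n} (hw : ‖w‖ < 1) :
    AnalyticAt ℝ (radialInv p) w := by
  have h0 : 0 < 1 - ‖w‖ ^ 2 := by
    rw [sub_pos]; exact (sq_lt_one_iff₀ (norm_nonneg _)).mpr hw
  refine (contDiffAt_inv_sqrt_truncGeom_smul hp (contDiffAt_const.sub ?_) contDiffAt_id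
    ?_).analyticAt
  · exact (contDiffAt_const.sub (contDiff_norm_sq ℝ).contDiffAt).rpow_const_of_ne h0.ne'
  · have : 0 ≤ (1 - ‖w‖ ^ 2) ^ ((p : ℝ)⁻¹) := by positivity
    linarith

/-- `radialMap p` as a homeomorphism of the closed ball. -/
noncomputable def radialHomeo (n : ℕ) {p : ℕ} (hp : 1 ≤ p) : CBall n ≃ₜ CBall n :=
  Continuous.homeoOfEquivCompactToT2
    (f := { toFun := fun x => ⟨radialMap p x.1, radialMap_mem hp x.2⟩
            invFun := fun x => ⟨radialInv p x.1, radialInv_mem hp x.2⟩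
            left_inv := fun x => Subtype.ext (radialInv_radialMap hp x.2)
            right_inv := fun x => Subtype.ext (radialMap_radialInv hp x.2) })
    (Continuous.subtype_mk (continuous_iff_continuousAt.mpr fun x =>
      (contDiffAt_radialMap hp x.2).continuousAt.comp continuousAt_subtype_val) _)

theorem radialHomeo_apply {p : ℕ} (hp : 1 ≤ p) (x : CBall n) :
    (radialHomeo n hp x).1 = radialMap p x.1 := rfl

theorem radialHomeo_symm_apply {p : ℕ} (hp : 1 ≤ p) (x : CBall n) :
    ((radialHomeo n hp).symm x).1 = radialInv p x.1 := rfl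

/-- The action of `SO₀(n,1)` that is conjugate to the projective one through `radialMap p`,
extended to matrices. The fractional powers are taken of denominators only, not of the defining
function `1 - ‖v‖ ^ 2` of the boundary, whence the analyticity up to the boundary. -/
noncomputable def radialAction (p : ℕ) (a : (Idx n → Idx n → ℝ) × E n) : E n :=
  (√(truncGeom p (1 - (1 - ‖a.2‖ ^ 2) * ((((Matrix.of a.1) *ᵥ HypBall.lift (radialMap p a.2))
    (.inr ())) ^ 2) ^ (-(p : ℝ)⁻¹))))⁻¹ • projFun (Matrix.of a.1) (radialMap p a.2)

theorem radialAction_eq {p : ℕ} (hp : 1 ≤ p) (g : SO₀ n) (x : CBall n) :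
    radialAction p (fun i j => g.1.1 i j, x.1) = (conjAction (radialHomeo n hp) g x).1 := by
  have hd := den_pos g (radialHomeo n hp x)
  have hx : 0 ≤ 1 - ‖x.1‖ ^ 2 := sub_nonneg.mpr (norm_sq_le_one x.2)
  have hof : Matrix.of (fun i j => g.1.1 i j) = g.1.1 := rfl
  change _ = radialInv p (projFun g.1.1 (radialHomeo n hp x).1)
  rw [radialInv, one_sub_norm_sq_projFun, radialHomeo_apply, norm_sq_radialMap hp x.2,
    Real.div_rpow (by positivity) (by positivity), Real.pow_rpow_inv_natCast hx (by omega),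
    div_eq_mul_inv, ← Real.rpow_neg (by positivity)]
  rfl

theorem contDiff_matrix_mulVec_lift (i : Idx n) :
    ContDiff ℝ ω fun a : (Idx n → Idx n → ℝ) × E n => (Matrix.of a.1 *ᵥ HypBall.lift a.2) i := by
  simp only [Matrix.mulVec, dotProduct, Fintype.sum_sum_type, HypBall.lift, Matrix.of_apply,
    Sum.elim_inl, Sum.elim_inr]
  fun_prop

theorem analyticAt_radialAction {p : ℕ} (hp : 1 ≤ p) (g : SO₀ n) (x : CBall n) :
    AnalyticAt ℝ (radialAction p) ((fun i j => g.1.1 i j, x.1) : (Idx n → Idx n → ℝ) × E n) := by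
  have hd : 0 < ((Matrix.of fun i j => g.1.1 i j) *ᵥ HypBall.lift (radialMap p x.1)) (.inr ()) :=
    den_pos g (radialHomeo n hp x)
  have h2 : ContDiffAt ℝ ω (fun a : (Idx n → Idx n → ℝ) × E n => radialMap p a.2)
      (fun i j => g.1.1 i j, x.1) :=
    ContDiffAt.comp (g := radialMap p) (f := Prod.snd) _ (contDiffAt_radialMap hp x.2)
      contDiffAt_snd
  have h3 : ∀ i, ContDiffAt ℝ ω (fun a : (Idx n → Idx n → ℝ) × E n =>
      (Matrix.of a.1 *ᵥ HypBall.lift (radialMap p a.2)) i) (fun i j => g.1.1 i j, x.1) := fun i =>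
    (contDiff_matrix_mulVec_lift i).contDiffAt.comp _ (contDiffAt_fst.prodMk h2)
  refine (contDiffAt_inv_sqrt_truncGeom_smul hp ?_ ?_ ?_).analyticAt
  · refine contDiffAt_const.sub (ContDiffAt.mul (contDiffAt_const.sub ?_) ?_)
    · exact (contDiff_norm_sq ℝ).contDiffAt.comp _ contDiffAt_snd
    · exact ((h3 _).pow 2).rpow_const_of_ne (pow_pos hd 2).ne'
  · exact contDiffAt_euclidean.mpr fun i => (h3 _).div (h3 _) hd.ne'
  · have hx : 0 ≤ 1 - ‖x.1‖ ^ 2 := sub_nonneg.mpr (norm_sq_le_one x.2)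
    have : 0 ≤ (1 - ‖x.1‖ ^ 2) *
      ((((Matrix.of fun i j => g.1.1 i j) *ᵥ HypBall.lift (radialMap p x.1)) (.inr ())) ^ 2)
        ^ (-(p : ℝ)⁻¹) := by positivity
    simpa using this

theorem isAnalyticAction_radialHomeo {p : ℕ} (hp : 1 ≤ p) :
    IsAnalyticAction (radialHomeo n hp) := by
  refine ⟨radialAction p, ?_, radialAction_eq hp⟩
  rintro ⟨A, x⟩ ⟨⟨g, hg⟩, hx⟩
  subst hg
  exact (analyticAt_radialAction hp g ⟨x, hx⟩).analyticWithinAt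

theorem isCompactification_radialHomeo {p : ℕ} (hp : 1 ≤ p) :
    IsCompactification (radialHomeo n hp) where
  interior x := by
    have h1 : ∀ y : E n, ‖y‖ < 1 ↔ 0 < 1 - ‖y‖ ^ 2 := fun y => by
      rw [sub_pos, sq_lt_one_iff₀ (norm_nonneg _)]
    have h2 : 0 ≤ 1 - ‖x.1‖ ^ 2 := sub_nonneg.mpr (norm_sq_le_one x.2)
    rw [h1, h1, radialHomeo_apply, norm_sq_radialMap hp x.2]
    refine ⟨fun h => h2.lt_of_ne fun h0 => ?_, fun h => pow_pos h p⟩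
    rw [← h0, zero_pow (by omega)] at h
    exact lt_irrefl _ h
  analytic := ⟨radialMap p, fun v hv => (contDiffAt_radialMap hp
    (Metric.ball_subset_closedBall hv)).analyticAt.analyticWithinAt, fun _ _ => rfl⟩
  analytic_symm := ⟨radialInv p, fun v hv => (analyticAt_radialInv hp
    (mem_ball_zero_iff.mp hv)).analyticWithinAt, fun _ _ => rfl⟩
  extension g := by
    refine ⟨fun x => radialAction p (fun i j => g.1.1 i j, x), fun x hx => ?_,
      fun x _ => radialAction_eq hp g x⟩
    exact ((analyticAt_radialAction hp g ⟨x, hx⟩).comp₂ analyticAt_const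
      analyticAt_id).analyticWithinAt

/-- In half-space coordinates, `1 - ‖v‖ ^ 2` is the height up to an analytic positive factor; the
radial map takes its `p`-th power, and the root of the height is again analytic. -/
theorem isPowerCompactification_radialHomeo [NeZero n] {p : ℕ} (hp : 1 ≤ p) :
    IsPowerCompactification p (radialHomeo n hp) := by
  have hzero : (0 : ℝ) ≤ (0 : E n) 0 := by simp
  refine isPowerCompactification_of_analyticWithinAt hp (isCompactification_radialHomeo hp) ?_ ?_
  · obtain ⟨m, hm⟩ : ∃ m, m = kleinOfInv (radialHomeo n hp) 0 := ⟨_, rfl⟩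
    have hmem : m ∈ Metric.closedBall (0 : E n) 1 := hm ▸ kleinOfInv_mem _
    have hlt : radialMap p m 0 < 1 := by
      have := ballExt_zero_lt_one (ψ := radialHomeo n hp) hmem (hm ▸ kleinOfInv_ne hzero)
      rwa [ballExt_of_mem _ hmem] at this
    rw [← hm]
    have hmap := contDiffAt_radialMap hp hmem
    have hi : ∀ i, ContDiffAt ℝ ω (fun v : E n => radialMap p v i) m :=
      contDiffAt_euclidean.mp hmap
    have hu : 0 < 1 - radialMap p m 0 := by linarith
    have key : ContDiffAt ℝ ω (fun v : E n => (WithLp.toLp 2 fun i => if i = 0 then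
        (1 - ‖v‖ ^ 2) * ((1 - radialMap p v 0) ^ 2) ^ (-(p : ℝ)⁻¹)
        else radialMap p v i / (1 - radialMap p v 0) : E n)) m := by
      refine contDiffAt_euclidean.mpr fun i => ?_
      by_cases h : i = 0
      · simp only [h, if_true]
        exact (contDiffAt_const.sub (contDiff_norm_sq ℝ).contDiffAt).mul
          (((contDiffAt_const.sub (hi 0)).pow 2).rpow_const_of_ne (pow_pos hu 2).ne')
      · simp only [h, if_false]
        exact (hi i).div (contDiffAt_const.sub (hi 0)) hu.ne'
    have heq : ∀ v ∈ Metric.closedBall (0 : E n) 1,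
        rootMap p (kleinOf (radialHomeo n hp) v) = (WithLp.toLp 2 fun i => if i = 0 then
        (1 - ‖v‖ ^ 2) * ((1 - radialMap p v 0) ^ 2) ^ (-(p : ℝ)⁻¹)
        else radialMap p v i / (1 - radialMap p v 0) : E n) := by
      intro v hv
      have hv' : 0 ≤ 1 - ‖v‖ ^ 2 := sub_nonneg.mpr (norm_sq_le_one hv)
      ext i
      by_cases h : i = 0
      · subst h
        rw [rootMap_apply_zero, kleinOf, ballExt_of_mem _ hv, radialHomeo_apply]
        simp only [kleinFun, if_true]
        rw [norm_sq_radialMap hp hv, Real.div_rpow (by positivity) (by positivity),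
          Real.pow_rpow_inv_natCast hv' (by omega), div_eq_mul_inv, ← Real.rpow_neg (by positivity)]
      · rw [rootMap_apply_of_ne _ _ h, kleinOf, ballExt_of_mem _ hv, radialHomeo_apply]
        simp only [kleinFun, h, if_false]
    exact key.analyticAt.analyticWithinAt.congr heq (heq m hmem)
  · have hpow : powerMap p (0 : E n) = 0 := by
      ext i
      by_cases h : i = 0
      · subst h; rw [powerMap_apply_zero]; simp; omega
      · rw [powerMap_apply_of_ne _ _ h]
    have heq : ∀ z ∈ {z : E n | 0 ≤ z 0}, kleinOfInv (radialHomeo n hp) (powerMap p z)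
        = (√(truncGeom p (1 - z 0 * (4 / (1 + (‖powerMap p z‖ ^ 2 - powerMap p z 0 ^ 2)
          + powerMap p z 0) ^ 2) ^ ((p : ℝ)⁻¹))))⁻¹ • kleinInv (powerMap p z) := by
      intro z hz
      have hz : 0 ≤ z 0 := hz
      have hd := den_klein_pos (powerMap_mem (p := p) hz)
      rw [kleinOfInv, ballExt_of_mem _ (kleinInv_mem (powerMap_mem hz)).1, radialHomeo_symm_apply,
        radialInv, one_sub_norm_sq_kleinInv (powerMap_mem hz)]
      congr 5
      rw [mul_comm 4, mul_div_assoc, Real.mul_rpow (powerMap_mem hz) (by positivity)]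
      congr 1
      rw [powerMap_apply_zero, Real.pow_rpow_inv_natCast hz (by omega)]
    have hpm : ContDiffAt ℝ ω (powerMap p) (0 : E n) := (analyticAt_powerMap p 0).contDiffAt
    have hpm0 : ContDiffAt ℝ ω (fun z => powerMap p z 0) (0 : E n) :=
      contDiffAt_euclidean.mp hpm 0
    have hd := den_klein_pos (powerMap_mem (p := p) hzero)
    refine (ContDiffAt.analyticAt ?_).analyticWithinAt.congr heq (heq 0 hzero)
    refine contDiffAt_inv_sqrt_truncGeom_smul hp (contDiffAt_const.sub (ContDiffAt.mul ?_ ?_)) ?_ ?_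
    · fun_prop
    · refine ContDiffAt.rpow_const_of_ne (contDiffAt_const.div (ContDiffAt.pow ?_ 2)
        (pow_pos hd 2).ne') (by positivity)
      exact (contDiffAt_const.add (((contDiff_norm_sq ℝ).contDiffAt.comp _ hpm).sub
        (hpm0.pow 2))).add hpm0
    · exact ((analyticAt_kleinInv (powerMap_mem hzero)).comp (analyticAt_powerMap p 0)).contDiffAt
    · simp

end

/-! ### Curves fixed by a finite group -/

open Filter Topology Metric in
/-- Linearization of a finite group of analytic maps at a fixed boundary point `m` of the ball: the
fixed points of the group near `m` contain a curve that enters the ball transversally. -/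
theorem exists_curve_of_finite_group {V H : Type*} [NormedAddCommGroup V] [InnerProductSpace ℝ V]
    [CompleteSpace V] [Group H] [Fintype H] {R : H → V → V} {m : V} (hm : ‖m‖ = 1)
    (hR : ∀ h, AnalyticWithinAt ℝ (R h) (closedBall 0 1) m)
    (hmap : ∀ h, Set.MapsTo (R h) (closedBall 0 1) (closedBall 0 1))
    (hmul : ∀ g h, ∀ v ∈ closedBall (0 : V) 1, R (g * h) v = R g (R h v))
    (hone : ∀ v ∈ closedBall (0 : V) 1, R 1 v = v) (hfix : ∀ h, R h m = m) :
    ∃ (γ : ℝ → V) (w : V), AnalyticAt ℝ γ 0 ∧ γ 0 = m ∧ HasDerivAt γ w 0 ∧ inner ℝ m w < 0 ∧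
      (∀ᶠ s in 𝓝[>] (0 : ℝ), ‖γ s‖ < 1) ∧
      ∀ᶠ s in 𝓝[≥] (0 : ℝ), γ s ∈ closedBall (0 : V) 1 ∧ ∀ h, R h (γ s) = γ s := by
  have hmB : m ∈ closedBall (0 : V) 1 := by simp [hm]
  have hins : insert m (closedBall (0 : V) 1) = closedBall 0 1 := Set.insert_eq_of_mem hmB
  have huniq : UniqueDiffWithinAt ℝ (closedBall (0 : V) 1) m :=
    uniqueDiffOn_convex (convex_closedBall 0 1) ⟨0, by
      rw [interior_closedBall _ one_ne_zero]; simp⟩ m hmB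
  have hE : ∀ h, ∃ g : V → V, R h =ᶠ[𝓝[closedBall 0 1] m] g ∧ AnalyticAt ℝ g m := by
    intro h
    have := analyticWithinAt_iff_exists_analyticAt.mp (hR h)
    rwa [hins] at this
  choose S hRS hS using hE
  have hSm : ∀ h, S h m = m := fun h => by
    rw [← (hRS h).self_of_nhdsWithin hmB, hfix]
  -- the linear parts
  set A : H → V →L[ℝ] V := fun h => fderiv ℝ (S h) m with hA
  have hSA : ∀ h, HasStrictFDerivAt (S h) (A h) m := fun h => (hS h).hasStrictFDerivAt
  have hRA : ∀ h, HasFDerivWithinAt (R h) (A h) (closedBall 0 1) m := fun h =>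
    (hSA h).hasFDerivAt.hasFDerivWithinAt.congr_of_eventuallyEq (hRS h)
      ((hRS h).self_of_nhdsWithin hmB)
  have hAmul : ∀ g h, A (g * h) = (A g).comp (A h) := by
    intro g h
    have h1 : HasFDerivWithinAt (R g ∘ R h) ((A g).comp (A h)) (closedBall 0 1) m := by
      refine HasFDerivWithinAt.comp m ?_ (hRA h) (hmap h)
      rw [hfix]
      exact hRA g
    refine huniq.eq (hRA (g * h)) (h1.congr (fun v hv => hmul g h v hv) (hmul g h m hmB))
  have hAone : A 1 = ContinuousLinearMap.id ℝ V :=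
    huniq.eq (hRA 1) ((hasFDerivWithinAt_id m _).congr (fun v hv => hone v hv) (hone m hmB))
  -- the linearizing map
  set Λ : V → V := fun v => ∑ h, A h⁻¹ (S h v - m) with hΛ
  have hΛm : Λ m = 0 := by simp [hΛ, hSm]
  have hΛan : AnalyticAt ℝ Λ m := by
    refine Finset.analyticAt_fun_sum _ fun h _ => ?_
    exact ((A h⁻¹).analyticAt _).comp ((hS h).sub analyticAt_const)
  have hcard : (Fintype.card H : ℝ) ≠ 0 := by
    exact_mod_cast Fintype.card_ne_zero
  set D : V ≃L[ℝ] V := ContinuousLinearEquiv.smulLeft (Units.mk0 (Fintype.card H : ℝ) hcard) with hD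
  have hΛD : HasStrictFDerivAt Λ (D : V →L[ℝ] V) m := by
    have h1 : HasStrictFDerivAt Λ (∑ h, (A h⁻¹).comp (A h)) m :=
      HasStrictFDerivAt.fun_sum fun h _ =>
        (A h⁻¹).hasStrictFDerivAt.comp m ((hSA h).sub_const m)
    convert h1 using 1
    simp only [← hAmul, inv_mul_cancel, hAone]
    ext v
    simp [hD, Units.smul_def, ← Nat.cast_smul_eq_nsmul ℝ]
  set e := hΛD.toOpenPartialHomeomorph Λ with he
  have hesrc : m ∈ e.source := hΛD.mem_toOpenPartialHomeomorph_source
  have hecoe : (e : V → V) = Λ := hΛD.toOpenPartialHomeomorph_coe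
  have hem : e m = 0 := by rw [hecoe, hΛm]
  have hesymm0 : e.symm 0 = m := by rw [← hem, e.left_inv hesrc]
  have h0tgt : (0 : V) ∈ e.target := hem ▸ e.map_source hesrc
  have hean : AnalyticAt ℝ e.symm 0 := by
    refine e.analyticAt_symm (i := D) h0tgt ?_ ?_
    · rw [hesymm0, hecoe]; exact hΛan
    · rw [hesymm0, hecoe]; exact hΛD.hasFDerivAt.fderiv
  have heD : HasFDerivAt e.symm (D.symm : V →L[ℝ] V) 0 := by
    refine e.hasFDerivAt_symm h0tgt ?_
    rw [hesymm0, hecoe]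
    exact hΛD.hasFDerivAt
  -- an invariant vector that points inwards
  set w : V := ∑ h, A h (-m) with hw
  have hAw : ∀ g, A g w = w := by
    intro g
    rw [hw, map_sum]
    refine (Fintype.sum_equiv (Equiv.mulLeft g) _ _ fun h => ?_)
    simp only [Equiv.coe_mulLeft, hAmul]
    rfl
  have hle : ∀ h, inner ℝ m (A h (-m)) ≤ 0 := by
    intro h
    have h1 : IsLocalMaxOn (fun v => inner ℝ m (R h v)) (closedBall 0 1) m := by
      refine eventually_nhdsWithin_of_forall fun v hv => ?_
      change inner ℝ m (R h v) ≤ inner ℝ m (R h m)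
      rw [hfix, real_inner_self_eq_norm_sq, hm]
      have := real_inner_le_norm m (R h v)
      have h2 := mem_closedBall_zero_iff.mp (hmap h hv)
      rw [hm] at this
      linarith
    have h2 : HasFDerivWithinAt (fun v => inner ℝ m (R h v))
        ((innerSL ℝ m).comp (A h)) (closedBall 0 1) m :=
      (innerSL ℝ m).hasFDerivAt.comp_hasFDerivWithinAt m (hRA h)
    have h3 : (0 : V) - m ∈ posTangentConeAt (closedBall 0 1) m :=
      sub_mem_posTangentConeAt_of_segment_subset
        ((convex_closedBall 0 1).segment_subset hmB (by simp))
    rw [zero_sub] at h3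
    exact h1.hasFDerivWithinAt_nonpos h2 h3
  have hwm : inner ℝ m w < 0 := by
    rw [hw, inner_sum]
    refine Finset.sum_neg' (fun h _ => hle h) ⟨1, Finset.mem_univ _, ?_⟩
    rw [hAone, ContinuousLinearMap.id_apply, inner_neg_right, real_inner_self_eq_norm_sq, hm]
    norm_num
  set γ : ℝ → V := fun s => e.symm (s • w) with hγ
  have hγ0 : γ 0 = m := by simp [hγ, hesymm0]
  have hγan : AnalyticAt ℝ γ 0 := by
    refine AnalyticAt.comp_of_eq (g := e.symm) (y := 0) hean ?_ (by simp)
    exact analyticAt_id.smul analyticAt_const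
  have hγD : HasDerivAt γ (D.symm w) 0 := by
    have h1 : HasDerivAt (fun s : ℝ => s • w) w 0 := by
      simpa using (hasDerivAt_id (0 : ℝ)).smul_const w
    exact HasFDerivAt.comp_hasDerivAt_of_eq (0 : ℝ) heD h1 (by simp)
  have hDw : D.symm w = (Fintype.card H : ℝ)⁻¹ • w := by
    rw [D.symm_apply_eq]
    simp [hD, Units.smul_def, hcard]
  have hcardpos : (0 : ℝ) < Fintype.card H := by exact_mod_cast Fintype.card_pos
  have hDwm : inner ℝ m (D.symm w) < 0 := by
    rw [hDw, inner_smul_right]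
    exact mul_neg_of_pos_of_neg (by positivity) hwm
  have hγlt : ∀ᶠ s in 𝓝[>] (0 : ℝ), ‖γ s‖ < 1 := by
    have h1 : HasDerivAt (fun s => ‖γ s‖ ^ 2) (2 * inner ℝ m (D.symm w)) 0 := by
      have := hγD.norm_sq
      rwa [hγ0] at this
    have h2 := (hasDerivAt_iff_tendsto_slope.mp h1).eventually_lt_const
      (by linarith : 2 * inner ℝ m (D.symm w) < 0)
    filter_upwards [h2.filter_mono (nhdsWithin_mono 0 fun s (hs : 0 < s) => hs.ne'),
      self_mem_nhdsWithin] with s hs hs0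
    have hs0 : 0 < s := hs0
    rw [slope_def_field, hγ0, hm, sub_zero, div_lt_iff₀ hs0, zero_mul] at hs
    rw [← sq_lt_one_iff₀ (norm_nonneg _)]
    linarith
  have hγball : ∀ᶠ s in 𝓝[≥] (0 : ℝ), γ s ∈ closedBall (0 : V) 1 := by
    rw [← Set.Ioi_insert, nhdsWithin_insert, eventually_sup, eventually_pure]
    exact ⟨by rw [hγ0]; exact hmB, hγlt.mono fun s hs => mem_closedBall_zero_iff.mpr hs.le⟩
  have hγtend : Tendsto γ (𝓝[≥] 0) (𝓝[closedBall 0 1] m) := by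
    refine tendsto_nhdsWithin_iff.mpr ⟨?_, hγball⟩
    have := hγan.continuousAt.tendsto
    rw [hγ0] at this
    exact this.mono_left nhdsWithin_le_nhds
  have hRtend : ∀ h, Tendsto (R h) (𝓝[closedBall 0 1] m) (𝓝[closedBall 0 1] m) := fun h => by
    have h1 : ContinuousWithinAt (R h) (closedBall 0 1) m := (hRA h).continuousWithinAt
    have := h1.tendsto_nhdsWithin (hmap h)
    rwa [hfix] at this
  have hequi : ∀ᶠ v in 𝓝[closedBall 0 1] m, ∀ h, Λ (R h v) = A h (Λ v) := by
    rw [eventually_all]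
    intro h
    have h1 : ∀ᶠ v in 𝓝[closedBall 0 1] m, ∀ k, S k (R h v) = S (k * h) v := by
      rw [eventually_all]
      intro k
      filter_upwards [(hRtend h).eventually (hRS k), hRS (k * h), self_mem_nhdsWithin]
        with v h2 h3 hv
      rw [← h2, ← h3, hmul k h v hv]
    filter_upwards [h1] with v hv
    simp only [hΛ, hv, map_sum]
    refine Fintype.sum_equiv (Equiv.mulRight h) _ _ fun k => ?_
    have h2 : A k⁻¹ = (A h).comp (A (k * h)⁻¹) := by
      rw [← hAmul, mul_inv_rev, mul_inv_cancel_left]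
    rw [h2]
    rfl
  have hsrc : ∀ᶠ v in 𝓝[closedBall 0 1] m, v ∈ e.source ∧ ∀ h, R h v ∈ e.source := by
    have h1 : e.source ∈ 𝓝[closedBall 0 1] m :=
      nhdsWithin_le_nhds (e.open_source.mem_nhds hesrc)
    refine Eventually.and h1 (eventually_all.mpr fun h => hRtend h h1)
  have htgt : ∀ᶠ s in 𝓝[≥] (0 : ℝ), s • w ∈ e.target := by
    refine nhdsWithin_le_nhds ?_
    have : ContinuousAt (fun s : ℝ => s • w) 0 := by fun_prop
    exact this (e.open_target.mem_nhds (by simpa using h0tgt))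
  refine ⟨γ, D.symm w, hγan, hγ0, hγD, hDwm, hγlt, ?_⟩
  filter_upwards [hγball, hγtend hequi, hγtend hsrc, htgt] with s h1 h2 h3 h4
  refine ⟨h1, fun h => ?_⟩
  refine e.injOn (h3.2 h) h3.1 ?_
  have h2' : ∀ h, Λ (R h (γ s)) = A h (Λ (γ s)) := h2
  have h5 : Λ (γ s) = s • w := by
    rw [← hecoe]
    exact e.right_inv h4
  rw [hecoe, h2', h5, map_smul, hAw]

/-! ### Local parametrizations of a compactification -/

section

variable {n : ℕ} [NeZero n]

theorem contDiff_horiz : ContDiff ℝ ω (horiz : E n → E n) := by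
  refine contDiff_euclidean.mpr fun i => ?_
  by_cases hi : i = 0
  · subst hi
    simp only [horiz_zero_apply]
    fun_prop
  · simp only [horiz_apply_of_ne _ hi]
    fun_prop

theorem contDiff_single_zero : ContDiff ℝ ω fun t : ℝ => (EuclideanSpace.single 0 t : E n) := by
  refine contDiff_euclidean.mpr fun i => ?_
  by_cases hi : i = 0
  · subst hi
    simp only [PiLp.single_apply, if_true]
    fun_prop
  · simp only [PiLp.single_apply, hi, if_false]
    fun_prop

theorem horiz_add (a b : E n) : horiz (a + b) = horiz a + horiz b := by
  ext i
  by_cases hi : i = 0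
  · subst hi; simp
  · simp [horiz_apply_of_ne, hi]

theorem horiz_neg (a : E n) : horiz (-a) = -horiz a := by
  ext i
  by_cases hi : i = 0
  · subst hi; simp
  · simp [horiz_apply_of_ne, hi]

theorem horiz_horiz (a : E n) : horiz (horiz a) = horiz a := horiz_eq_self (horiz_zero_apply a)

@[simp] theorem horiz_zero : horiz (0 : E n) = 0 := horiz_eq_self rfl

@[simp] theorem horiz_single_zero (t : ℝ) : horiz (EuclideanSpace.single 0 t : E n) = 0 := by
  ext i
  by_cases hi : i = 0
  · subst hi; simp
  · simp [horiz_apply_of_ne, hi]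

@[simp] theorem single_zero_zero : (EuclideanSpace.single 0 0 : E n) = 0 := by
  ext i
  simp

theorem smul_single_zero_one (t : ℝ) :
    t • (EuclideanSpace.single 0 1 : E n) = EuclideanSpace.single 0 t := by
  ext i
  by_cases hi : i = 0
  · subst hi; simp
  · simp [hi]

theorem eq_of_horiz_eq {a b : E n} (h : horiz a = horiz b) (h0 : a 0 = b 0) : a = b := by
  rw [← horiz_add_single a, ← horiz_add_single b, h, h0]

variable {ψ : CBall n ≃ₜ CBall n}

theorem norm_kleinOfInv_eq_one (hψ : IsCompactification ψ) {z : E n} (hz : z 0 = 0) :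
    ‖kleinOfInv ψ z‖ = 1 := by
  have h1 : ¬ ‖kleinOfInv ψ z‖ < 1 := by
    rw [norm_kleinOfInv_lt_one_iff hψ hz.ge, hz]
    exact lt_irrefl _
  have h2 := mem_closedBall_zero_iff.mp (kleinOfInv_mem (ψ := ψ) z)
  linarith

/-- The diagonal sign matrices that fix the two ends of the vertical axis of the half-space. -/
def axisSigns (n : ℕ) [NeZero n] : Subgroup (evenSigns n) where
  carrier := {ε | ε.1 0 = 1}
  one_mem' := rfl
  mul_mem' := by
    intro a b ha hb
    change a.1 0 * b.1 0 = 1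
    rw [show a.1 0 = 1 from ha, show b.1 0 = 1 from hb, one_mul]
  inv_mem' := by
    intro a ha
    change (a.1 0)⁻¹ = 1
    rw [show a.1 0 = 1 from ha, inv_one]

/-- A sign change of two horizontal coordinates belongs to `axisSigns n`, whence the hypothesis
`3 ≤ n`. -/
theorem horiz_kleinOf_eq_zero (hn : 3 ≤ n) {v : E n} (hv : v ∈ Metric.closedBall (0 : E n) 1)
    (h : ∀ ε : axisSigns n, ballExt (conjAction ψ (signSO n ε.1)) v = v) :
    horiz (kleinOf ψ v) = 0 := by
  ext i
  by_cases hi : i = 0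
  · subst hi; simp
  obtain ⟨j, hj0, hji⟩ : ∃ j : Fin n, j ≠ 0 ∧ j ≠ i := by
    have hcard : 2 < (Finset.univ : Finset (Fin n)).card := by
      rw [Finset.card_univ, Fintype.card_fin]; omega
    obtain ⟨j, -, hj⟩ := Finset.exists_mem_notMem_of_card_lt_card
      (s := {0, i}) (t := (Finset.univ : Finset (Fin n)))
      ((Finset.card_le_two).trans_lt hcard)
    simp only [Finset.mem_insert, Finset.mem_singleton, not_or] at hj
    exact ⟨j, hj.1, hj.2⟩
  have h0 : (flipSigns i j hji.symm).1 0 = 1 := by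
    simp [flipSigns, Ne.symm hi, hj0.symm]
  have h1 := h ⟨flipSigns i j hji.symm, h0⟩
  rw [ballExt_of_mem _ hv] at h1
  have h2 := congrArg (ballExt ψ) h1
  rw [ballExt_coe, ballExt_of_mem _ hv] at h2
  have h3 : ψ (conjAction ψ (signSO n (flipSigns i j hji.symm)) ⟨v, hv⟩)
      = proj n (signSO n (flipSigns i j hji.symm)) (ψ ⟨v, hv⟩) := by simp [conjAction]
  rw [h3] at h2
  have h4 := congrArg (fun u : E n => u i) h2
  have h5 : (flipSigns i j hji.symm).1 i = -1 := by simp [flipSigns]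
  simp only [proj_signSO_apply, h5] at h4
  have h6 : (ψ ⟨v, hv⟩).1 i = 0 := by
    push_cast at h4
    linarith
  rw [horiz_apply_of_ne _ hi, kleinOf, ballExt_of_mem _ hv]
  simp [kleinFun, hi, h6]

open Filter Topology in
/-- A curve that runs up the vertical axis of the half-space, and that is analytic in the
differentiable structure of the compactification, up to and beyond the boundary. In dimension at
least `3`, the axis is the fixed point set of a finite group of isometries. -/
theorem exists_axis_curve (hn : 3 ≤ n) (hψ : IsCompactification ψ) :
    ∃ (γ : ℝ → E n) (w : E n), AnalyticAt ℝ γ 0 ∧ γ 0 = kleinOfInv ψ 0 ∧ HasDerivAt γ w 0 ∧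
      inner ℝ (kleinOfInv ψ 0) w < 0 ∧ (∀ᶠ s in 𝓝[>] (0 : ℝ), ‖γ s‖ < 1) ∧
      ∀ᶠ s in 𝓝[≥] (0 : ℝ), γ s ∈ Metric.closedBall (0 : E n) 1 ∧ γ s ≠ poleOf ψ ∧
        horiz (kleinOf ψ (γ s)) = 0 := by
  have hR : ∀ g, AnalyticOn ℝ (ballExt (conjAction ψ g)) (Metric.closedBall 0 1) :=
    fun g => (analyticBallMapOn_iff subset_rfl).mp (hψ.analyticBallMapOn_conjAction _)
  have hfix : ∀ ε : axisSigns n, ballExt (conjAction ψ (signSO n ε.1)) (kleinOfInv ψ 0)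
      = kleinOfInv ψ 0 := by
    intro ε
    have hmem : kleinInv (0 : E n) ∈ Metric.closedBall (0 : E n) 1 := (kleinInv_mem le_rfl).1
    have h1 : proj n (signSO n ε.1) ⟨kleinInv 0, hmem⟩ = ⟨kleinInv 0, hmem⟩ := by
      refine Subtype.ext ?_
      ext i
      rw [proj_signSO_apply]
      by_cases hi : i = 0
      · subst hi
        have : ε.1.1 0 = 1 := ε.2
        simp [this]
      · simp [kleinInv, hi]
    rw [kleinOfInv, ballExt_of_mem _ hmem, ballExt_coe]
    simp [conjAction, h1]
  have : Fintype (axisSigns n) := Fintype.ofFinite _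
  obtain ⟨γ, w, h1, h2, h3, h4, h5, h6⟩ := exists_curve_of_finite_group
    (H := axisSigns n) (R := fun ε => ballExt (conjAction ψ (signSO n ε.1)))
    (norm_kleinOfInv_eq_one hψ rfl) (fun ε => hR _ _ (kleinOfInv_mem _))
    (fun ε v _ => ballExt_mem _ _)
    (fun g h v hv => by
      rw [← ballExt_comp _ _ hv]
      simp [ballExt_of_mem _ hv])
    (fun v hv => by simp [ballExt_of_mem _ hv]) hfix
  refine ⟨γ, w, h1, h2, h3, h4, h5, ?_⟩
  have h7 : ∀ᶠ s in 𝓝[≥] (0 : ℝ), γ s ≠ poleOf ψ := by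
    refine nhdsWithin_le_nhds (h1.continuousAt.eventually_ne ?_)
    rw [h2]
    exact kleinOfInv_ne le_rfl
  filter_upwards [h6, h7] with s h8 h9
  exact ⟨h8.1, h9, horiz_kleinOf_eq_zero hn h8.1 h8.2⟩

open Filter Topology in
/-- Near a boundary point, the compactification is parametrized, analytically and up to the
boundary, by the half-space coordinates after a change of variable `f` of the height. The horizontal
translates of the axis curve are analytic in the height, and jointly analytic inside the ball, so
that `exists_analyticAt_of_separately` yields joint analyticity at some boundary point; the
translations carry it to the others. -/
theorem exists_analytic_parametrization (hn : 3 ≤ n) (hψ : IsCompactification ψ) :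
    ∃ (f : ℝ → ℝ) (G : E n → E n), f 0 = 0 ∧ (∀ᶠ s in 𝓝[>] (0 : ℝ), 0 < f s) ∧
      AnalyticAt ℝ G 0 ∧ G 0 = kleinOfInv ψ 0 ∧
      (∀ᶠ z in 𝓝 (0 : E n), 0 ≤ z 0 → 0 ≤ f (z 0) ∧
        G z = kleinOfInv ψ (horiz z + EuclideanSpace.single 0 (f (z 0)))) ∧
      inner ℝ (kleinOfInv ψ 0) (fderiv ℝ G 0 (EuclideanSpace.single 0 1)) < 0 := by
  obtain ⟨γ, w, hγ, hγ0, hγw, hw, hγlt, hγax⟩ := exists_axis_curve hn hψ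
  have hR : ∀ b : E n, AnalyticOn ℝ (ballExt (conjAction ψ (transSO b))) (Metric.closedBall 0 1) :=
    fun b => (analyticBallMapOn_iff subset_rfl).mp (hψ.analyticBallMapOn_conjAction _)
  set f : ℝ → ℝ := fun s => kleinOf ψ (γ s) 0 with hf
  have hf0 : f 0 = 0 := by
    simp only [hf, hγ0]
    rw [kleinOf_kleinOfInv le_rfl]
    rfl
  have hfnn : ∀ s, 0 ≤ f s := fun s => kleinOf_zero_nonneg _
  have hev : ∀ᶠ s in 𝓝[>] (0 : ℝ), AnalyticAt ℝ γ s ∧ ‖γ s‖ < 1 ∧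
      (γ s ∈ Metric.closedBall (0 : E n) 1 ∧ γ s ≠ poleOf ψ ∧ horiz (kleinOf ψ (γ s)) = 0) :=
    Eventually.and (nhdsWithin_le_nhds hγ.eventually_analyticAt) (Eventually.and hγlt
      (nhdsWithin_mono _ Set.Ioi_subset_Ici_self hγax))
  obtain ⟨ε, hε, hεs⟩ := (mem_nhdsGT_iff_exists_Ioo_subset).mp hev
  have hε : 0 < ε := hε
  have hcb : ∀ s ∈ Set.Ico 0 ε, γ s ∈ Metric.closedBall (0 : E n) 1 ∧ γ s ≠ poleOf ψ ∧
      horiz (kleinOf ψ (γ s)) = 0 := by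
    rintro s ⟨hs, hsε⟩
    rcases hs.eq_or_lt with rfl | hs
    · exact hγax.self_of_nhdsWithin Set.self_mem_Ici
    · exact (hεs ⟨hs, hsε⟩).2.2
  have hax : ∀ s ∈ Set.Ico 0 ε, kleinOf ψ (γ s) = EuclideanSpace.single 0 (f s) := by
    intro s hs
    rw [← horiz_add_single (kleinOf ψ (γ s)), (hcb s hs).2.2, zero_add]
  have hγf : ∀ s ∈ Set.Ico 0 ε, γ s = kleinOfInv ψ (EuclideanSpace.single 0 (f s)) := by
    intro s hs
    rw [← hax s hs, kleinOfInv_kleinOf (hcb s hs).1 (hcb s hs).2.1]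
  have hfpos : ∀ s ∈ Set.Ioo 0 ε, 0 < f s := fun s hs =>
    (kleinOf_zero_pos_iff (hcb s ⟨hs.1.le, hs.2⟩).1 (hcb s ⟨hs.1.le, hs.2⟩).2.1 hψ).mpr
      (hεs hs).2.1
  -- the family of the translates of the curve
  set K : E n × ℝ → E n := fun z => kleinOfInv ψ (horiz z.1 + EuclideanSpace.single 0 (f z.2))
    with hK
  have hKR : ∀ b, ∀ s ∈ Set.Ico 0 ε,
      K (b, s) = ballExt (conjAction ψ (transSO b)) (γ s) := by
    intro b s hs
    rw [hγf s hs, ballExt_conjAction_kleinOfInv _ (by simpa using hfnn s), add_comm]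
  have hK0 : ∀ b, AnalyticWithinAt ℝ (fun s => K (b, s)) (Set.Ici 0) 0 := by
    intro b
    have h0 : (0 : ℝ) ∈ Set.Ico 0 ε := ⟨le_rfl, hε⟩
    have h1 : AnalyticWithinAt ℝ (ballExt (conjAction ψ (transSO b)) ∘ γ) (Set.Ico 0 ε) 0 :=
      AnalyticWithinAt.comp (hR b _ (hcb 0 h0).1) hγ.analyticWithinAt fun s hs => (hcb s hs).1
    have h2 : AnalyticWithinAt ℝ (fun s => K (b, s)) (Set.Ico 0 ε) 0 :=
      h1.congr (fun s hs => hKR b s hs) (hKR b 0 h0)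
    exact h2.mono_of_mem_nhdsWithin (Ico_mem_nhdsGE hε)
  have hK1 : ∀ b, ∀ s ∈ Set.Ioo 0 ε, AnalyticAt ℝ K (b, s) := by
    intro b s hs
    have h1 : AnalyticAt ℝ (fun s => kleinOf ψ (γ s)) s :=
      (analyticAt_kleinOf hψ (hεs hs).2.1).comp (hεs hs).1
    have h2 : AnalyticAt ℝ f s := ((contDiffAt_euclidean.mp h1.contDiffAt) 0).analyticAt
    refine AnalyticAt.comp (g := kleinOfInv ψ) (analyticAt_kleinOfInv hψ ?_) ?_
    · simpa using hfpos s hs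
    · refine (ContDiffAt.add ?_ ?_).analyticAt
      · exact contDiff_horiz.contDiffAt.comp _ contDiffAt_fst
      · exact contDiff_single_zero.contDiffAt.comp _
          (ContDiffAt.comp (g := f) (f := Prod.snd) (b, s) h2.contDiffAt contDiffAt_snd)
  obtain ⟨b, H, hH, hHK⟩ := exists_analyticAt_of_separately hε hK0 hK1
  have hHb : H (b, 0) = K (b, 0) := (hHK.self_of_nhds le_rfl).symm
  have hKmem : ∀ z, K z ∈ Metric.closedBall (0 : E n) 1 := fun z => kleinOfInv_mem _
  -- a translation carries the point found to the origin
  obtain ⟨S, hRS, hS⟩ := analyticWithinAt_iff_exists_analyticAt.mp (hR (-b) _ (hKmem (b, 0)))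
  rw [Set.insert_eq_of_mem (hKmem _)] at hRS
  set T : E n → E n × ℝ := fun z => (horiz z + b, z 0) with hT
  have hTan : AnalyticAt ℝ T 0 := by
    refine ContDiffAt.analyticAt ?_
    exact (contDiff_horiz.contDiffAt.add contDiffAt_const).prodMk (by fun_prop)
  have hT0 : T 0 = (b, 0) := by simp [hT]
  have hTt : Tendsto T (𝓝 0) (𝓝 (b, 0)) := hT0 ▸ hTan.continuousAt.tendsto
  have hHt : Tendsto (fun z => H (T z)) (𝓝 0) (𝓝 (K (b, 0))) := by
    rw [← hHb]
    exact hH.continuousAt.tendsto.comp hTt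
  have hKT : ∀ z : E n, ballExt (conjAction ψ (transSO (-b))) (K (T z))
      = kleinOfInv ψ (horiz z + EuclideanSpace.single 0 (f (z 0))) := by
    intro z
    simp only [hK, hT]
    rw [ballExt_conjAction_kleinOfInv _ (by simpa using hfnn _), horiz_add, horiz_horiz, horiz_neg]
    congr 1
    abel
  have hGK : ∀ᶠ z in 𝓝 (0 : E n), 0 ≤ z 0 →
      S (H (T z)) = kleinOfInv ψ (horiz z + EuclideanSpace.single 0 (f (z 0))) := by
    filter_upwards [hTt hHK, hHt (eventually_nhdsWithin_iff.mp hRS)] with z h1 h2 hz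
    have h1 : K (T z) = H (T z) := h1 hz
    rw [← hKT, h1]
    have h3 : H (T z) ∈ Metric.closedBall (0 : E n) 1 := h1 ▸ hKmem (T z)
    exact (h2 h3).symm
  have hG : AnalyticAt ℝ (fun z => S (H (T z))) 0 := by
    have h1 : AnalyticAt ℝ (fun z => H (T z)) 0 := hH.comp_of_eq hTan hT0
    refine hS.comp_of_eq h1 ?_
    rw [hT0, hHb]
  have hG0 : S (H (T 0)) = kleinOfInv ψ 0 := by
    have := hGK.self_of_nhds le_rfl
    simpa [hf0] using this
  refine ⟨f, fun z => S (H (T z)), hf0, ?_, hG, hG0, ?_, ?_⟩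
  · exact mem_of_superset (Ioo_mem_nhdsGT hε) hfpos
  · filter_upwards [hGK] with z hz hz0
    exact ⟨hfnn _, hz hz0⟩
  · have hGd := hG.differentiableAt.hasFDerivAt
    have h1 : HasDerivAt (fun s : ℝ => (EuclideanSpace.single 0 s : E n))
        (EuclideanSpace.single 0 1) 0 := by
      have h2 : HasDerivAt (fun s : ℝ => s • (EuclideanSpace.single 0 1 : E n))
          ((1 : ℝ) • EuclideanSpace.single 0 1) 0 := (hasDerivAt_id (0 : ℝ)).smul_const _
      simpa only [smul_single_zero_one, one_smul] using h2
    have h3 := (hGd.comp_hasDerivAt_of_eq (0 : ℝ) h1 (by simp)).hasDerivWithinAt (s := Set.Ici 0)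
    have h4 : HasDerivWithinAt γ w (Set.Ici 0) 0 := hγw.hasDerivWithinAt
    have h5 : ∀ᶠ s in 𝓝[≥] (0 : ℝ), ((fun z => S (H (T z))) ∘
        fun s : ℝ => (EuclideanSpace.single 0 s : E n)) s = γ s := by
      have hc : Tendsto (fun s : ℝ => (EuclideanSpace.single 0 s : E n)) (𝓝 0) (𝓝 0) := by
        have := h1.continuousAt.tendsto
        simpa using this
      filter_upwards [nhdsWithin_le_nhds (hc hGK), Ico_mem_nhdsGE hε] with s hs hs'
      have := hs (by simpa using hs'.1)
      simp only [Function.comp_apply, this, hγf s hs']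
      simp
    have h6 := h4.congr_of_eventuallyEq h5 (h5.self_of_nhdsWithin Set.self_mem_Ici)
    have h7 := (uniqueDiffWithinAt_Ici (0 : ℝ)).eq_deriv _ h3 h6
    rw [h7]
    exact hw

end

/-! ### Half-space coordinates of a compactification -/

section

variable {n : ℕ} [NeZero n] {ψ : CBall n ≃ₜ CBall n}

open Filter Topology Metric in
/-- A horizontal line cannot stop in the differentiable structure of the compactification: since
the translations are differentiable, its derivative would vanish everywhere. -/
theorem eq_zero_of_hasDerivAt_kleinOfInv_line (hψ : IsCompactification ψ) {b : E n} (hb : b 0 = 0)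
    (h : HasDerivAt (fun t : ℝ => kleinOfInv ψ (t • b)) 0 0) : b = 0 := by
  have hR : ∀ b : E n, AnalyticOn ℝ (ballExt (conjAction ψ (transSO b))) (closedBall 0 1) :=
    fun b => (analyticBallMapOn_iff subset_rfl).mp (hψ.analyticBallMapOn_conjAction _)
  have hz : ∀ t : ℝ, (t • b) 0 = 0 := fun t => by simp [hb]
  have hall : ∀ s : ℝ, HasDerivAt (fun t : ℝ => kleinOfInv ψ (t • b)) 0 s := by
    intro s
    obtain ⟨A, hA⟩ : ∃ A : E n →L[ℝ] E n, HasFDerivWithinAt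
        (ballExt (conjAction ψ (transSO (s • b)))) A (closedBall 0 1) (kleinOfInv ψ ((0 : ℝ) • b)) := by
      have := (hR (s • b) _ (kleinOfInv_mem (ψ := ψ) ((0 : ℝ) • b))).differentiableWithinAt
      rw [Set.insert_eq_of_mem (kleinOfInv_mem _)] at this
      exact this
    have h1 : HasDerivAt (ballExt (conjAction ψ (transSO (s • b))) ∘
        fun t : ℝ => kleinOfInv ψ (t • b)) (A 0) 0 := by
      have h0 := h.hasDerivWithinAt (s := Set.univ)
      rw [← hasDerivWithinAt_univ]
      exact hA.comp_hasDerivWithinAt (0 : ℝ) h0 fun t _ => kleinOfInv_mem _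
    have h2 : (ballExt (conjAction ψ (transSO (s • b))) ∘ fun t : ℝ => kleinOfInv ψ (t • b))
        = fun t : ℝ => kleinOfInv ψ ((t + s) • b) := by
      funext t
      simp only [Function.comp_apply]
      rw [ballExt_conjAction_kleinOfInv _ (hz t).ge, horiz_eq_self (hz s), add_smul]
    rw [h2, map_zero] at h1
    have h3 : HasDerivAt (fun t : ℝ => kleinOfInv ψ ((t + s) • b)) 0 (s + -s) := by
      rwa [add_neg_cancel]
    have h4 := h3.comp_add_const s (-s)
    simpa using h4
  have hconst := is_const_of_deriv_eq_zero (fun s => (hall s).differentiableAt)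
    (fun s => (hall s).deriv) 1 0
  have h1 := congrArg (kleinOf ψ) hconst
  simp only [one_smul, zero_smul] at h1
  rwa [kleinOf_kleinOfInv hb.ge, kleinOf_kleinOfInv le_rfl] at h1

open Filter Topology Metric in
/-- The parametrization of the compactification near a boundary point is an immersion. -/
theorem injective_fderiv_parametrization (hψ : IsCompactification ψ) {f : ℝ → ℝ} {G : E n → E n}
    (hf0 : f 0 = 0) (hG : AnalyticAt ℝ G 0)
    (hGf : ∀ᶠ z in 𝓝 (0 : E n), 0 ≤ z 0 → 0 ≤ f (z 0) ∧
        G z = kleinOfInv ψ (horiz z + EuclideanSpace.single 0 (f (z 0))))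
    (hw : inner ℝ (kleinOfInv ψ 0) (fderiv ℝ G 0 (EuclideanSpace.single 0 1)) < 0) :
    Function.Injective (fderiv ℝ G 0) := by
  rw [injective_iff_map_eq_zero]
  intro v hv
  have hGd := hG.differentiableAt.hasFDerivAt
  have hline : HasDerivAt (fun t : ℝ => t • horiz v) (horiz v) 0 := by
    simpa using (hasDerivAt_id (0 : ℝ)).smul_const (horiz v)
  have h1 : HasDerivAt (fun t : ℝ => G (t • horiz v)) (fderiv ℝ G 0 (horiz v)) 0 :=
    hGd.comp_hasDerivAt_of_eq (0 : ℝ) hline (by simp)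
  have hz : ∀ t : ℝ, (t • horiz v) 0 = 0 := fun t => by simp
  have h2 : (fun t : ℝ => G (t • horiz v)) =ᶠ[𝓝 0] fun t : ℝ => kleinOfInv ψ (t • horiz v) := by
    have hc : Tendsto (fun t : ℝ => t • horiz v) (𝓝 0) (𝓝 0) := by
      simpa using hline.continuousAt.tendsto
    filter_upwards [hc hGf] with t ht
    have := (ht (hz t).ge).2
    rw [this, hz, hf0, horiz_eq_self (hz t), single_zero_zero, add_zero]
  have h3 := h1.congr_of_eventuallyEq h2.symm
  have h4 : inner ℝ (kleinOfInv ψ 0) (fderiv ℝ G 0 (horiz v)) = 0 := by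
    have h5 := h3.norm_sq
    have h6 : (fun t : ℝ => ‖kleinOfInv ψ (t • horiz v)‖ ^ 2) = fun _ => 1 := by
      funext t
      rw [norm_kleinOfInv_eq_one hψ (hz t), one_pow]
    rw [h6] at h5
    have h7 := h5.unique (hasDerivAt_const _ _)
    simp only [zero_smul] at h7
    linarith
  have h0 : v 0 = 0 := by
    have h5 : fderiv ℝ G 0 (horiz v) + v 0 • fderiv ℝ G 0 (EuclideanSpace.single 0 1) = 0 := by
      rw [← map_smul, ← map_add, smul_single_zero_one, horiz_add_single, hv]
    have h6 := congrArg (fun u => inner ℝ (kleinOfInv ψ 0) u) h5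
    simp only [inner_add_right, inner_smul_right, inner_zero_right, h4, zero_add] at h6
    exact (mul_eq_zero.mp h6).resolve_right hw.ne
  have hvv := horiz_eq_self h0
  rw [hvv] at h3
  rw [hv] at h3
  exact eq_zero_of_hasDerivAt_kleinOfInv_line hψ h0 h3

open Filter Topology Metric in
/-- Each point of the ball near the boundary point comes from small half-space coordinates: by
the intermediate value theorem, `f` takes all small nonnegative values near `0`. -/
theorem eventually_exists_coordinates {f : ℝ → ℝ} {G : E n → E n}
    (hf0 : f 0 = 0) (hfpos : ∀ᶠ s in 𝓝[>] (0 : ℝ), 0 < f s) (hG : AnalyticAt ℝ G 0)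
    (hGf : ∀ᶠ z in 𝓝 (0 : E n), 0 ≤ z 0 → 0 ≤ f (z 0) ∧
        G z = kleinOfInv ψ (horiz z + EuclideanSpace.single 0 (f (z 0))))
    {U : Set (E n)} (hU : U ∈ 𝓝 0) :
    ∀ᶠ v in 𝓝[closedBall 0 1] (kleinOfInv ψ 0), ∃ z ∈ U, 0 ≤ z 0 ∧
      horiz z = horiz (kleinOf ψ v) ∧ f (z 0) = kleinOf ψ v 0 := by
  have hsingle : Tendsto (fun s : ℝ => (EuclideanSpace.single 0 s : E n)) (𝓝 0) (𝓝 0) := by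
    have := (contDiff_single_zero (n := n)).continuous.tendsto 0
    rwa [single_zero_zero] at this
  -- continuity of the change of height
  obtain ⟨δ, hδ, hδs⟩ : ∃ δ > 0, ContinuousOn f (Set.Icc 0 δ) := by
    have h1 : ∀ᶠ s : ℝ in 𝓝 0, AnalyticAt ℝ G (EuclideanSpace.single 0 s) ∧
        (0 ≤ s → 0 ≤ f s ∧ G (EuclideanSpace.single 0 s)
          = kleinOfInv ψ (EuclideanSpace.single 0 (f s))) := by
      refine (hsingle.eventually hG.eventually_analyticAt).and ?_
      filter_upwards [hsingle hGf] with s hs hs0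
      have := hs (by simpa using hs0)
      simpa using this
    obtain ⟨δ, hδ, hb⟩ := Metric.eventually_nhds_iff_ball.mp h1
    have hmem : ∀ s ∈ Set.Icc 0 (δ / 2), s ∈ ball (0 : ℝ) δ := by
      intro s hs
      rw [mem_ball_zero_iff, Real.norm_of_nonneg hs.1]
      linarith [hs.2]
    refine ⟨δ / 2, by positivity, ?_⟩
    have h2 : ∀ s ∈ Set.Icc 0 (δ / 2), f s = kleinOf ψ (G (EuclideanSpace.single 0 s)) 0 := by
      intro s hs
      have := (hb s (hmem s hs)).2 hs.1
      rw [this.2, kleinOf_kleinOfInv (by simpa using this.1)]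
      simp
    have h3 : ContinuousOn (fun s : ℝ => kleinOf ψ (G (EuclideanSpace.single 0 s)))
        (Set.Icc 0 (δ / 2)) := by
      refine (continuousOn_kleinOf (ψ := ψ)).comp ?_ ?_
      · intro s hs
        exact ((hb s (hmem s hs)).1.continuousAt.comp (f := fun s : ℝ =>
          (EuclideanSpace.single 0 s : E n))
          (contDiff_single_zero (n := n)).continuous.continuousAt).continuousWithinAt
      · intro s hs
        have := (hb s (hmem s hs)).2 hs.1
        simp only [this.2]
        exact ⟨kleinOfInv_mem _, kleinOfInv_ne (by simpa using this.1)⟩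
    have h4 : ContinuousOn (fun s : ℝ => kleinOf ψ (G (EuclideanSpace.single 0 s)) 0)
        (Set.Icc 0 (δ / 2)) := (EuclideanSpace.proj (𝕜 := ℝ) (0 : Fin n)).continuous.comp_continuousOn h3
    exact h4.congr h2
  have hadd : Tendsto (fun p : E n × ℝ => horiz p.1 + (EuclideanSpace.single 0 p.2 : E n))
      (𝓝 (0, 0)) (𝓝 0) := by
    have h1 : Continuous fun p : E n × ℝ => horiz p.1 + (EuclideanSpace.single 0 p.2 : E n) :=
      (contDiff_horiz.continuous.comp continuous_fst).add
        (contDiff_single_zero.continuous.comp continuous_snd)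
    simpa using h1.tendsto (0, 0)
  have hU' := hadd hU
  rw [nhds_prod_eq] at hU'
  obtain ⟨U₁, hU₁, U₂, hU₂, hUU⟩ := Filter.mem_prod_iff.mp hU'
  obtain ⟨ρ, hρ, hρU⟩ := Metric.mem_nhds_iff.mp hU₂
  -- a small height at which `f` is positive
  obtain ⟨s₁, hs₁f, hs₁δ, hs₁⟩ : ∃ s₁, 0 < f s₁ ∧ s₁ < min δ ρ ∧ 0 < s₁ := by
    have h1 : ∀ᶠ s : ℝ in 𝓝[>] 0, s < min δ ρ :=
      nhdsWithin_le_nhds (gt_mem_nhds (lt_min hδ hρ))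
    obtain ⟨s, ⟨h2, h3⟩, h4⟩ := ((hfpos.and h1).and self_mem_nhdsWithin).exists
    exact ⟨s, h2, h3, h4⟩
  have hcont : Tendsto (kleinOf ψ) (𝓝[closedBall 0 1] (kleinOfInv ψ 0)) (𝓝 0) := by
    have h1 := continuousOn_kleinOf (ψ := ψ) (kleinOfInv ψ 0)
      ⟨kleinOfInv_mem _, kleinOfInv_ne le_rfl⟩
    have h2 : closedBall (0 : E n) 1 \ {poleOf ψ} ∈ 𝓝[closedBall 0 1] (kleinOfInv ψ 0) :=
      inter_mem self_mem_nhdsWithin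
        (nhdsWithin_le_nhds (isOpen_compl_singleton.mem_nhds (kleinOfInv_ne le_rfl)))
    have h3 := h1.mono_of_mem_nhdsWithin h2
    have h4 : kleinOf ψ (kleinOfInv ψ 0) = 0 := kleinOf_kleinOfInv le_rfl
    have h5 := h3.tendsto
    rwa [h4] at h5
  have hcont0 : Tendsto (fun v => kleinOf ψ v 0) (𝓝[closedBall 0 1] (kleinOfInv ψ 0)) (𝓝 0) := by
    have := ((EuclideanSpace.proj (𝕜 := ℝ) (0 : Fin n)).continuous.tendsto 0).comp hcont
    simpa [Function.comp_def] using this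
  filter_upwards [hcont hU₁, hcont0 (gt_mem_nhds hs₁f)] with v h1 h2
  have h2 : kleinOf ψ v 0 < f s₁ := h2
  have hsub : Set.Icc 0 s₁ ⊆ Set.Icc 0 δ :=
    Set.Icc_subset_Icc_right (hs₁δ.le.trans (min_le_left _ _))
  obtain ⟨s, hs, hfs⟩ := intermediate_value_Icc hs₁.le (hδs.mono hsub)
    (show kleinOf ψ v 0 ∈ Set.Icc (f 0) (f s₁) from ⟨by rw [hf0]; exact kleinOf_zero_nonneg v, h2.le⟩)
  refine ⟨horiz (kleinOf ψ v) + EuclideanSpace.single 0 s, ?_, ?_, ?_, ?_⟩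
  · refine hUU (Set.mk_mem_prod (a := kleinOf ψ v) (b := s) h1 (hρU ?_))
    rw [mem_ball_zero_iff, Real.norm_of_nonneg hs.1]
    exact hs.2.trans_lt (hs₁δ.trans_le (min_le_right _ _))
  · simpa using hs.1
  · rw [horiz_add, horiz_horiz, horiz_single_zero, add_zero]
  · simpa using hfs

open Filter Topology Metric in
/-- Analytic half-space coordinates near a boundary point of a compactification, up to the change
of variable `f` of the height. -/
theorem exists_analytic_coordinates (hn : 3 ≤ n) (hψ : IsCompactification ψ) :
    ∃ (f : ℝ → ℝ) (G L : E n → E n), f 0 = 0 ∧ (∀ᶠ s in 𝓝[>] (0 : ℝ), 0 < f s) ∧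
      AnalyticAt ℝ G 0 ∧ G 0 = kleinOfInv ψ 0 ∧
      (∀ᶠ z in 𝓝 (0 : E n), 0 ≤ z 0 → 0 ≤ f (z 0) ∧
        G z = kleinOfInv ψ (horiz z + EuclideanSpace.single 0 (f (z 0)))) ∧
      AnalyticAt ℝ L (kleinOfInv ψ 0) ∧ (∀ᶠ z in 𝓝 (0 : E n), L (G z) = z) ∧
      ∀ᶠ v in 𝓝[closedBall 0 1] (kleinOfInv ψ 0), 0 ≤ L v 0 ∧
        horiz (L v) = horiz (kleinOf ψ v) ∧ f (L v 0) = kleinOf ψ v 0 := by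
  obtain ⟨f, G, hf0, hfpos, hG, hG0, hGf, hw⟩ := exists_analytic_parametrization hn hψ
  have hinj := injective_fderiv_parametrization hψ hf0 hG hGf hw
  set D : E n ≃L[ℝ] E n :=
    (LinearEquiv.ofInjectiveEndo (fderiv ℝ G 0 : E n →ₗ[ℝ] E n) hinj).toContinuousLinearEquiv
    with hD
  have hDG : (D : E n →L[ℝ] E n) = fderiv ℝ G 0 := by
    ext v
    rfl
  have hGD : HasStrictFDerivAt G (D : E n →L[ℝ] E n) 0 := hDG ▸ hG.hasStrictFDerivAt
  set e := hGD.toOpenPartialHomeomorph G with he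
  have hesrc : (0 : E n) ∈ e.source := hGD.mem_toOpenPartialHomeomorph_source
  have hecoe : (e : E n → E n) = G := hGD.toOpenPartialHomeomorph_coe
  have hem : e 0 = kleinOfInv ψ 0 := by rw [hecoe, hG0]
  have hesymm0 : e.symm (kleinOfInv ψ 0) = 0 := by rw [← hem, e.left_inv hesrc]
  have htgt : kleinOfInv ψ 0 ∈ e.target := hem ▸ e.map_source hesrc
  have hL : AnalyticAt ℝ e.symm (kleinOfInv ψ 0) := by
    refine e.analyticAt_symm (i := D) htgt ?_ ?_
    · rw [hesymm0, hecoe]; exact hG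
    · rw [hesymm0, hecoe]; exact hGD.hasFDerivAt.fderiv
  have hLG : ∀ᶠ z in 𝓝 (0 : E n), e.symm (G z) = z := by
    filter_upwards [e.open_source.mem_nhds hesrc] with z hz
    rw [← hecoe, e.left_inv hz]
  refine ⟨f, G, e.symm, hf0, hfpos, hG, hG0, hGf, hL, hLG, ?_⟩
  have hne : ∀ᶠ v in 𝓝[closedBall 0 1] (kleinOfInv ψ 0), v ≠ poleOf ψ :=
    nhdsWithin_le_nhds (isOpen_compl_singleton.mem_nhds (kleinOfInv_ne le_rfl))
  filter_upwards [eventually_exists_coordinates hf0 hfpos hG hGf (hGf.and hLG), hne,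
    self_mem_nhdsWithin] with v hv hvp hvb
  obtain ⟨z, ⟨hz1, hz2⟩, hz0, hzh, hzf⟩ := hv
  have h1 : G z = v := by
    rw [(hz1 hz0).2, hzh, hzf, horiz_add_single, kleinOfInv_kleinOf hvb hvp]
  rw [← h1, hz2, h1]
  exact ⟨hz0, hzh, hzf⟩

end

/-! ### The exponent of an arbitrary compactification -/

section

variable {n : ℕ} [NeZero n] {ψ : CBall n ≃ₜ CBall n}

theorem ballExt_conjAction_signSO {ε : evenSigns n} (hε : ε.1 0 = -1) {z : E n} (hz : 0 ≤ z 0)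
    (hq : 0 < ‖z‖ ^ 2 - z 0 ^ 2 + z 0) :
    ballExt (conjAction ψ (signSO n ε)) (kleinOfInv ψ z)
      = kleinOfInv ψ (WithLp.toLp 2 fun i => if i = 0 then z 0 / (‖z‖ ^ 2 - z 0 ^ 2 + z 0) ^ 2
        else ((ε.1 i : ℤ) : ℝ) * z i / (‖z‖ ^ 2 - z 0 ^ 2 + z 0)) := by
  have h1 := coord_lt_one (mem_closedBall_zero_iff.mp (kleinInv_mem hz).1) (kleinInv_mem hz).2
  have h2 : -1 < kleinInv z 0 := by
    have h3 : kleinInv z 0 = 1 - 2 / (1 + (‖z‖ ^ 2 - z 0 ^ 2) + z 0) := by simp [kleinInv]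
    have h4 : 2 / (1 + (‖z‖ ^ 2 - z 0 ^ 2) + z 0) < 2 := by
      rw [div_lt_iff₀ (den_klein_pos hz)]
      linarith
    linarith
  rw [← kleinFun_proj_signSO hε (x := ⟨kleinInv z, (kleinInv_mem hz).1⟩) h1 h2
    (kleinFun_kleinInv hz)]
  rw [kleinOfInv, kleinOfInv, kleinInv_kleinFun, ballExt_of_mem _ (kleinInv_mem hz).1, ballExt_coe,
    ballExt_coe]
  · simp [conjAction]
  · rw [proj_signSO_apply, hε]
    push_cast
    linarith

open Filter Topology Metric in
/-- The change of variable `f` of the height is analytic up to the boundary. The coordinates `L` are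
analytic, and their horizontal part is that of the half-space; a translation and an inversion turn
the height `t` over the origin into the horizontal coordinate `-1 / (1 + t)`. -/
theorem analyticWithinAt_height (hn : 2 ≤ n) (hψ : IsCompactification ψ) {f : ℝ → ℝ}
    {G L : E n → E n} (hf0 : f 0 = 0) (hG : AnalyticAt ℝ G 0)
    (hGf : ∀ᶠ z in 𝓝 (0 : E n), 0 ≤ z 0 → 0 ≤ f (z 0) ∧
        G z = kleinOfInv ψ (horiz z + EuclideanSpace.single 0 (f (z 0))))
    (hL : AnalyticAt ℝ L (kleinOfInv ψ 0))
    (hLk : ∀ᶠ v in 𝓝[closedBall 0 1] (kleinOfInv ψ 0), 0 ≤ L v 0 ∧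
        horiz (L v) = horiz (kleinOf ψ v) ∧ f (L v 0) = kleinOf ψ v 0) :
    AnalyticWithinAt ℝ f (Set.Ici 0) 0 := by
  have : Nontrivial (Fin n) := Fin.nontrivial_iff_two_le.mpr hn
  obtain ⟨j, hj⟩ := exists_ne (0 : Fin n)
  have hR : ∀ g, AnalyticOn ℝ (ballExt (conjAction ψ g)) (closedBall 0 1) :=
    fun g => (analyticBallMapOn_iff subset_rfl).mp (hψ.analyticBallMapOn_conjAction _)
  set e : E n := EuclideanSpace.single j 1 with he
  have he0 : e 0 = 0 := by simp [he, hj.symm]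
  have hej : e j = 1 := by simp [he]
  have hhe : horiz e = e := horiz_eq_self he0
  set ε := flipSigns 0 j hj.symm with hε
  have hε0 : ε.1 0 = -1 := by simp [hε, flipSigns]
  have hεj : ε.1 j = -1 := by simp [hε, flipSigns]
  set R := ballExt (conjAction ψ (transSO e)) with hRdef
  set I := ballExt (conjAction ψ (signSO n ε)) with hIdef
  have hsingle : Tendsto (fun s : ℝ => (EuclideanSpace.single 0 s : E n)) (𝓝 0) (𝓝 0) := by
    have := (contDiff_single_zero (n := n)).continuous.tendsto 0
    rwa [single_zero_zero] at this
  set Γ : ℝ → E n := fun s => G (EuclideanSpace.single 0 s) with hΓ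
  have hΓan : AnalyticAt ℝ Γ 0 := by
    refine hG.comp_of_eq (f := fun s : ℝ => (EuclideanSpace.single 0 s : E n))
      (contDiff_single_zero (n := n)).contDiffAt.analyticAt (by simp)
  have hΓf : ∀ᶠ s in 𝓝[≥] (0 : ℝ), 0 ≤ f s ∧ Γ s = kleinOfInv ψ (EuclideanSpace.single 0 (f s)) := by
    filter_upwards [nhdsWithin_le_nhds (hsingle hGf), self_mem_nhdsWithin] with s hs hs0
    have hs0 : 0 ≤ s := hs0
    have := hs (by simpa using hs0)
    simpa using this
  -- the image under the two translations and the inversion, in half-space coordinates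
  set W : ℝ → E n := fun t => (WithLp.toLp 2 fun i => if i = 0 then t / (1 + t) ^ 2
    else ((ε.1 i : ℤ) : ℝ) * (EuclideanSpace.single 0 t + e : E n) i / (1 + t)) with hW
  have huW : ∀ t : ℝ, 0 ≤ t → R (I (R (kleinOfInv ψ (EuclideanSpace.single 0 t))))
      = kleinOfInv ψ (W t + e) := by
    intro t ht
    have hz0 : (EuclideanSpace.single 0 t + e : E n) 0 = t := by simp [he0]
    have hnn : ‖(EuclideanSpace.single 0 t + e : E n)‖ ^ 2
        - (EuclideanSpace.single 0 t + e : E n) 0 ^ 2 = 1 := by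
      rw [norm_sq_split, add_sub_cancel_left, Finset.sum_eq_single j]
      · simp [hj, he]
      · intro i hi hij
        simp [(Finset.mem_erase.mp hi).1, he, hij]
      · simp [hj]
    rw [hRdef, ballExt_conjAction_kleinOfInv _ (by simpa using ht), hhe, hIdef,
      ballExt_conjAction_signSO hε0 (by rw [hz0]; exact ht) (by rw [hnn, hz0]; linarith), hnn, hz0,
      ballExt_conjAction_kleinOfInv _ (by simp only [if_true]; positivity), hhe]
  set u : ℝ → E n := fun s => R (I (R (Γ s))) with hu
  have huf : ∀ᶠ s in 𝓝[≥] (0 : ℝ), 0 ≤ f s ∧ u s = kleinOfInv ψ (W (f s) + e) := by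
    filter_upwards [hΓf] with s hs
    exact ⟨hs.1, by rw [← huW _ hs.1, ← hs.2]⟩
  have hW0 : W 0 + e = 0 := by
    ext i
    by_cases hi : i = 0
    · subst hi
      simp [hW, he0]
    · by_cases hij : i = j
      · subst hij
        simp [hW, hi, hεj, hej]
      · simp [hW, hi, he, hij]
  have hu0 : u 0 = kleinOfInv ψ 0 := by
    have := (huf.self_of_nhdsWithin Set.self_mem_Ici).2
    rwa [hf0, hW0] at this
  have huan : AnalyticWithinAt ℝ u (Set.Ici 0) 0 := by
    set T : Set ℝ := {s | Γ s ∈ closedBall (0 : E n) 1} with hT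
    have hTm : T ∈ 𝓝[≥] (0 : ℝ) := hΓf.mono fun s hs => by
      rw [hs.2]
      exact kleinOfInv_mem _
    have hT0 : Γ 0 ∈ closedBall (0 : E n) 1 := by
      rw [(hΓf.self_of_nhdsWithin Set.self_mem_Ici).2]
      exact kleinOfInv_mem _
    have a1 : AnalyticWithinAt ℝ (R ∘ Γ) T 0 :=
      AnalyticWithinAt.comp (hR _ _ hT0) hΓan.analyticWithinAt fun s hs => hs
    have a2 : AnalyticWithinAt ℝ (I ∘ (R ∘ Γ)) T 0 :=
      AnalyticWithinAt.comp (hR _ _ (ballExt_mem _ _)) a1 fun s hs => ballExt_mem _ _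
    have a3 : AnalyticWithinAt ℝ (R ∘ (I ∘ (R ∘ Γ))) T 0 :=
      AnalyticWithinAt.comp (hR _ _ (ballExt_mem _ _)) a2 fun s hs => ballExt_mem _ _
    exact a3.mono_of_mem_nhdsWithin hTm
  have haan : AnalyticWithinAt ℝ (fun s => L (u s) j) (Set.Ici 0) 0 := by
    have a1 : AnalyticWithinAt ℝ (L ∘ u) (Set.Ici 0) 0 :=
      AnalyticWithinAt.comp (t := Set.univ) (by rw [hu0]; exact hL.analyticWithinAt) huan
        fun s _ => Set.mem_univ _
    exact AnalyticWithinAt.comp (g := fun v : E n => v j) (t := Set.univ)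
      ((EuclideanSpace.proj (𝕜 := ℝ) j).analyticAt _).analyticWithinAt a1 fun s _ => Set.mem_univ _
  have hut : Tendsto u (𝓝[≥] 0) (𝓝[closedBall 0 1] (kleinOfInv ψ 0)) := by
    refine tendsto_nhdsWithin_iff.mpr ⟨?_, Eventually.of_forall fun s => ballExt_mem _ _⟩
    have h1 := huan.continuousWithinAt.tendsto
    rwa [hu0] at h1
  have hfa : ∀ᶠ s in 𝓝[≥] (0 : ℝ), L (u s) j = 1 - (1 + f s)⁻¹ ∧ 0 ≤ f s := by
    filter_upwards [huf, hut hLk] with s h1 h2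
    have h2 : horiz (L (u s)) = horiz (kleinOf ψ (u s)) := h2.2.1
    have h3 := congrArg (fun v : E n => v j) h2
    simp only [horiz_apply_of_ne _ hj] at h3
    have h4 : 0 ≤ (W (f s) + e) 0 := by
      have := h1.1
      simp only [hW, PiLp.add_apply, he0, if_true]
      positivity
    rw [h1.2, kleinOf_kleinOfInv h4] at h3
    rw [h1.2, h3]
    refine ⟨?_, h1.1⟩
    simp only [hW, PiLp.add_apply, hj, if_false, hεj, hej]
    simp [hj]
    ring
  have h0 := (hfa.self_of_nhdsWithin Set.self_mem_Ici).1
  rw [hf0] at h0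
  have h1 : AnalyticWithinAt ℝ (fun s => (1 - L (u s) j)⁻¹ - 1) (Set.Ici 0) 0 :=
    ((analyticWithinAt_const.sub haan).inv (by rw [Pi.sub_apply, h0]; norm_num)).sub
      analyticWithinAt_const
  refine h1.congr_of_eventuallyEq ?_ ?_
  · filter_upwards [hfa] with s hs
    rw [hs.1, sub_sub_cancel, inv_inv, add_sub_cancel_left]
  · rw [h0, hf0]
    norm_num

open Filter Topology in
/-- An analytic function that is positive on the right of its zero `0` is there the `p`-th power of
an analytic change of variable. -/
theorem exists_eq_pow_of_analyticAt {f : ℝ → ℝ} (hf : AnalyticAt ℝ f 0) (hf0 : f 0 = 0)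
    (hpos : ∀ᶠ s in 𝓝[>] (0 : ℝ), 0 < f s) :
    ∃ (p : ℕ) (κ μ : ℝ → ℝ), 1 ≤ p ∧ AnalyticAt ℝ κ 0 ∧ AnalyticAt ℝ μ 0 ∧ κ 0 = 0 ∧ μ 0 = 0 ∧
      (∀ᶠ y in 𝓝 (0 : ℝ), κ (μ y) = y) ∧
      ∀ᶠ s in 𝓝 (0 : ℝ), f s = κ s ^ p ∧ (0 ≤ s ↔ 0 ≤ κ s) := by
  have hne : ¬ ∀ᶠ s in 𝓝 (0 : ℝ), f s = 0 := by
    intro h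
    obtain ⟨s, h1, h2⟩ := (hpos.and (nhdsWithin_le_nhds h)).exists
    exact h1.ne' h2
  obtain ⟨p, g, hg, hg0, hfg⟩ := hf.exists_eventuallyEq_pow_smul_nonzero_iff.mpr hne
  simp only [sub_zero, smul_eq_mul] at hfg
  have hp : 1 ≤ p := by
    rw [Nat.one_le_iff_ne_zero]
    rintro rfl
    have := hfg.self_of_nhds
    rw [hf0, pow_zero, one_mul] at this
    exact hg0 this.symm
  have hgpos : 0 < g 0 := by
    refine lt_of_le_of_ne ?_ (Ne.symm hg0)
    refine ge_of_tendsto (hg.continuousAt.tendsto.mono_left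
      (nhdsWithin_le_nhds (s := Set.Ioi (0 : ℝ)))) ?_
    filter_upwards [hpos, nhdsWithin_le_nhds hfg, self_mem_nhdsWithin] with s h1 h2 h3
    have h3 : 0 < s := h3
    rw [h2] at h1
    exact (pos_of_mul_pos_right h1 (by positivity)).le
  set κ : ℝ → ℝ := fun s => s * g s ^ ((p : ℝ)⁻¹) with hκ
  have hr : AnalyticAt ℝ (fun s => g s ^ ((p : ℝ)⁻¹)) 0 :=
    (hg.contDiffAt.rpow_const_of_ne hgpos.ne').analyticAt
  have hκan : AnalyticAt ℝ κ 0 := analyticAt_id.mul hr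
  have hκ0 : κ 0 = 0 := by simp [hκ]
  have hκd : deriv κ 0 ≠ 0 := by
    have h1 : HasDerivAt κ (1 * g 0 ^ ((p : ℝ)⁻¹) + 0 * _) 0 :=
      (hasDerivAt_id (0 : ℝ)).mul hr.differentiableAt.hasDerivAt
    rw [h1.deriv, zero_mul, one_mul, add_zero]
    exact (Real.rpow_pos_of_pos hgpos _).ne'
  obtain ⟨μ, hμan, hμ0, hκμ⟩ : ∃ μ : ℝ → ℝ, AnalyticAt ℝ μ 0 ∧ μ 0 = 0 ∧
      ∀ᶠ y in 𝓝 (0 : ℝ), κ (μ y) = y := by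
    have h1 := hκan.hasStrictDerivAt
    have h2 := hκan.analyticAt_localInverse hκd
    have h3 := (h1.hasStrictFDerivAt_equiv hκd).localInverse_apply_image
    have h4 := (h1.hasStrictFDerivAt_equiv hκd).eventually_right_inverse
    rw [hκ0] at h2 h3 h4
    exact ⟨_, h2, h3, h4⟩
  refine ⟨p, κ, μ, hp, hκan, hμan, hκ0, hμ0, hκμ, ?_⟩
  filter_upwards [hfg, hg.continuousAt.eventually_const_lt hgpos] with s h1 h2
  refine ⟨?_, ?_⟩
  · rw [h1, hκ, mul_pow, Real.rpow_inv_natCast_pow h2.le (by omega)]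
  · exact (mul_nonneg_iff_of_pos_right (Real.rpow_pos_of_pos h2 _)).symm

open Filter Topology Metric in
/-- In dimension at least `3`, each compactification is itself given by some `φ_p`: with
`f = κ ^ p` on the right of `0`, the chart is obtained from the coordinates `L` by applying `κ` to
the height. -/
theorem exists_isPowerCompactification (hn : 3 ≤ n) (hψ : IsCompactification ψ) :
    ∃ p : ℕ, 1 ≤ p ∧ IsPowerCompactification p ψ := by
  obtain ⟨f, G, L, hf0, hfpos, hG, hG0, hGf, hL, hLG, hLk⟩ := exists_analytic_coordinates hn hψ
  have hfan := analyticWithinAt_height (by omega) hψ hf0 hG hGf hL hLk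
  obtain ⟨F, hfF, hF⟩ := analyticWithinAt_iff_exists_analyticAt.mp hfan
  rw [Set.insert_eq_of_mem Set.self_mem_Ici] at hfF
  have hF0 : F 0 = 0 := by rw [← hfF.self_of_nhdsWithin Set.self_mem_Ici, hf0]
  have hFpos : ∀ᶠ s in 𝓝[>] (0 : ℝ), 0 < F s := by
    filter_upwards [hfpos, nhdsWithin_mono _ Set.Ioi_subset_Ici_self hfF] with s h1 h2
    rwa [← h2]
  obtain ⟨p, κ, μ, hp, hκ, hμ, hκ0, hμ0, hκμ, hFκ⟩ := exists_eq_pow_of_analyticAt hF hF0 hFpos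
  have hfκ : ∀ᶠ s in 𝓝 (0 : ℝ), 0 ≤ s → f s = κ s ^ p ∧ 0 ≤ κ s := by
    filter_upwards [eventually_nhdsWithin_iff.mp hfF, hFκ] with s h1 h2 hs
    exact ⟨(h1 hs).trans h2.1, h2.2.mp hs⟩
  have hcoord : Tendsto (fun z : E n => z 0) (𝓝 0) (𝓝 0) :=
    (EuclideanSpace.proj (𝕜 := ℝ) (0 : Fin n)).continuous.tendsto 0
  have hL0 : L (kleinOfInv ψ 0) = 0 := by rw [← hG0, hLG.self_of_nhds]
  refine ⟨p, hp, isPowerCompactification_of_analyticWithinAt hp hψ ?_ ?_⟩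
  · have h1 : AnalyticAt ℝ (fun v => horiz (L v) + (EuclideanSpace.single 0 (κ (L v 0)) : E n))
        (kleinOfInv ψ 0) := by
      refine ContDiffAt.analyticAt (ContDiffAt.add ?_ ?_)
      · exact contDiff_horiz.contDiffAt.comp _ hL.contDiffAt
      · refine contDiff_single_zero.contDiffAt.comp _ ?_
        refine AnalyticAt.contDiffAt ?_
        refine hκ.comp_of_eq (f := fun v => L v 0)
          (contDiffAt_euclidean.mp hL.contDiffAt 0).analyticAt ?_
        rw [hL0]; rfl
    have h2 : ∀ᶠ v in 𝓝[closedBall 0 1] (kleinOfInv ψ 0), rootMap p (kleinOf ψ v)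
        = horiz (L v) + (EuclideanSpace.single 0 (κ (L v 0)) : E n) := by
      have hLt : Tendsto (fun v => L v 0) (𝓝[closedBall 0 1] (kleinOfInv ψ 0)) (𝓝 0) := by
        refine Tendsto.mono_left ?_ nhdsWithin_le_nhds
        refine hcoord.comp ?_
        have := hL.continuousAt.tendsto
        rwa [hL0] at this
      filter_upwards [hLk, hLt hfκ] with v h3 h4
      obtain ⟨h5, h6, h7⟩ := h3
      obtain ⟨h8, h9⟩ := h4 h5
      refine eq_of_horiz_eq ?_ ?_
      · rw [horiz_add, horiz_horiz, horiz_single_zero, add_zero, h6]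
        ext i
        by_cases hi : i = 0
        · subst hi; simp
        · simp [horiz_apply_of_ne, hi, rootMap_apply_of_ne]
      · rw [rootMap_apply_zero, ← h7, h8, Real.pow_rpow_inv_natCast h9 (by omega)]
        simp
    exact h1.analyticWithinAt.congr_of_eventuallyEq h2 (h2.self_of_nhdsWithin (kleinOfInv_mem _))
  · have h1 : AnalyticAt ℝ (fun z : E n => G (horiz z + (EuclideanSpace.single 0 (μ (z 0)) : E n)))
        0 := by
      refine hG.comp_of_eq (f := fun z : E n => horiz z + (EuclideanSpace.single 0 (μ (z 0)) : E n))
        (ContDiffAt.analyticAt (ContDiffAt.add ?_ ?_)) (by simp [hμ0])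
      · exact contDiff_horiz.contDiffAt
      · refine contDiff_single_zero.contDiffAt.comp _ ?_
        exact ContDiffAt.comp (g := μ) (f := fun z : E n => z 0) _ hμ.contDiffAt (by fun_prop)
    have h2 : ∀ᶠ z in 𝓝[{z : E n | 0 ≤ z 0}] (0 : E n), kleinOfInv ψ (powerMap p z)
        = G (horiz z + (EuclideanSpace.single 0 (μ (z 0)) : E n)) := by
      have hμt : Tendsto (fun z : E n => μ (z 0)) (𝓝 0) (𝓝 0) := by
        have := hμ.continuousAt.tendsto.comp hcoord
        rwa [hμ0] at this
      have hzt : Tendsto (fun z : E n => horiz z + (EuclideanSpace.single 0 (μ (z 0)) : E n))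
          (𝓝 0) (𝓝 0) := by
        have h3 := (contDiff_horiz (n := n)).continuous.tendsto 0
        have h4 := ((contDiff_single_zero (n := n)).continuous.tendsto 0).comp hμt
        have h5 := h3.add h4
        simpa using h5
      filter_upwards [nhdsWithin_le_nhds (hzt hGf), nhdsWithin_le_nhds (hμt hfκ),
        nhdsWithin_le_nhds (hμt hFκ), nhdsWithin_le_nhds (hcoord hκμ), self_mem_nhdsWithin]
        with z h3 h4 h5 h6 hz
      have hz : 0 ≤ z 0 := hz
      have h6 : κ (μ (z 0)) = z 0 := h6
      have h7 : 0 ≤ μ (z 0) := by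
        refine (h5.2).mpr ?_
        rw [h6]
        exact hz
      have h8 := (h3 (by simpa using h7)).2
      rw [h8]
      congr 1
      have h9 := (h4 h7).1
      rw [h6] at h9
      refine eq_of_horiz_eq ?_ ?_
      · rw [horiz_add, horiz_horiz, horiz_add, horiz_horiz, horiz_single_zero, horiz_single_zero]
        ext i
        by_cases hi : i = 0
        · subst hi; simp
        · simp [horiz_apply_of_ne, hi, powerMap_apply_of_ne]
      · rw [powerMap_apply_zero]
        simp [h9]
    exact h1.analyticWithinAt.congr_of_eventuallyEq h2
      (h2.self_of_nhdsWithin (show (0 : ℝ) ≤ (0 : E n) 0 from le_rfl))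

end

theorem theorem1 (n : ℕ) [NeZero n] (hn : 2 ≤ n) :
    (∀ p : ℕ, 1 ≤ p →
      ∃ φ : CBall n ≃ₜ CBall n, IsPowerCompactification p φ ∧ IsAnalyticAction φ) ∧
    (∀ p q : ℕ, 1 ≤ p → 1 ≤ q → ∀ φ ψ : CBall n ≃ₜ CBall n,
      IsPowerCompactification p φ → IsPowerCompactification q ψ →
        (AnalyticallyConjugate φ ψ ↔ p = q)) ∧
    (3 ≤ n → ∀ ψ : CBall n ≃ₜ CBall n, IsCompactification ψ →
      ∃! p : ℕ, 1 ≤ p ∧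
        ∃ φ : CBall n ≃ₜ CBall n, IsPowerCompactification p φ ∧ AnalyticallyConjugate ψ φ) := by
  refine ⟨fun p hp => ⟨radialHomeo n hp, isPowerCompactification_radialHomeo hp,
    isAnalyticAction_radialHomeo hp⟩, fun p q hp hq φ ψ hφ hψ =>
    analyticallyConjugate_iff hn hp hq hφ hψ, fun hn3 ψ hψ => ?_⟩
  obtain ⟨p, hp, hpψ⟩ := exists_isPowerCompactification hn3 hψ
  refine ⟨p, ⟨hp, ψ, hpψ, analyticallyConjugate_refl ψ⟩, ?_⟩
  rintro q ⟨hq, φ, hφ, hconj⟩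
  exact (analyticallyConjugate_iff hn hq hp hφ hpψ).mp hconj.symm
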